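/- Let $G$ be a real symmetric $m\times m$ matrix with distinct eigenvalues $d_1,\dots,d_m$, $G=ODO^{T}$ with $O$ orthogonal and $D=\mathrm{diag}(d_1,\dots,d_m)$. Let $O_i$ be the $i$-th column of $O$ (the $i$-th eigenvector) and $|O_i|^2$ the vector of squares of its entries. Fix $\lambda_*\in\mathbb R$ with $\frac{2-\lambda_*}{2+\lambda_*}\ne \frac{d_j}{d_{j'}}$ for all $j,j'$. *Notation.* For angles $x_1,\dots,x_m$ the chaoticity $\mathrm{cha}(x)$ is the distance from $0$, on the circle $\mathbb R/2\pi\mathbb Z$, of the set of all $x_{i_1}+x_{i_2}+x_{i_3}+x_{i_4}$, all $x_{i_1}+x_{i_2}-x_{j_1}-x_{j_2}$ with $i_k\neq j_\ell$ for all $k,\ell$, and all $x_{i_1}+x_{i_2}+x_{i_3}-x_{j_1}$. $\mathbb Z_n$ is the adjacency matrix of the path with $n$ vertices, and $A\times B=A\otimes I+I\otimes B$. *Assumptions.* Let $r_\nu\to r$ be real with $|\lambda_*-r_\nu d_j|<2$, such that for every $\nu$ the critical angles $q_{\nu,j}=\arccos((\lambda_*-r_\nu d_j)/2)$, $j=1,\dots,m$,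 are linearly independent over the integers. Let $z_j=e^{iq_{\nu,j}}$, $Z=\mathrm{diag}(z_1,\dots,z_m)$, let $S_\nu$ be the $2m\times 2m$ matrix $\mathrm{diag}(S_{11},S_{11})$ with $S_{11}=\mathrm{diag}(|\bar z_j-z_j|^{-1/2})$, and $Q=\begin{pmatrix}\bar Z&Z\\ I&I\end{pmatrix}S_\nu$; assume that the limit $S=\lim S_\nu$ exists. Let $n_\nu\in\mathbb N$ satisfy $(n_\nu+1)q_{\nu,j}\to0 \bmod 2\pi$ for every $j$ and $n_\nu\,\mathrm{cha}(q_\nu)\to\infty$. Let $\sigma_\nu>0$, $\sigma_\nu\to0$, with $\frac1{\sigma_\nu}\max_j|e^{i(n_\nu+1)q_{\nu,j}}-1|\to0$ and $\sigma_\nu n_\nu\,\mathrm{cha}(q_\nu)\to\infty$. For each $\nu$ let $V_\nu$ be a random diagonal matrix on the box $\{1,\dots,m\}\times\{1,\dots,n_\nu\}$ whose entries are independent with mean $0$ and variance $1$, and whose absolute third moments are bounded uniformly in the entry and in $\nu$. *Regularized transfer matrices.* For $E\in\mathbb C$ let $T_k=\begin{pmatrix}E-r_\nu G-\frac{\sigma_\nu}{\sqrt{n_\nu}}V_{\nu,k}&-I\\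 I&0\end{pmatrix}$, where $V_{\nu,k}$ is the restriction of $V_\nu$ to the slice $k$, let $T_*=\begin{pmatrix}\lambda_*-r_\nu G&-I\\ I&0\end{pmatrix}$, and put $X^\nu_k(E)=U^{-1}\,T_*^{-k}T_k\cdots T_1\,U$ with $U=\mathrm{diag}(O,O)\,Q$. *Limit.* Let $A(t),B(t)$, $t\in[0,1]$, be matrix-valued Brownian motions (jointly Gaussian, centred, with continuous paths and independent stationary increments, starting at $0$) with $A_{ij}=\bar A_{ji}$, $B_{ij}=B_{ji}$, $\mathbf E|B_{ij}(t)|^2=\mathbf E A_{ii}(t)A_{jj}(t)=\mathbf E|A_{ij}(t)|^2=\langle|O_i|^2,|O_j|^2\rangle t$, all covariances that do not follow from these being zero. Put $$Y_t(\lambda)=iS^2\begin{pmatrix}I&0\\0&-I\end{pmatrix}\lambda t+iS\begin{pmatrix}A(t)&B(t)\\-\bar B(t)&-\bar A(t)\end{pmatrix}S .$$ *Conclusion.* For every finite $\Lambda\subset\mathbb C$, $$\Big(\tfrac1{\sigma_\nu}\big(X^\nu_{\lfloor n_\nu t\rfloor}(\lambda_*+\lambda\sigma_\nu/n_\nu)-I\big),\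 t\in[0,1],\ \lambda\in\Lambda\Big)\Rightarrow\big(Y_t(\lambda),\ t\in[0,1],\ \lambda\in\Lambda\big)$$ in distribution as processes on $[0,1]$, with respect to uniform convergence of paths. Moreover, the eigenvalue process (the point process of eigenvalues, with multiplicity) of $$M_\nu=\frac{n_\nu}{\sigma_\nu}\Big(r_\nu G\times\mathbb Z_{n_\nu}+\frac{\sigma_\nu}{\sqrt{n_\nu}}V_\nu-\lambda_*I\Big)$$ converges in distribution, for the vague topology on locally finite measures on $\mathbb R$, to the eigenvalue process of the real symmetric Gaussian matrix $\operatorname{Re}(A(1)-B(1))$. -/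

import Mathlib

open MeasureTheory ProbabilityTheory Filter Topology
open scoped Kronecker CompactlySupported

noncomputable section

namespace LongBox

/-! ### Critical angles and chaoticity -/

/-- All the sums `x i₁ + x i₂ + x i₃ + x i₄`, all `x i₁ + x i₂ - x j₁ - x j₂` with
`{i₁, i₂}` and `{j₁, j₂}` disjoint, and all `x i₁ + x i₂ + x i₃ - x j₁`, modulo `2π`. -/
def resonanceSet {ι : Type*} (x : ι → Real.Angle) : Set Real.Angle :=
  {a | ∃ i₁ i₂ i₃ i₄, a = x i₁ + x i₂ + x i₃ + x i₄} ∪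
  {a | ∃ i₁ i₂ j₁ j₂, i₁ ≠ j₁ ∧ i₁ ≠ j₂ ∧ i₂ ≠ j₁ ∧ i₂ ≠ j₂ ∧ a = x i₁ + x i₂ - x j₁ - x j₂} ∪
  {a | ∃ i₁ i₂ i₃ j₁, a = x i₁ + x i₂ + x i₃ - x j₁}

/-- The chaoticity of finitely many angles: the distance of `0` from the resonance set
on the circle `ℝ / 2πℤ`. -/
def chaoticity {ι : Type*} (x : ι → Real.Angle) : ℝ :=
  Metric.infDist 0 (resonanceSet x)

/-- The critical angle `arccos (e / 2)` in `[0, π]`, for `e = λ⋆ - r dⱼ`. -/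
def criticalAngle (e : ℝ) : ℝ := Real.arccos (e / 2)

/-! ### The operator -/

/-- Adjacency matrix of the path with `n` vertices. -/
def pathMatrix (n : ℕ) : Matrix (Fin n) (Fin n) ℝ :=
  Matrix.of fun i j => if (i : ℕ) + 1 = j ∨ (j : ℕ) + 1 = i then 1 else 0

/-- Cartesian product of two weighted graphs, given by their adjacency matrices. -/
def cartesianProduct {ι κ : Type*} [DecidableEq ι] [DecidableEq κ]
    (A : Matrix ι ι ℝ) (B : Matrix κ κ ℝ) : Matrix (ι × κ) (ι × κ) ℝ :=
  A ⊗ₖ (1 : Matrix κ κ ℝ) + (1 : Matrix ι ι ℝ) ⊗ₖ B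

/-- The operator `(n / σ) (r G × ℤₙ + (σ / √n) V - λ⋆ I)`, with `V` the diagonal matrix
with entries `v`. -/
def rescaledOperator {m : ℕ} (G : Matrix (Fin m) (Fin m) ℝ) (lam r σ : ℝ) (n : ℕ)
    (v : Fin m × Fin n → ℝ) : Matrix (Fin m × Fin n) (Fin m × Fin n) ℝ :=
  ((n : ℝ) / σ) • (cartesianProduct (r • G) (pathMatrix n)
    + (σ / √(n : ℝ)) • Matrix.diagonal v - lam • (1 : Matrix _ _ ℝ))

/-! ### The regularized transfer matrix evolution -/

section Transfer

variable {m : ℕ}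

/-- Unit complex number `e / 2 + i √(1 - (e / 2)²)` in the upper half plane (for `|e| < 2`). -/
def unitRoot (e : ℝ) : ℂ :=
  ((e / 2 : ℝ) : ℂ) + Complex.I * ((√(1 - (e / 2) ^ 2) : ℝ) : ℂ)

/-- The diagonal matrix `Z` with entries `zⱼ`; here `e j = λ⋆ - r dⱼ`. -/
def zMatrix (e : Fin m → ℝ) : Matrix (Fin m) (Fin m) ℂ :=
  Matrix.diagonal fun j => unitRoot (e j)

/-- The diagonal block `S₁₁ = diag |z̄ⱼ - zⱼ| ^ (-1/2)`. -/
def sBlock (e : Fin m → ℝ) : Matrix (Fin m) (Fin m) ℂ :=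
  Matrix.diagonal fun j =>
    ((‖(starRingEnd ℂ) (unitRoot (e j)) - unitRoot (e j)‖ ^ (-(1 / 2) : ℝ) : ℝ) : ℂ)

/-- `S = diag (S₁₁, S₁₁)`. -/
def sMatrix (e : Fin m → ℝ) : Matrix (Fin m ⊕ Fin m) (Fin m ⊕ Fin m) ℂ :=
  Matrix.fromBlocks (sBlock e) 0 0 (sBlock e)

/-- `Q = [[Z̄, Z], [I, I]] S`. -/
def qMatrix (e : Fin m → ℝ) : Matrix (Fin m ⊕ Fin m) (Fin m ⊕ Fin m) ℂ :=
  Matrix.fromBlocks ((zMatrix e).map (starRingEnd ℂ)) (zMatrix e) 1 1 * sMatrix e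

/-- The one-step transfer matrix `[[E I - H - diag w, -I], [I, 0]]` at energy `E`. -/
def transferMatrix (H : Matrix (Fin m) (Fin m) ℝ) (E : ℂ) (w : Fin m → ℝ) :
    Matrix (Fin m ⊕ Fin m) (Fin m ⊕ Fin m) ℂ :=
  Matrix.fromBlocks
    (E • 1 - H.map (algebraMap ℝ ℂ) - Matrix.diagonal (fun j => (w j : ℂ))) (-1) 1 0

/-- The product `Tₖ ⋯ T₂ T₁` (the factor numbered `k + 1` uses the potential `w k`). -/
def transferProduct (H : Matrix (Fin m) (Fin m) ℝ) (E : ℂ) (w : ℕ → Fin m → ℝ) :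
    ℕ → Matrix (Fin m ⊕ Fin m) (Fin m ⊕ Fin m) ℂ
  | 0 => 1
  | k + 1 => transferMatrix H E (w k) * transferProduct H E w k

/-- `Xₖ = (T⋆⁻ᵏ Tₖ ⋯ T₁)^((O ⊗ I₂) Q)` at energy `E`, for the operator `H × ℤₙ + diag w`
regularized at `lam`, where `M^Y = Y⁻¹ M Y`, `e` lists the eigenvalues of `lam I - H` and the
columns of `O` are the corresponding eigenvectors. -/
def regularizedEvolution (H O : Matrix (Fin m) (Fin m) ℝ) (e : Fin m → ℝ) (lam : ℝ)
    (w : ℕ → Fin m → ℝ) (E : ℂ) (k : ℕ) : Matrix (Fin m ⊕ Fin m) (Fin m ⊕ Fin m) ℂ :=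
  let U : Matrix (Fin m ⊕ Fin m) (Fin m ⊕ Fin m) ℂ :=
    Matrix.fromBlocks (O.map (algebraMap ℝ ℂ)) 0 0 (O.map (algebraMap ℝ ℂ)) * qMatrix e
  U⁻¹ * (((transferMatrix H (lam : ℂ) 0)⁻¹) ^ k * transferProduct H E w k) * U

/-- The restriction of the diagonal entries `v` to slice number `k + 1` of the box
(zero beyond the end of the box). -/
def slice {n : ℕ} (v : Fin m × Fin n → ℝ) (k : ℕ) : Fin m → ℝ :=
  fun j => if h : k < n then v (j, ⟨k, h⟩) else 0

end Transfer

/-! ### The driving Brownian motions -/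

/-- `⟨|Oᵢ|², |Oⱼ|²⟩`, where `Oᵢ` is the `i`-th column of `O` (the `i`-th eigenvector). -/
def eigenvectorOverlap {m : ℕ} (O : Matrix (Fin m) (Fin m) ℝ) (i j : Fin m) : ℝ :=
  ∑ k, O k i ^ 2 * O k j ^ 2

/-- `A` and `B` are matrix-valued Brownian motions on `[0, 1]` with `A` Hermitian, `B` complex
symmetric, and `E|B_ij|² = E A_ii A_jj = E|A_ij|² = ⟨|Oᵢ|², |Oⱼ|²⟩ t`, all the covariances that do
not follow from these being zero. Independence of increments and `A₀ = B₀ = 0` are encoded by the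
factor `min s t`; `E[A A]` and `E[A B]` are determined by the listed covariances, because
`A_kl` is the conjugate of `A_lk`. -/
structure IsDrivingBrownianMotion {m : ℕ} {Ω : Type*} [MeasurableSpace Ω]
    (O : Matrix (Fin m) (Fin m) ℝ)
    (A B : unitInterval → Ω → Matrix (Fin m) (Fin m) ℂ) (P : Measure Ω) : Prop where
  gaussian : IsGaussianProcess (fun t ω => ((fun i j => A t ω i j, fun i j => B t ω i j) :
    (Fin m → Fin m → ℂ) × (Fin m → Fin m → ℂ))) P
  continuous_paths : ∀ᵐ ω ∂P, Continuous (fun t => A t ω) ∧ Continuous (fun t => B t ω)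
  hermitian : ∀ᵐ ω ∂P, ∀ t, (A t ω).IsHermitian
  symmetric : ∀ᵐ ω ∂P, ∀ t, (B t ω).IsSymm
  mean_A : ∀ t i j, ∫ ω, A t ω i j ∂P = 0
  mean_B : ∀ t i j, ∫ ω, B t ω i j ∂P = 0
  cov_A : ∀ (s t : unitInterval) (i j k l : Fin m),
    ∫ ω, A s ω i j * (starRingEnd ℂ) (A t ω k l) ∂P =
      ((min (s : ℝ) (t : ℝ) *
        (if i = k ∧ j = l then eigenvectorOverlap O i j
          else if i = j ∧ k = l then eigenvectorOverlap O i k else 0) : ℝ) : ℂ)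
  cov_B : ∀ (s t : unitInterval) (i j k l : Fin m),
    ∫ ω, B s ω i j * (starRingEnd ℂ) (B t ω k l) ∂P =
      ((min (s : ℝ) (t : ℝ) *
        (if (i = k ∧ j = l) ∨ (i = l ∧ j = k) then eigenvectorOverlap O i j else 0) : ℝ) : ℂ)
  pseudoCov_B : ∀ (s t : unitInterval) (i j k l : Fin m),
    ∫ ω, B s ω i j * B t ω k l ∂P = 0
  cov_AB : ∀ (s t : unitInterval) (i j k l : Fin m),
    ∫ ω, A s ω i j * (starRingEnd ℂ) (B t ω k l) ∂P = 0

/-- The limit `Y_t(z) = i S² diag(I, -I) z t + i S [[A, B], [-B̄, -Ā]] S`, for given values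
`A`, `B` of the Brownian motions at time `t`. -/
def limitMatrix {m : ℕ} (S : Matrix (Fin m ⊕ Fin m) (Fin m ⊕ Fin m) ℂ)
    (A B : Matrix (Fin m) (Fin m) ℂ) (z : ℂ) (t : ℝ) :
    Matrix (Fin m ⊕ Fin m) (Fin m ⊕ Fin m) ℂ :=
  (Complex.I * z * (t : ℂ)) • (S ^ 2 * Matrix.fromBlocks 1 0 0 (-1)) +
  Complex.I • (S * Matrix.fromBlocks A B (-(B.map (starRingEnd ℂ))) (-(A.map (starRingEnd ℂ))) * S)

/-! ### Spaces of paths and of point configurations -/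

/-- Functions `[0, 1] → E` with the topology of uniform convergence and its Borel sets. -/
def PathSpace (E : Type*) : Type _ := UniformFun unitInterval E

/-- A function seen as an element of the path space. -/
def PathSpace.mk {E : Type*} (f : unitInterval → E) : PathSpace E := UniformFun.ofFun f

instance {E : Type*} [UniformSpace E] : TopologicalSpace (PathSpace E) :=
  inferInstanceAs (TopologicalSpace (UniformFun unitInterval E))

instance {E : Type*} [UniformSpace E] : MeasurableSpace (PathSpace E) := borel _

instance {E : Type*} [UniformSpace E] : BorelSpace (PathSpace E) := ⟨rfl⟩

/-- Locally finite measures on `ℝ`: the state space of point processes. -/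
def LocallyFiniteMeasures : Type := {μ : Measure ℝ // IsLocallyFiniteMeasure μ}

/-- The vague topology: the coarsest one for which `μ ↦ ∫ f dμ` is continuous for every
continuous compactly supported `f`. -/
instance : TopologicalSpace LocallyFiniteMeasures :=
  TopologicalSpace.induced (fun μ (f : C_c(ℝ, ℝ)) => ∫ x, f x ∂μ.1) inferInstance

instance : MeasurableSpace LocallyFiniteMeasures := borel _

instance : BorelSpace LocallyFiniteMeasures := ⟨rfl⟩

/-- A finite sum of point masses is a finite measure. -/
theorem isFiniteMeasure_sum_dirac (s : Multiset ℝ) :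
    IsFiniteMeasure (s.map (fun x => Measure.dirac x)).sum := by
  induction s using Multiset.induction_on with
  | empty => simp only [Multiset.map_zero, Multiset.sum_zero]; infer_instance
  | cons a s ih =>
    simp only [Multiset.map_cons, Multiset.sum_cons]
    infer_instance

/-- The eigenvalue counting measure of a real symmetric matrix: a unit mass at every eigenvalue,
with multiplicity. -/
def eigenvalueProcess {ι : Type*} [Fintype ι] [DecidableEq ι] (H : Matrix ι ι ℝ) :
    LocallyFiniteMeasures :=
  ⟨(H.charpoly.roots.map (fun x => Measure.dirac x)).sum,
    have := isFiniteMeasure_sum_dirac H.charpoly.roots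
    inferInstance⟩

end LongBox

end

/-! In the eigenbasis of `G` the unperturbed transfer matrix splits into 2×2 blocks with eigenvalues
z̄_j, z_j on the unit circle, so conjugation by U turns powers of T_* into diagonal rotations. In
these coordinates the evolution satisfies X_{k+1} = (1 + (E - λ_*) D_k + σ M_k) X_k, where D_k is
deterministic and bounded and M_k is linear in the noise of one slice, with coefficients of size
n^(-1/2) carrying the phases exp(i(k+1)(±q_i ± q_j)); see `regularizedEvolution_step`.

Since σ → 0, this multiplicative recursion linearizes. At E = λ_* the matrix X_k - 1 is σ times a
martingale whose coefficients contain the earlier X_j. A second moment bound gives X_j - 1 = O(σ),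
and replacing X_j by 1 in the coefficients costs a further factor σ, uniformly up to time n by
Doob's inequality. The shift λσ/n of the energy is a perturbation of total size O(σ), handled
deterministically by variation of constants (`norm_perturbation_le`). Hence (X - 1)/σ is, up to an
error that vanishes in probability, a fixed linear image of sums of independent variables with
deterministic coefficients, plus an averaged drift.

These sums satisfy a functional central limit theorem (`functional_clt`): characteristic functions
give the finite-dimensional laws, and a maximal inequality with third moments on short blocks
controls the paths between grid points. The limiting covariances are averages over k of oscillating
phases. A phase either vanishes identically or, because n·cha → ∞, turns often enough for its
average to tend to 0; the phases that survive produce exactly the covariances of A and B.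

For the eigenvalues, the characteristic polynomial on the box is a nonzero constant times the
determinant of the upper left m×m block of the transfer product, hence a function of X_n. As
exp(i(n+1)q_j) - 1 = o(σ), the identity part of X_n does not contribute after division by σ, and the
limit is a nonzero constant times the characteristic polynomial of -Re(a - b), where (a, b) is the
value of the noise at the end of the box; the minus sign is absorbed by passing from V to -V.
Convergence of characteristic polynomials up to nonzero factors on the upper half plane implies
vague convergence of the eigenvalues: the ratio of the moduli at heights 2y and y gives the sum of a
logarithmic kernel over the eigenvalues, in which the factors cancel, and this kernel is an
approximate identity (`tendsto_sum_of_tendsto_prod`). All of this is deterministic once the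
evolution is linearized; a compactness argument
(`IsCriticalRegime.exists_abs_eigenvalueProcess_sub_le`) makes it uniform over such potentials, so
that it passes to laws. -/

set_option linter.unusedSectionVars false
set_option linter.unusedVariables false

noncomputable section

namespace LongBox

/-! ### Sums of noise against predictable coefficients -/

section Martingale

variable {Ω α : Type*} {mΩ : MeasurableSpace Ω} [Fintype α]

/-- An array of centred random variables with second moments at most `1` and third absolute moments
at most `K`, adapted to a filtration and independent of its past. -/
structure IsNoise (P : Measure Ω) (F : Filtration ℕ mΩ) (v : ℕ → α → Ω → ℝ) (K : ℝ) : Prop where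
  measurable_succ : ∀ k a, Measurable[F (k + 1)] (v k a)
  -- Each variable separately is independent of the past. Nothing is required between the variables
  -- of one slice, which is why factors `Fintype.card α` appear in the estimates.
  indep : ∀ k a, Indep (MeasurableSpace.comap (v k a) inferInstance) (F k) P
  mean : ∀ k a, ∫ ω, v k a ω ∂P = 0
  memLp : ∀ k a, MemLp (v k a) 3 P
  -- An inequality rather than an equality, because the noise of a box is continued by zero beyond
  -- its end.
  sq_le : ∀ k a, ∫ ω, v k a ω ^ 2 ∂P ≤ 1
  cube_le : ∀ k a, ∫ ω, |v k a ω| ^ 3 ∂P ≤ K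

/-- The filtration that starts at a later time. -/
def shiftFiltration (F : Filtration ℕ mΩ) (k₀ : ℕ) : Filtration ℕ mΩ where
  seq k := F (k₀ + k)
  mono' _ _ h := F.mono (Nat.add_le_add_left h k₀)
  le' k := F.le (k₀ + k)

/-- The sum of the noise against given coefficients, up to a given time. -/
def noiseSum {E : Type*} [AddCommMonoid E] [Module ℝ E] (v : ℕ → α → Ω → ℝ) (H : ℕ → α → Ω → E)
    (k : ℕ) (ω : Ω) : E :=
  ∑ j ∈ Finset.range k, ∑ a, v j a ω • H j a ω

variable {P : Measure Ω} [IsProbabilityMeasure P] {F : Filtration ℕ mΩ} {v : ℕ → α → Ω → ℝ} {K : ℝ}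

theorem IsNoise.shift (hv : IsNoise P F v K) (k₀ : ℕ) :
    IsNoise P (shiftFiltration F k₀) (fun k => v (k₀ + k)) K where
  measurable_succ k a := hv.measurable_succ (k₀ + k) a
  indep k a := hv.indep (k₀ + k) a
  mean k a := hv.mean _ a
  memLp k a := hv.memLp _ a
  sq_le k a := hv.sq_le _ a
  cube_le k a := hv.cube_le _ a

theorem IsNoise.measurable (hv : IsNoise P F v K) (k : ℕ) (a : α) : Measurable (v k a) :=
  (hv.measurable_succ k a).mono (F.le _) le_rfl

theorem IsNoise.memLp_two (hv : IsNoise P F v K) (k : ℕ) (a : α) : MemLp (v k a) 2 P :=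
  (hv.memLp k a).mono_exponent (by norm_num)

theorem IsNoise.integrable (hv : IsNoise P F v K) (k : ℕ) (a : α) : Integrable (v k a) P :=
  (hv.memLp k a).integrable (by norm_num)

theorem IsNoise.integrable_sq (hv : IsNoise P F v K) (k : ℕ) (a : α) :
    Integrable (fun ω => v k a ω ^ 2) P :=
  (hv.memLp_two k a).integrable_sq

theorem IsNoise.integrable_cube (hv : IsNoise P F v K) (k : ℕ) (a : α) :
    Integrable (fun ω => |v k a ω| ^ 3) P := by
  have h := (hv.memLp k a).integrable_norm_rpow (by norm_num) (by norm_num)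
  refine h.congr (ae_of_all _ fun ω => ?_)
  simp only [Real.norm_eq_abs]
  norm_num

theorem IsNoise.indepFun (hv : IsNoise P F v K) (k : ℕ) (a : α) {β : Type*} [MeasurableSpace β]
    {G : Ω → β} (hG : Measurable[F k] G) : IndepFun (v k a) G P :=
  indep_of_indep_of_le_right (hv.indep k a) hG.comap_le

theorem IsNoise.integral_mul_eq_zero (hv : IsNoise P F v K) (k : ℕ) (a : α) {G : Ω → ℝ}
    (hG : Measurable[F k] G) : ∫ ω, v k a ω * G ω ∂P = 0 := by
  rw [(hv.indepFun k a hG).integral_fun_mul_eq_mul_integral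
    (hv.measurable k a).aestronglyMeasurable (hG.mono (F.le _) le_rfl).aestronglyMeasurable,
    hv.mean, zero_mul]

theorem IsNoise.integrable_sq_mul (hv : IsNoise P F v K) (k : ℕ) (a : α) {G : Ω → ℝ}
    (hG : Measurable[F k] G) (hGi : Integrable G P) : Integrable (fun ω => v k a ω ^ 2 * G ω) P :=
  ((hv.indepFun k a hG).comp (φ := fun x => x ^ 2) (ψ := id) (by fun_prop)
    measurable_id).integrable_mul (hv.integrable_sq k a) hGi

theorem IsNoise.integral_sq_mul_le (hv : IsNoise P F v K) (k : ℕ) (a : α) {G : Ω → ℝ}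
    (hG : Measurable[F k] G) (hG0 : 0 ≤ G) :
    ∫ ω, v k a ω ^ 2 * G ω ∂P ≤ ∫ ω, G ω ∂P := by
  have h := ((hv.indepFun k a hG).comp (φ := fun x => x ^ 2) (ψ := id) (by fun_prop)
    measurable_id).integral_fun_mul_eq_mul_integral
    ((hv.measurable k a).pow_const 2).aestronglyMeasurable
    (hG.mono (F.le _) le_rfl).aestronglyMeasurable
  simp only [Function.comp_apply, id] at h
  rw [h]
  exact mul_le_of_le_one_left (integral_nonneg hG0) (hv.sq_le k a)

variable {E : Type*} [NormedAddCommGroup E] [InnerProductSpace ℝ E] [FiniteDimensional ℝ E]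
  [MeasurableSpace E] [BorelSpace E]

/-- Coefficients known before the noise they multiply, and square integrable. -/
structure IsPredictable (P : Measure Ω) (F : Filtration ℕ mΩ) (H : ℕ → α → Ω → E) : Prop where
  measurable : ∀ k a, Measurable[F k] (H k a)
  memLp : ∀ k a, MemLp (H k a) 2 P

omit [IsProbabilityMeasure P] [FiniteDimensional ℝ E] [Fintype α] in
theorem isPredictable_const [IsProbabilityMeasure P] (h : ℕ → α → E) :
    IsPredictable P F (fun k a (_ : Ω) => h k a) where
  measurable _ _ := measurable_const
  memLp _ _ := memLp_const _

theorem IsNoise.memLp_smul (hv : IsNoise P F v K) {H : ℕ → α → Ω → E} (hH : IsPredictable P F H)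
    (k : ℕ) (a : α) : MemLp (fun ω => v k a ω • H k a ω) 2 P := by
  have hm : Measurable (H k a) := (hH.measurable k a).mono (F.le _) le_rfl
  refine (memLp_two_iff_integrable_sq_norm
    ((hv.measurable k a).smul hm).aestronglyMeasurable).2 ?_
  simp only [Pi.smul_apply', norm_smul, mul_pow, Real.norm_eq_abs, sq_abs]
  exact hv.integrable_sq_mul k a
    ((by fun_prop : Measurable fun x : E => ‖x‖ ^ 2).comp (hH.measurable k a))
    ((memLp_two_iff_integrable_sq_norm hm.aestronglyMeasurable).1 (hH.memLp k a))

theorem IsNoise.memLp_noiseSum (hv : IsNoise P F v K) {H : ℕ → α → Ω → E}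
    (hH : IsPredictable P F H) (k : ℕ) : MemLp (noiseSum v H k) 2 P :=
  memLp_finsetSum _ fun j _ => memLp_finsetSum _ fun a _ => hv.memLp_smul hH j a

theorem IsNoise.measurable_noiseSum (hv : IsNoise P F v K) {H : ℕ → α → Ω → E}
    (hH : IsPredictable P F H) (k : ℕ) : Measurable[F k] (noiseSum v H k) := by
  refine Finset.measurable_fun_sum _ fun j hj => Finset.measurable_fun_sum _ fun a _ => ?_
  have hj' := Finset.mem_range.1 hj
  exact ((hv.measurable_succ j a).mono (F.mono hj') le_rfl).smul
    ((hH.measurable j a).mono (F.mono hj'.le) le_rfl)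

omit [FiniteDimensional ℝ E] [MeasurableSpace E] [BorelSpace E] [InnerProductSpace ℝ E] in
theorem noiseSum_succ [NormedSpace ℝ E] (v : ℕ → α → Ω → ℝ) (H : ℕ → α → Ω → E) (k : ℕ) (ω : Ω) :
    noiseSum v H (k + 1) ω = noiseSum v H k ω + ∑ a, v k a ω • H k a ω := by
  rw [noiseSum, Finset.sum_range_succ, noiseSum]

/-- Orthogonality of the increments: the cross term with the past has mean zero because the noise is
independent of the past and centred. Within one slice the Cauchy–Schwarz inequality is used, whence
the factor `Fintype.card α`. -/
theorem IsNoise.integral_norm_sq_noiseSum_le (hv : IsNoise P F v K) {H : ℕ → α → Ω → E}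
    (hH : IsPredictable P F H) (k : ℕ) :
    ∫ ω, ‖noiseSum v H k ω‖ ^ 2 ∂P ≤
      (Fintype.card α : ℝ) * ∑ j ∈ Finset.range k, ∑ a, ∫ ω, ‖H j a ω‖ ^ 2 ∂P := by
  induction k with
  | zero => simp [noiseSum]
  | succ k ih =>
    have hM := hv.measurable_noiseSum hH k
    have hM2 := hv.memLp_noiseSum hH k
    have hinner : ∀ a, Measurable[F k] fun ω => inner ℝ (noiseSum v H k ω) (H k a ω) :=
      fun a =>
        (continuous_inner (𝕜 := ℝ)).measurable.comp (hM.prodMk (hH.measurable k a))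
    have hMi : Integrable (fun ω => ‖noiseSum v H k ω‖ ^ 2) P := hM2.norm.integrable_sq
    have hHni : ∀ a, Integrable (fun ω => ‖H k a ω‖ ^ 2) P := fun a =>
      (hH.memLp k a).norm.integrable_sq
    have hinneri : ∀ a, Integrable (fun ω => inner ℝ (noiseSum v H k ω) (H k a ω)) P := by
      refine fun a => (hMi.add (hHni a)).mono'
        ((hinner a).mono (F.le _) le_rfl).aestronglyMeasurable (ae_of_all _ fun ω => ?_)
      have h1 := abs_real_inner_le_norm (noiseSum v H k ω) (H k a ω)
      have h2 := two_mul_le_add_sq ‖noiseSum v H k ω‖ ‖H k a ω‖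
      have h3 := mul_nonneg (norm_nonneg (noiseSum v H k ω)) (norm_nonneg (H k a ω))
      simp only [Real.norm_eq_abs, Pi.add_apply]
      linarith
    have hi1 : ∀ a, Integrable (fun ω => v k a ω * inner ℝ (noiseSum v H k ω) (H k a ω)) P :=
      fun a => (hv.indepFun k a (hinner a)).integrable_mul (hv.integrable k a) (hinneri a)
    have hHn : ∀ a, Measurable[F k] fun ω => ‖H k a ω‖ ^ 2 :=
      fun a => (by fun_prop : Measurable fun x : E => ‖x‖ ^ 2).comp (hH.measurable k a)
    have hi2 : ∀ a, Integrable (fun ω => v k a ω ^ 2 * ‖H k a ω‖ ^ 2) P :=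
      fun a => hv.integrable_sq_mul k a (hHn a) (hHni a)
    have hpt : ∀ ω, ‖noiseSum v H (k + 1) ω‖ ^ 2 ≤ ‖noiseSum v H k ω‖ ^ 2
        + 2 * (∑ a, v k a ω * inner ℝ (noiseSum v H k ω) (H k a ω))
        + (Fintype.card α : ℝ) * ∑ a, v k a ω ^ 2 * ‖H k a ω‖ ^ 2 := by
      intro ω
      rw [noiseSum_succ, norm_add_sq_real, inner_sum]
      simp only [inner_smul_right]
      gcongr
      calc ‖∑ a, v k a ω • H k a ω‖ ^ 2 ≤ (∑ a, ‖v k a ω • H k a ω‖) ^ 2 := by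
            gcongr; exact norm_sum_le _ _
        _ ≤ (Fintype.card α : ℝ) * ∑ a, ‖v k a ω • H k a ω‖ ^ 2 := by
            simpa using sq_sum_le_card_mul_sum_sq (s := Finset.univ)
              (f := fun a => ‖v k a ω • H k a ω‖)
        _ = _ := by simp only [norm_smul, mul_pow, Real.norm_eq_abs, sq_abs]
    have hs1 := integrable_finsetSum Finset.univ fun a _ => hi1 a
    have hs2 := integrable_finsetSum Finset.univ fun a _ => hi2 a
    calc ∫ ω, ‖noiseSum v H (k + 1) ω‖ ^ 2 ∂P
        ≤ ∫ ω, (‖noiseSum v H k ω‖ ^ 2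
        + 2 * (∑ a, v k a ω * inner ℝ (noiseSum v H k ω) (H k a ω))
        + (Fintype.card α : ℝ) * ∑ a, v k a ω ^ 2 * ‖H k a ω‖ ^ 2) ∂P :=
          integral_mono (hv.memLp_noiseSum hH (k + 1)).norm.integrable_sq
            ((hMi.add (hs1.const_mul 2)).add (hs2.const_mul _)) hpt
      _ = ∫ ω, ‖noiseSum v H k ω‖ ^ 2 ∂P
          + 2 * ∑ a, ∫ ω, v k a ω * inner ℝ (noiseSum v H k ω) (H k a ω) ∂P
          + (Fintype.card α : ℝ) * ∑ a, ∫ ω, v k a ω ^ 2 * ‖H k a ω‖ ^ 2 ∂P := by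
          rw [integral_add (f := fun ω => _ + _) (hMi.add (hs1.const_mul 2)) (hs2.const_mul _),
            integral_add hMi (hs1.const_mul 2), integral_const_mul, integral_const_mul,
            integral_finsetSum _ fun a _ => hi1 a, integral_finsetSum _ fun a _ => hi2 a]
      _ ≤ (Fintype.card α : ℝ) * ∑ j ∈ Finset.range k, ∑ a, ∫ ω, ‖H j a ω‖ ^ 2 ∂P + 2 * 0
          + (Fintype.card α : ℝ) * ∑ a, ∫ ω, ‖H k a ω‖ ^ 2 ∂P := by
          refine add_le_add (add_le_add ih (mul_le_mul_of_nonneg_left ?_ zero_le_two))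
            (mul_le_mul_of_nonneg_left (Finset.sum_le_sum fun a _ => ?_) (by positivity))
          · exact (Finset.sum_eq_zero fun a _ => hv.integral_mul_eq_zero k a (hinner a)).le
          · exact hv.integral_sq_mul_le k a (hHn a) (fun ω => by positivity)
      _ = _ := by rw [Finset.sum_range_succ]; ring

/-- The coefficient is known before its slice and comes out of the conditional expectation, which
leaves the mean of the noise. This opens the way to maximal inequalities. -/
theorem IsNoise.martingale_noiseSum (hv : IsNoise P F v K) {H : ℕ → α → Ω → E}
    (hH : IsPredictable P F H) : Martingale (noiseSum v H) F P := by
  refine martingale_of_condExp_sub_eq_zero_nat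
    (fun k => (hv.measurable_noiseSum hH k).stronglyMeasurable)
    (fun k => (hv.memLp_noiseSum hH k).integrable (by norm_num)) fun k => ?_
  have h1 : noiseSum v H (k + 1) - noiseSum v H k = ∑ a, (v k a • H k a) := by
    ext ω
    simp only [Pi.sub_apply, noiseSum_succ, Finset.sum_apply, Pi.smul_apply']
    abel
  rw [h1]
  have hint : ∀ a, Integrable (v k a • H k a) P := fun a =>
    (hv.memLp_smul hH k a).integrable (by norm_num)
  refine (condExp_finsetSum (fun a _ => hint a) (F k)).trans ?_
  have h2 : ∀ a, P[v k a • H k a | F k] =ᵐ[P] 0 := by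
    intro a
    have h3 := condExp_smul_of_aestronglyMeasurable_right (m := F k) (hv.integrable k a) (hint a)
      (hH.measurable k a).stronglyMeasurable.aestronglyMeasurable
    have h4 := condExp_indep_eq (μ := P) (hv.measurable k a).comap_le (F.le k)
      (comap_measurable (v k a)).stronglyMeasurable (hv.indep k a)
    filter_upwards [h3, h4] with ω h3 h4
    rw [h3, Pi.smul_apply', h4, hv.mean, zero_smul, Pi.zero_apply]
  have h5 : ∀ᵐ ω ∂P, ∀ a, P[v k a • H k a | F k] ω = 0 := ae_all_iff.2 h2
  filter_upwards [h5] with ω h5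
  simp [h5]

/-- A consequence of Doob's maximal inequality. -/
theorem measure_exists_le_norm_le {M : ℕ → Ω → E} (hM : Martingale M F P) {ε : ℝ} (hε : 0 < ε)
    (n p : ℕ) (hp : 2 ≤ p) (hint : Integrable (fun ω => ‖M n ω‖ ^ p) P) :
    P.real {ω | ∃ k ≤ n, ε ≤ ‖M k ω‖} ≤ (∫ ω, ‖M n ω‖ ^ p ∂P) / ε ^ p := by
  have hsub : Submartingale (fun k ω => ‖M k ω‖) F P := by
    refine ⟨fun k => (hM.stronglyMeasurable k).norm, fun i j hij => ?_, fun k =>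
      (hM.integrable k).norm⟩
    filter_upwards [norm_condExp_le (μ := P) (m := F i) (M j), hM.condExp_ae_eq hij] with ω h1 h2
    rwa [h2] at h1
  set A := {ω | ∃ k ≤ n, ε ≤ ‖M k ω‖} with hA
  obtain ⟨e, he⟩ : ∃ e : NNReal, (e : ℝ) = ε := ⟨⟨ε, hε.le⟩, rfl⟩
  have h : (e : ENNReal) * P A ≤ ENNReal.ofReal (∫ ω in A, ‖M n ω‖ ∂P) := by
    have key : ∀ S : Set Ω, S = A →
        (e : ENNReal) * P S ≤ ENNReal.ofReal (∫ ω in S, ‖M n ω‖ ∂P) →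
        (e : ENNReal) * P A ≤ ENNReal.ofReal (∫ ω in A, ‖M n ω‖ ∂P) := by
      rintro S rfl h
      exact h
    refine key _ ?_ (maximal_ineq hsub (fun k ω => norm_nonneg (M k ω)) (ε := e) n)
    ext ω
    simp only [he, Finset.le_sup'_iff, Finset.mem_range, Nat.lt_succ_iff, hA,
      Set.mem_setOf_eq]
  have h' : ε * P.real A ≤ ∫ ω in A, ‖M n ω‖ ∂P := by
    have h0 : 0 ≤ ∫ ω in A, ‖M n ω‖ ∂P := integral_nonneg fun ω => norm_nonneg _
    have := ENNReal.toReal_mono ENNReal.ofReal_ne_top h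
    rwa [ENNReal.toReal_ofReal h0, ENNReal.toReal_mul, ENNReal.coe_toReal, he] at this
  have hp1 : (1 : ℝ) < p := by exact_mod_cast hp
  have hp0 : (0 : ℝ) < p := by linarith
  -- Young's inequality, obtained from Bernoulli's. Integrated over `A`, the constant term gives the
  -- fraction `1 - 1 / p` of `ε * P A`, which is absorbed by the left side of the weak maximal
  -- inequality; this yields the `p`-th moment bound from the submartingale of norms alone.
  have hyoung : ∀ x : ℝ, 0 ≤ x → x ≤ x ^ p / (p * ε ^ (p - 1)) + (1 - 1 / p) * ε := by
    intro x hx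
    have hb := one_add_mul_le_pow (a := x / ε - 1) (by
      have := div_nonneg hx hε.le
      linarith) p
    have h1 : 1 + (x / ε - 1) = x / ε := by ring
    rw [h1, div_pow] at hb
    have h2 : x ^ p / (p * ε ^ (p - 1)) = x ^ p / ε ^ p * (ε / p) := by
      have : ε ^ p = ε ^ (p - 1) * ε := by
        rw [← pow_succ]; congr 1; omega
      rw [this]
      field_simp
    rw [h2]
    have h3 : (1 + p * (x / ε - 1)) * (ε / p) ≤ x ^ p / ε ^ p * (ε / p) :=
      mul_le_mul_of_nonneg_right hb (by positivity)
    have h4 : (1 + p * (x / ε - 1)) * (ε / p) = x - (1 - 1 / p) * ε := by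
      field_simp
      ring
    linarith
  have h5 : ∫ ω in A, ‖M n ω‖ ∂P ≤
      (∫ ω, ‖M n ω‖ ^ p ∂P) / (p * ε ^ (p - 1)) + (1 - 1 / p) * ε * P.real A := by
    calc ∫ ω in A, ‖M n ω‖ ∂P
        ≤ ∫ ω in A, (‖M n ω‖ ^ p / (p * ε ^ (p - 1)) + (1 - 1 / p) * ε) ∂P :=
          integral_mono (hM.integrable n).norm.integrableOn
            ((hint.div_const _).add (integrable_const _)).integrableOn
            fun ω => hyoung _ (norm_nonneg _)
      _ = (∫ ω in A, ‖M n ω‖ ^ p ∂P) / (p * ε ^ (p - 1)) + (1 - 1 / p) * ε * P.real A := by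
          rw [integral_add (hint.div_const _).integrableOn (integrable_const _).integrableOn,
            integral_div, integral_const]
          simp [mul_comm]
      _ ≤ _ := by
          have := setIntegral_le_integral (s := A) hint (ae_of_all _ fun ω => by positivity)
          exact add_le_add_left (div_le_div_of_nonneg_right this (by positivity)) _
  have h6 : ε / p * P.real A ≤ (∫ ω, ‖M n ω‖ ^ p ∂P) / (p * ε ^ (p - 1)) := by
    have : ε / p * P.real A = ε * P.real A - (1 - 1 / p) * ε * P.real A := by ring
    linarith
  have h7 : ε ^ p = ε ^ (p - 1) * ε := by
    rw [← pow_succ]; congr 1; omega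
  rw [le_div_iff₀ (by positivity), h7]
  rw [le_div_iff₀ (by positivity)] at h6
  calc P.real A * (ε ^ (p - 1) * ε) = ε / p * P.real A * (p * ε ^ (p - 1)) := by field_simp
    _ ≤ _ := h6

theorem IsNoise.measure_exists_le_noiseSum_le (hv : IsNoise P F v K) {H : ℕ → α → Ω → E}
    (hH : IsPredictable P F H) {ε : ℝ} (hε : 0 < ε) (n : ℕ) :
    P.real {ω | ∃ k ≤ n, ε ≤ ‖noiseSum v H k ω‖} ≤
      Fintype.card α * (∑ j ∈ Finset.range n, ∑ a, ∫ ω, ‖H j a ω‖ ^ 2 ∂P) / ε ^ 2 := by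
  refine (measure_exists_le_norm_le (hv.martingale_noiseSum hH) hε n 2 le_rfl
    (hv.memLp_noiseSum hH n).norm.integrable_sq).trans ?_
  gcongr
  exact hv.integral_norm_sq_noiseSum_le hH n

/-- An expansion whose linear term is exact: it vanishes in mean when `x` is centred and independent
of `a`, so a third moment bound propagates using only the second and third moments of the
increments. -/
theorem abs_add_pow_three_le (a x : ℝ) :
    |a + x| ^ 3 ≤ |a| ^ 3 + 3 * (|a| * a * x) + 3 * |a| * x ^ 2 + |x| ^ 3 := by
  have h1 : ∀ b y : ℝ, 0 ≤ b → |b + y| ^ 3 ≤ b ^ 3 + 3 * (b * b * y) + 3 * b * y ^ 2 + |y| ^ 3 := by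
    intro b y hb
    rcases abs_cases y with ⟨h2, h2'⟩ | ⟨h2, h2'⟩ <;>
      rcases abs_cases (b + y) with ⟨h3, h3'⟩ | ⟨h3, h3'⟩ <;> rw [h2, h3]
    · linarith [show (b + y) ^ 3 = b ^ 3 + 3 * (b * b * y) + 3 * b * y ^ 2 + y ^ 3 by ring]
    · linarith
    · nlinarith [mul_nonneg (sq_nonneg y) (neg_nonneg.2 h2'.le)]
    · nlinarith [mul_nonneg hb (sq_nonneg (2 * b + 3 * y)), mul_nonneg hb (sq_nonneg y),
        mul_nonneg hb (sq_nonneg b)]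
  rcases le_total 0 a with ha | ha
  · rw [abs_of_nonneg ha]
    exact h1 a x ha
  · rw [abs_of_nonpos ha]
    have := h1 (-a) (-x) (by linarith)
    rw [← neg_add, abs_neg, abs_neg] at this
    linarith

theorem sum_abs_pow_three_le (f : α → ℝ) :
    |∑ a, f a| ^ 3 ≤ (Fintype.card α : ℝ) ^ 2 * ∑ a, |f a| ^ 3 := by
  calc |∑ a, f a| ^ 3 ≤ (∑ a, |f a|) ^ 3 := by
        gcongr; exact Finset.abs_sum_le_sum_abs _ _
    _ ≤ _ := by
        simpa using pow_sum_le_card_mul_sum_pow (s := Finset.univ) (f := fun a => |f a|)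
          (fun a _ => abs_nonneg _) 2

/-- Third absolute moments of sums of the noise against constant coefficients. -/
theorem IsNoise.integral_abs_noiseSum_cube_le (hv : IsNoise P F v K) {h : ℕ → α → ℝ} {η : ℝ}
    (hη : ∀ k a, |h k a| ≤ η) (hη0 : 0 ≤ η) (n : ℕ) :
    Integrable (fun ω => |noiseSum v (fun k a _ => h k a) n ω| ^ 3) P ∧
    ∫ ω, |noiseSum v (fun k a _ => h k a) n ω| ^ 3 ∂P ≤
      (3 * (n * √n) + n * K) * ((Fintype.card α : ℝ) * η) ^ 3 := by
  set c : ℝ := ((Fintype.card α : ℕ) : ℝ) with hcdef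
  have hc : 0 ≤ c := by positivity
  set H : ℕ → α → Ω → ℝ := fun k a _ => h k a with hHdef
  have hH : IsPredictable P F H := isPredictable_const h
  have hη2 : ∀ k a, h k a ^ 2 ≤ η ^ 2 := fun k a => sq_le_sq' (by linarith [neg_abs_le (h k a), hη k a])
    ((le_abs_self _).trans (hη k a))
  -- A first moment of order `√k`, from the second moment. The quadratic term of the cubic expansion
  -- is then of order `√k` in each step, which adds up to `n * √n`.
  have hL2 : ∀ k, ∫ ω, |noiseSum v H k ω| ∂P ≤ √k * (c * η) := by
    intro k
    have h1 := hv.integral_norm_sq_noiseSum_le hH k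
    have h2 : (Fintype.card α : ℝ) * ∑ j ∈ Finset.range k, ∑ a, ∫ ω, ‖H j a ω‖ ^ 2 ∂P ≤
        (√k * (c * η)) ^ 2 := by
      calc (Fintype.card α : ℝ) * ∑ j ∈ Finset.range k, ∑ a, ∫ ω, ‖H j a ω‖ ^ 2 ∂P
          ≤ (Fintype.card α : ℝ) * ∑ j ∈ Finset.range k, ∑ a : α, η ^ 2 := by
            gcongr with j _ a _
            simpa [hHdef] using hη2 j a
        _ = (√k * (c * η)) ^ 2 := by
            rw [mul_pow, Real.sq_sqrt (Nat.cast_nonneg k)]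
            simp [hcdef]
            ring
    have h3 : (∫ ω, |noiseSum v H k ω| ∂P) ^ 2 ≤ ∫ ω, ‖noiseSum v H k ω‖ ^ 2 ∂P := by
      have := variance_nonneg |noiseSum v H k| P
      rw [variance_eq_sub (hv.memLp_noiseSum hH k).abs] at this
      simpa using this
    exact abs_le_of_sq_le_sq' ((h3.trans h1).trans h2) (by positivity) |>.2
  induction n with
  | zero => simp [noiseSum]
  | succ k ih =>
    obtain ⟨ihi, ih⟩ := ih
    set M := noiseSum v H k with hM
    have hMm : Measurable[F k] M := hv.measurable_noiseSum hH k
    have hMi : Integrable M P := (hv.memLp_noiseSum hH k).integrable (by norm_num)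
    have hM2i : Integrable (fun ω => |M ω| * M ω) P := by
      refine ((hv.memLp_noiseSum hH k).norm.integrable_sq).mono'
        ((hMi.abs.aestronglyMeasurable).mul hMi.aestronglyMeasurable) (ae_of_all _ fun ω => ?_)
      simp [abs_mul, sq, M]
    have hM2m : Measurable[F k] fun ω => |M ω| * M ω :=
      (by fun_prop : Measurable fun x : ℝ => |x| * x).comp hMm
    have hMam : Measurable[F k] fun ω => |M ω| := (by fun_prop : Measurable fun x : ℝ => |x|).comp hMm
    have hi1 : ∀ a, Integrable (fun ω => v k a ω * (|M ω| * M ω)) P :=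
      fun a => (hv.indepFun k a hM2m).integrable_mul (hv.integrable k a) hM2i
    have hi2 : ∀ a, Integrable (fun ω => v k a ω ^ 2 * |M ω|) P :=
      fun a => hv.integrable_sq_mul k a hMam hMi.abs
    have hi3 := fun a => hv.integrable_cube k a
    -- The cubic expansion with the square and the cube of the slice sum bounded by sums over the
    -- slice. The linear term is kept as it is, since it integrates to zero.
    set g : Ω → ℝ := fun ω => |M ω| ^ 3 + 3 * (∑ a, h k a * (v k a ω * (|M ω| * M ω)))
      + 3 * (c * η ^ 2 * ∑ a, v k a ω ^ 2 * |M ω|) + c ^ 2 * η ^ 3 * ∑ a, |v k a ω| ^ 3 with hg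
    have hpt : ∀ ω, |noiseSum v H (k + 1) ω| ^ 3 ≤ g ω := by
      intro ω
      rw [noiseSum_succ]
      refine (abs_add_pow_three_le _ _).trans ?_
      have e1 : |M ω| * M ω * ∑ a, v k a ω • H k a ω = ∑ a, h k a * (v k a ω * (|M ω| * M ω)) := by
        rw [Finset.mul_sum]
        refine Finset.sum_congr rfl fun a _ => ?_
        simp only [hHdef, smul_eq_mul]
        ring
      have e2 : |M ω| * (∑ a, v k a ω • H k a ω) ^ 2 ≤ c * η ^ 2 * ∑ a, v k a ω ^ 2 * |M ω| := by
        calc |M ω| * (∑ a, v k a ω • H k a ω) ^ 2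
            ≤ |M ω| * (c * ∑ a, (v k a ω • H k a ω) ^ 2) := by
              gcongr
              simpa using sq_sum_le_card_mul_sum_sq (s := Finset.univ)
                (f := fun a => v k a ω • H k a ω)
          _ ≤ |M ω| * (c * ∑ a, v k a ω ^ 2 * η ^ 2) := by
              gcongr with a
              simp only [hHdef, smul_eq_mul, mul_pow]
              exact mul_le_mul_of_nonneg_left (hη2 k a) (sq_nonneg _)
          _ = _ := by rw [← Finset.sum_mul, ← Finset.sum_mul]; ring
      have e3 : |∑ a, v k a ω • H k a ω| ^ 3 ≤ c ^ 2 * η ^ 3 * ∑ a, |v k a ω| ^ 3 := by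
        calc |∑ a, v k a ω • H k a ω| ^ 3 ≤ c ^ 2 * ∑ a, |v k a ω • H k a ω| ^ 3 :=
              sum_abs_pow_three_le _
          _ ≤ c ^ 2 * ∑ a, |v k a ω| ^ 3 * η ^ 3 := by
              gcongr with a
              simp only [hHdef, smul_eq_mul, abs_mul, mul_pow]
              gcongr
              exact hη k a
          _ = _ := by rw [← Finset.sum_mul]; ring
      rw [hg]
      simp only
      rw [← e1]
      linarith
    have hs1 := integrable_finsetSum Finset.univ fun a _ => (hi1 a).const_mul (h k a)
    have hs2 := integrable_finsetSum Finset.univ fun a _ => hi2 a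
    have hs3 := integrable_finsetSum Finset.univ fun a _ => hi3 a
    have hgi : Integrable g P := ((ihi.add (hs1.const_mul 3)).add
      ((hs2.const_mul _).const_mul 3)).add (hs3.const_mul _)
    have hint : Integrable (fun ω => |noiseSum v H (k + 1) ω| ^ 3) P :=
      hgi.mono' ((hv.memLp_noiseSum hH (k + 1)).aestronglyMeasurable.aemeasurable.abs.pow_const
        3).aestronglyMeasurable (ae_of_all _ fun ω => by simpa using hpt ω)
    refine ⟨hint, (integral_mono hint hgi hpt).trans ?_⟩
    have e0 : ∫ ω, g ω ∂P = ∫ ω, |M ω| ^ 3 ∂P + 3 * (∑ a, h k a * ∫ ω, v k a ω * (|M ω| * M ω) ∂P)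
      + 3 * (c * η ^ 2 * ∑ a, ∫ ω, v k a ω ^ 2 * |M ω| ∂P)
      + c ^ 2 * η ^ 3 * ∑ a, ∫ ω, |v k a ω| ^ 3 ∂P := by
      rw [hg, integral_add (f := fun ω => _ + _) ((ihi.add (hs1.const_mul 3)).add
        ((hs2.const_mul _).const_mul 3)) (hs3.const_mul _),
        integral_add (f := fun ω => _ + _) (ihi.add (hs1.const_mul 3))
        ((hs2.const_mul _).const_mul 3), integral_add ihi (hs1.const_mul 3)]
      simp only [integral_const_mul]
      rw [integral_finsetSum _ fun a _ => (hi1 a).const_mul (h k a),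
        integral_finsetSum _ fun a _ => hi2 a, integral_finsetSum _ fun a _ => hi3 a]
      simp only [integral_const_mul]
    rw [e0]
    have f1 : ∑ a, h k a * ∫ ω, v k a ω * (|M ω| * M ω) ∂P = 0 :=
      Finset.sum_eq_zero fun a _ => by rw [hv.integral_mul_eq_zero k a hM2m, mul_zero]
    have f2 : ∑ a, ∫ ω, v k a ω ^ 2 * |M ω| ∂P ≤ c * (√k * (c * η)) := by
      calc ∑ a, ∫ ω, v k a ω ^ 2 * |M ω| ∂P ≤ ∑ a : α, √k * (c * η) :=
            Finset.sum_le_sum fun a _ =>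
              (hv.integral_sq_mul_le k a hMam fun ω => abs_nonneg _).trans (hL2 k)
        _ = _ := by simp [hcdef]
    have f3 : ∑ a, ∫ ω, |v k a ω| ^ 3 ∂P ≤ c * K := by
      calc ∑ a, ∫ ω, |v k a ω| ^ 3 ∂P ≤ ∑ a : α, K := Finset.sum_le_sum fun a _ => hv.cube_le k a
        _ = _ := by simp [hcdef]
    have f4 : √(k : ℝ) ≤ √((k + 1 : ℕ) : ℝ) := Real.sqrt_le_sqrt (by push_cast; linarith)
    have f5 : 0 ≤ √(k : ℝ) := Real.sqrt_nonneg _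
    calc _ ≤ (3 * (k * √k) + k * K) * (c * η) ^ 3 + 3 * 0
          + 3 * (c * η ^ 2 * (c * (√k * (c * η)))) + c ^ 2 * η ^ 3 * (c * K) := by
          rw [f1]
          gcongr
      _ = (3 * ((k + 1 : ℕ) * √k) + (k + 1 : ℕ) * K) * (c * η) ^ 3 := by push_cast; ring
      _ ≤ _ := by gcongr

end Martingale

/-! ### Tools for convergence in distribution -/

section WeakConvergence

variable {Ω : ℕ → Type*} [∀ ν, MeasurableSpace (Ω ν)] {P : ∀ ν, Measure (Ω ν)}
  [∀ ν, IsProbabilityMeasure (P ν)] {Ω' : Type*} [MeasurableSpace Ω'] {P' : Measure Ω'}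
  [IsProbabilityMeasure P']

/-- Random elements that can be approximated, uniformly in the index and in probability, by
random elements converging in distribution, converge in distribution. -/
theorem tendstoInDistribution_of_approx {E : Type*} [PseudoEMetricSpace E] [MeasurableSpace E]
    [BorelSpace E] {X : ∀ ν, Ω ν → E} {Z : Ω' → E} (hX : ∀ ν, AEMeasurable (X ν) (P ν))
    (hZ : AEMeasurable Z P')
    (h : ∀ ε : ℝ, 0 < ε → ∃ (Y : ∀ ν, Ω ν → E) (W : Ω' → E), TendstoInDistribution Y atTop W P P' ∧
      (∀ᶠ ν in atTop, P ν {ω | ENNReal.ofReal ε < edist (X ν ω) (Y ν ω)} ≤ ENNReal.ofReal ε) ∧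
      P' {ω | ENNReal.ofReal ε < edist (Z ω) (W ω)} ≤ ENNReal.ofReal ε) :
    TendstoInDistribution X atTop Z P P' := by
  refine ⟨hX, hZ, ?_⟩
  refine tendsto_of_forall_isClosed_limsup_le' fun F hF => ?_
  simp only [ProbabilityMeasure.coe_mk]
  have hcl : ∀ δ, MeasurableSet (Metric.cthickening δ F) := fun δ =>
    Metric.isClosed_cthickening.measurableSet
  -- The prelimit and the limit are both moved by at most `ε`, outside events of probability `ε`;
  -- the closed set is therefore thickened twice and two summands `ε` are lost. Letting `ε` tend to
  -- 0 recovers the closed set.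
  have key : ∀ ε : ℝ, 0 < ε → limsup (fun ν => ((P ν).map (X ν)) F) atTop ≤
      (P'.map Z) (Metric.cthickening (2 * ε) F) + ENNReal.ofReal ε + ENNReal.ofReal ε := by
    intro ε hε
    obtain ⟨Y, W, hYW, h1, h2⟩ := h ε hε
    have hlim := ProbabilityMeasure.limsup_measure_closed_le_of_tendsto hYW.tendsto
      (Metric.isClosed_cthickening (δ := ε) (E := F))
    simp only [ProbabilityMeasure.coe_mk] at hlim
    have hXY : ∀ᶠ ν in atTop, ((P ν).map (X ν)) F ≤
        ((P ν).map (Y ν)) (Metric.cthickening ε F) + ENNReal.ofReal ε := by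
      filter_upwards [h1] with ν h1
      rw [Measure.map_apply_of_aemeasurable (hX ν) hF.measurableSet,
        Measure.map_apply_of_aemeasurable (hYW.forall_aemeasurable ν) (hcl ε)]
      refine (measure_mono (t := Y ν ⁻¹' Metric.cthickening ε F ∪
        {ω | ENNReal.ofReal ε < edist (X ν ω) (Y ν ω)}) fun ω hω => ?_).trans
        ((measure_union_le _ _).trans (add_le_add le_rfl h1))
      by_cases hd : ENNReal.ofReal ε < edist (X ν ω) (Y ν ω)
      · exact Or.inr hd
      · refine Or.inl (Metric.mem_cthickening_iff.2 ?_)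
        refine (Metric.infEDist_le_edist_of_mem (show X ν ω ∈ F from hω)).trans ?_
        rw [edist_comm]
        exact not_lt.1 hd
    have hZW : (P'.map W) (Metric.cthickening ε F) ≤
        (P'.map Z) (Metric.cthickening (2 * ε) F) + ENNReal.ofReal ε := by
      rw [Measure.map_apply_of_aemeasurable hZ (hcl _),
        Measure.map_apply_of_aemeasurable hYW.aemeasurable_limit (hcl ε)]
      refine (measure_mono (t := Z ⁻¹' Metric.cthickening (2 * ε) F ∪
        {ω | ENNReal.ofReal ε < edist (Z ω) (W ω)}) fun ω hω => ?_).trans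
        ((measure_union_le _ _).trans (add_le_add le_rfl h2))
      by_cases hd : ENNReal.ofReal ε < edist (Z ω) (W ω)
      · exact Or.inr hd
      · refine Or.inl (Metric.mem_cthickening_iff.2 ?_)
        refine (Metric.infEDist_le_infEDist_add_edist (y := W ω)).trans ?_
        rw [two_mul, ENNReal.ofReal_add hε.le hε.le]
        exact add_le_add (Metric.mem_cthickening_iff.1 hω) (not_lt.1 hd)
    calc limsup (fun ν => ((P ν).map (X ν)) F) atTop
        ≤ limsup (fun ν => ((P ν).map (Y ν)) (Metric.cthickening ε F) + ENNReal.ofReal ε) atTop :=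
          limsup_le_limsup hXY
      _ = limsup (fun ν => ((P ν).map (Y ν)) (Metric.cthickening ε F)) atTop +
          ENNReal.ofReal ε := limsup_add_const _ _ _ (by isBoundedDefault) (by isBoundedDefault)
      _ ≤ (P'.map Z) (Metric.cthickening (2 * ε) F) + ENNReal.ofReal ε + ENNReal.ofReal ε := by
          exact add_le_add (hlim.trans hZW) le_rfl
  have : IsProbabilityMeasure (P'.map Z) := Measure.isProbabilityMeasure_map hZ
  have hlim : Tendsto (fun ε : ℝ => (P'.map Z) (Metric.cthickening (2 * ε) F) + ENNReal.ofReal ε +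
      ENNReal.ofReal ε) (𝓝[>] 0) (𝓝 ((P'.map Z) F + ENNReal.ofReal 0 + ENNReal.ofReal 0)) := by
    have h2 : Tendsto (fun ε : ℝ => 2 * ε) (𝓝 0) (𝓝 0) := by
      simpa using (tendsto_id (α := ℝ) (x := 𝓝 0)).const_mul 2
    have h1 := (tendsto_measure_cthickening_of_isClosed (μ := P'.map Z)
      ⟨1, one_pos, measure_ne_top _ _⟩ hF).comp h2
    have h3 : Tendsto ENNReal.ofReal (𝓝 0) (𝓝 (ENNReal.ofReal 0)) :=
      ENNReal.continuous_ofReal.tendsto 0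
    exact ((h1.add h3).add h3).mono_left nhdsWithin_le_nhds
  simp only [ENNReal.ofReal_zero, add_zero] at hlim
  exact ge_of_tendsto hlim (eventually_mem_nhdsWithin.mono fun ε hε => key ε hε)

/-- Lévy's theorem is applied in a Euclidean space; an inner product there is a continuous linear
functional on `G`. -/
theorem charFun_map_toEuclidean {G : Type*} [NormedAddCommGroup G] [NormedSpace ℝ G]
    [FiniteDimensional ℝ G] [MeasurableSpace G] [BorelSpace G] {Ω₀ : Type*} [MeasurableSpace Ω₀]
    {Q : Measure Ω₀} {Y : Ω₀ → G} (hY : AEMeasurable Y Q)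
    (t : EuclideanSpace ℝ (Fin (Module.finrank ℝ G))) :
    charFun (Q.map fun ω => toEuclidean (Y ω)) t =
      ∫ ω, Complex.exp (((((innerSL ℝ t).comp (toEuclidean (E := G)).toContinuousLinearMap) (Y ω) :
        ℝ) : ℂ) * Complex.I) ∂Q := by
  have hem : Measurable (toEuclidean (E := G)) := (toEuclidean (E := G)).continuous.measurable
  have hc : Continuous fun x : EuclideanSpace ℝ (Fin (Module.finrank ℝ G)) =>
      Complex.exp ((inner ℝ x t : ℝ) * Complex.I) := by fun_prop
  have := integral_map (μ := Q) (φ := fun ω => toEuclidean (Y ω)) (hem.comp_aemeasurable hY)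
    hc.aestronglyMeasurable
  rw [charFun_apply, this]
  refine integral_congr_ae (ae_of_all _ fun ω => ?_)
  simp [real_inner_comm]

/-- The Cramér–Wold form of Lévy's convergence theorem. -/
theorem tendstoInDistribution_of_integral_exp {G : Type*} [NormedAddCommGroup G] [NormedSpace ℝ G]
    [FiniteDimensional ℝ G] [MeasurableSpace G] [BorelSpace G] {X : ∀ ν, Ω ν → G} {Z : Ω' → G}
    (hX : ∀ ν, AEMeasurable (X ν) (P ν)) (hZ : AEMeasurable Z P')
    (h : ∀ L : G →L[ℝ] ℝ, Tendsto (fun ν => ∫ ω, Complex.exp ((L (X ν ω) : ℂ) * Complex.I) ∂(P ν))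
      atTop (𝓝 (∫ ω, Complex.exp ((L (Z ω) : ℂ) * Complex.I) ∂P'))) :
    TendstoInDistribution X atTop Z P P' := by
  set e := toEuclidean (E := G) with he
  have hem : Measurable e := e.continuous.measurable
  have hlim : TendstoInDistribution (fun ν ω => e (X ν ω)) atTop (fun ω => e (Z ω)) P P' := by
    refine ⟨fun ν => hem.comp_aemeasurable (hX ν), hem.comp_aemeasurable hZ, ?_⟩
    refine ProbabilityMeasure.tendsto_iff_tendsto_charFun.2 fun t => ?_
    have h2 := h ((innerSL ℝ t).comp e.toContinuousLinearMap)
    have h3 := fun ν => charFun_map_toEuclidean (hX ν) t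
    have h4 := charFun_map_toEuclidean hZ t
    simp only [ProbabilityMeasure.coe_mk]
    rw [h4]
    exact h2.congr fun ν => (h3 ν).symm
  have := hlim.continuous_comp e.symm.continuous
  refine this.congr (fun ν => ae_of_all _ fun ω => ?_) (ae_of_all _ fun ω => ?_) <;> simp

end WeakConvergence

/-! ### Characteristic functions of weighted sums of independent variables -/

section CharFun

/-- Taylor's formula for `|x| ≤ 1`; for larger `x` every term on the left is dominated by `|x| ^ 3`.
-/
theorem norm_exp_mul_I_sub_le (x : ℝ) :
    ‖Complex.exp (x * Complex.I) - (1 + x * Complex.I - ((x ^ 2 / 2 : ℝ) : ℂ))‖ ≤ 4 * |x| ^ 3 := by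
  rcases le_total |x| 1 with hx | hx
  · have h := Complex.exp_bound (x := x * Complex.I) (by simpa using hx) (n := 3) (by norm_num)
    have e : ∑ m ∈ Finset.range 3, ((x : ℂ) * Complex.I) ^ m / (m.factorial : ℂ) =
        1 + x * Complex.I - ((x ^ 2 / 2 : ℝ) : ℂ) := by
      simp [Finset.sum_range_succ, mul_pow]
      ring
    rw [e] at h
    refine h.trans ?_
    simp only [norm_mul, Complex.norm_real, Complex.norm_I, mul_one, Real.norm_eq_abs]
    have : 0 ≤ |x| ^ 3 := by positivity
    norm_num [Nat.factorial]
    linarith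
  · have h1 : ‖Complex.exp (x * Complex.I)‖ = 1 := Complex.norm_exp_ofReal_mul_I x
    have h2 : ‖(1 : ℂ) + x * Complex.I - ((x ^ 2 / 2 : ℝ) : ℂ)‖ ≤ 1 + |x| + |x| ^ 2 / 2 := by
      refine (norm_sub_le _ _).trans (add_le_add ((norm_add_le _ _).trans ?_) ?_)
      · simp
      · rw [Complex.norm_real, Real.norm_eq_abs, abs_div, abs_pow]; simp
    refine (norm_sub_le _ _).trans ?_
    rw [h1]
    have h3 : |x| ≤ |x| ^ 3 := le_self_pow₀ hx (by norm_num)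
    have h4 : |x| ^ 2 ≤ |x| ^ 3 := pow_le_pow_right₀ hx (by norm_num)
    linarith

/-- The factors are exchanged one at a time, the others having modulus at most one. -/
theorem norm_prod_sub_prod_le {κ : Type*} (s : Finset κ) (f g : κ → ℂ) (hf : ∀ i, ‖f i‖ ≤ 1)
    (hg : ∀ i, ‖g i‖ ≤ 1) : ‖∏ i ∈ s, f i - ∏ i ∈ s, g i‖ ≤ ∑ i ∈ s, ‖f i - g i‖ := by
  classical
  induction s using Finset.induction_on with
  | empty => simp
  | insert a s ha ih =>
    rw [Finset.prod_insert ha, Finset.prod_insert ha, Finset.sum_insert ha]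
    have e : f a * ∏ i ∈ s, f i - g a * ∏ i ∈ s, g i =
        (f a - g a) * ∏ i ∈ s, f i + g a * (∏ i ∈ s, f i - ∏ i ∈ s, g i) := by ring
    rw [e]
    refine (norm_add_le _ _).trans (add_le_add ?_ ?_)
    · rw [norm_mul]
      refine mul_le_of_le_one_right (norm_nonneg _) ?_
      rw [norm_prod]
      exact Finset.prod_le_one (fun _ _ => norm_nonneg _) fun i _ => hf i
    · rw [norm_mul]
      exact (mul_le_of_le_one_left (norm_nonneg _) (hg a)).trans ih

/-- The characteristic function and the Gaussian factor both agree with `1 - c ^ 2 / 2` up to `O(|c|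
^ 3)`: the former by the first three moments, the latter because `|c| ≤ 1`. -/
theorem norm_integral_exp_sub_le {Ω : Type*} [MeasurableSpace Ω] {P : Measure Ω}
    [IsProbabilityMeasure P] {X : Ω → ℝ} (hX : Measurable X) (hX3 : MemLp X 3 P)
    (h0 : ∫ ω, X ω ∂P = 0) (h2 : ∫ ω, X ω ^ 2 ∂P = 1) {K : ℝ} (hK : ∫ ω, |X ω| ^ 3 ∂P ≤ K)
    (c : ℝ) (hc : |c| ≤ 1) :
    ‖∫ ω, Complex.exp (((c * X ω : ℝ) : ℂ) * Complex.I) ∂P - (Real.exp (-(c ^ 2 / 2)) : ℂ)‖ ≤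
      (4 * K + 1) * |c| ^ 3 := by
  have hi1 : Integrable X P := hX3.integrable (by norm_num)
  have hi2 : Integrable (fun ω => X ω ^ 2) P := (hX3.mono_exponent (by norm_num)).integrable_sq
  have hi3 : Integrable (fun ω => |X ω| ^ 3) P := by
    have h := hX3.integrable_norm_rpow (by norm_num) (by norm_num)
    refine h.congr (ae_of_all _ fun ω => ?_)
    simp only [Real.norm_eq_abs]
    norm_num
  have hie : Integrable (fun ω => Complex.exp (((c * X ω : ℝ) : ℂ) * Complex.I)) P := by
    refine Integrable.of_bound (C := 1) ?_ (ae_of_all _ fun ω => ?_)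
    · exact (by fun_prop : Measurable fun ω =>
        Complex.exp (((c * X ω : ℝ) : ℂ) * Complex.I)).aestronglyMeasurable
    · rw [Complex.norm_exp_ofReal_mul_I]
  have hiq : Integrable (fun ω => (c * X ω) ^ 2 / 2) P := by
    simp only [mul_pow]
    exact (hi2.const_mul (c ^ 2)).div_const 2
  have hip : Integrable (fun ω => (1 : ℂ) + ((c * X ω : ℝ) : ℂ) * Complex.I -
      (((c * X ω) ^ 2 / 2 : ℝ) : ℂ)) P := by
    refine ((integrable_const _).add ((hi1.const_mul c).ofReal.mul_const _)).sub ?_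
    exact hiq.ofReal
  have e1 : ∫ ω, ((1 : ℂ) + ((c * X ω : ℝ) : ℂ) * Complex.I - (((c * X ω) ^ 2 / 2 : ℝ) : ℂ)) ∂P =
      ((1 - c ^ 2 / 2 : ℝ) : ℂ) := by
    rw [integral_sub, integral_add, integral_mul_const, integral_complex_ofReal, integral_complex_ofReal,
      integral_const_mul, h0]
    · have : ∫ ω, (c * X ω) ^ 2 / 2 ∂P = c ^ 2 / 2 := by
        simp only [mul_pow]
        rw [integral_div, integral_const_mul, h2, mul_one]
      rw [this]
      simp
    · exact integrable_const _
    · exact (hi1.const_mul c).ofReal.mul_const _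
    · exact (integrable_const _).add ((hi1.const_mul c).ofReal.mul_const _)
    · exact hiq.ofReal
  have h3 : ‖∫ ω, Complex.exp (((c * X ω : ℝ) : ℂ) * Complex.I) ∂P - ((1 - c ^ 2 / 2 : ℝ) : ℂ)‖ ≤
      4 * K * |c| ^ 3 := by
    rw [← e1, ← integral_sub hie hip]
    calc _ ≤ ∫ ω, 4 * |c| ^ 3 * |X ω| ^ 3 ∂P := by
          refine norm_integral_le_of_norm_le (hi3.const_mul _) (ae_of_all _ fun ω => ?_)
          refine (norm_exp_mul_I_sub_le _).trans_eq ?_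
          rw [abs_mul, mul_pow]
          ring
      _ ≤ 4 * K * |c| ^ 3 := by
          rw [integral_const_mul]
          have : 0 ≤ |c| ^ 3 := by positivity
          nlinarith
  have h4 : ‖((1 - c ^ 2 / 2 : ℝ) : ℂ) - (Real.exp (-(c ^ 2 / 2)) : ℂ)‖ ≤ |c| ^ 3 := by
    rw [← Complex.ofReal_sub, Complex.norm_real, norm_sub_rev, Real.norm_eq_abs]
    have hc2 : c ^ 2 ≤ 1 := by rw [← sq_abs]; exact pow_le_one₀ (abs_nonneg c) hc
    have h5 := Real.norm_exp_sub_one_sub_id_le (x := -(c ^ 2 / 2)) (by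
      rw [norm_neg, Real.norm_eq_abs, abs_of_nonneg (by positivity)]; linarith)
    rw [norm_neg] at h5
    simp only [Real.norm_eq_abs, sq_abs] at h5
    have h6 : (c ^ 2 / 2) ^ 2 ≤ |c| ^ 3 := by
      have : |c| ^ 4 ≤ |c| ^ 3 := pow_le_pow_of_le_one (abs_nonneg c) hc (by norm_num)
      have e : c ^ 4 = |c| ^ 4 := by rw [← abs_pow, abs_of_nonneg (by positivity)]
      nlinarith [sq_nonneg (c ^ 2)]
    refine le_trans (le_of_eq ?_) (h5.trans h6)
    congr 1
    ring
  calc _ ≤ _ := norm_sub_le_norm_sub_add_norm_sub _ ((1 - c ^ 2 / 2 : ℝ) : ℂ) _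
    _ ≤ 4 * K * |c| ^ 3 + |c| ^ 3 := add_le_add h3 h4
    _ = _ := by ring

/-- The central limit theorem for triangular arrays with bounded third moments. -/
theorem tendsto_integral_exp_sum {Ω : ℕ → Type*} [∀ ν, MeasurableSpace (Ω ν)]
    {P : ∀ ν, Measure (Ω ν)} [∀ ν, IsProbabilityMeasure (P ν)] {κ : ℕ → Type*} [∀ ν, Fintype (κ ν)]
    {V : ∀ ν, κ ν → Ω ν → ℝ} (hVm : ∀ ν p, Measurable (V ν p)) (hVi : ∀ ν, iIndepFun (V ν) (P ν))
    (hV3 : ∀ ν p, MemLp (V ν p) 3 (P ν)) (hV0 : ∀ ν p, ∫ ω, V ν p ω ∂(P ν) = 0)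
    (hV2 : ∀ ν p, ∫ ω, V ν p ω ^ 2 ∂(P ν) = 1) {K : ℝ}
    (hK : ∀ ν p, ∫ ω, |V ν p ω| ^ 3 ∂(P ν) ≤ K) (c : ∀ ν, κ ν → ℝ) {η : ℕ → ℝ}
    (hη : Tendsto η atTop (𝓝 0)) (hc : ∀ ν p, |c ν p| ≤ η ν) {s : ℝ}
    (hs : Tendsto (fun ν => ∑ p, c ν p ^ 2) atTop (𝓝 s)) :
    Tendsto (fun ν => ∫ ω, Complex.exp (((∑ p, c ν p * V ν p ω : ℝ) : ℂ) * Complex.I) ∂(P ν)) atTop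
      (𝓝 (Real.exp (-(s / 2)) : ℂ)) := by
  have hprod : ∀ ν, ∫ ω, Complex.exp (((∑ p, c ν p * V ν p ω : ℝ) : ℂ) * Complex.I) ∂(P ν) =
      ∏ p, ∫ ω, Complex.exp (((c ν p * V ν p ω : ℝ) : ℂ) * Complex.I) ∂(P ν) := by
    intro ν
    have := (hVi ν).integral_fun_prod_comp (𝕜 := ℂ)
      (f := fun p x => Complex.exp (((c ν p * x : ℝ) : ℂ) * Complex.I))
      (fun p => (hVm ν p).aemeasurable)
      (fun p => (by fun_prop : Measurable fun x : ℝ =>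
        Complex.exp (((c ν p * x : ℝ) : ℂ) * Complex.I)).aestronglyMeasurable)
    rw [← this]
    refine integral_congr_ae (ae_of_all _ fun ω => ?_)
    simp only
    rw [← Complex.exp_sum]
    congr 1
    push_cast
    rw [Finset.sum_mul]
  have hgauss : ∀ ν, (Real.exp (-((∑ p, c ν p ^ 2) / 2)) : ℂ) =
      ∏ p, (Real.exp (-(c ν p ^ 2 / 2)) : ℂ) := by
    intro ν
    rw [← Complex.ofReal_prod, ← Real.exp_sum]
    congr 2
    rw [Finset.sum_neg_distrib, Finset.sum_div]
  have hη1 : ∀ᶠ ν in atTop, η ν ≤ 1 := hη.eventually_le_const one_pos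
  -- Lyapunov's argument: the error is a sum of `|c| ^ 3`, at most the largest coefficient times the
  -- sum of the squares.
  have hbound : ∀ᶠ ν in atTop,
      ‖∫ ω, Complex.exp (((∑ p, c ν p * V ν p ω : ℝ) : ℂ) * Complex.I) ∂(P ν) -
        (Real.exp (-((∑ p, c ν p ^ 2) / 2)) : ℂ)‖ ≤ (4 * |K| + 1) * (η ν * ∑ p, c ν p ^ 2) := by
    filter_upwards [hη1] with ν hν
    rw [hprod, hgauss]
    refine (norm_prod_sub_prod_le _ _ _ (fun p => ?_) (fun p => ?_)).trans ?_
    · refine (norm_integral_le_of_norm_le_const (C := 1) (ae_of_all _ fun ω => ?_)).trans ?_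
      · rw [Complex.norm_exp_ofReal_mul_I]
      · simp
    · rw [Complex.norm_real, Real.norm_eq_abs, abs_of_pos (Real.exp_pos _)]
      exact Real.exp_le_one_iff.2 (by have := sq_nonneg (c ν p); linarith)
    · rw [Finset.mul_sum, Finset.mul_sum]
      refine Finset.sum_le_sum fun p _ => ?_
      refine (norm_integral_exp_sub_le (hVm ν p) (hV3 ν p) (hV0 ν p) (hV2 ν p)
        ((hK ν p).trans (le_abs_self K)) (c ν p) ((hc ν p).trans hν)).trans ?_
      have e : |c ν p| ^ 3 = |c ν p| * c ν p ^ 2 := by rw [← sq_abs (c ν p)]; ring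
      rw [e]
      gcongr
      exact hc ν p
  have hz : Tendsto (fun ν => (4 * |K| + 1) * (η ν * ∑ p, c ν p ^ 2)) atTop (𝓝 0) := by
    simpa using (hη.mul hs).const_mul (4 * |K| + 1)
  have h1 := squeeze_zero_norm' hbound hz
  have h2 : Tendsto (fun ν => (Real.exp (-((∑ p, c ν p ^ 2) / 2)) : ℂ)) atTop
      (𝓝 (Real.exp (-(s / 2)) : ℂ)) :=
    (Complex.continuous_ofReal.tendsto _).comp
      ((Real.continuous_exp.tendsto _).comp (hs.div_const 2).neg)
  simpa using h1.add h2

end CharFun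

/-! ### The noise in a box -/

section BoxNoise

variable {Ω : Type*} [mΩ : MeasurableSpace Ω] {P : Measure Ω} [IsProbabilityMeasure P] {m n : ℕ}
  {V : Fin m × Fin n → Ω → ℝ} {K : ℝ}

/-- Independent centred variables with variance `1` and third moments at most `K`. -/
structure IsBoxNoise (P : Measure Ω) (V : Fin m × Fin n → Ω → ℝ) (K : ℝ) : Prop where
  measurable : ∀ p, Measurable (V p)
  indep : iIndepFun V P
  mean : ∀ p, ∫ ω, V p ω ∂P = 0
  var : ∀ p, ∫ ω, V p ω ^ 2 ∂P = 1
  memLp : ∀ p, MemLp (V p) 3 P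
  cube_le : ∀ p, ∫ ω, |V p ω| ^ 3 ∂P ≤ K

/-- A bound on the lower integral carries the integrability of the third power, which a bound on the
Bochner integral would not. -/
theorem isBoxNoise_of_lintegral {K : NNReal} (hVmeas : ∀ p, Measurable (V p))
    (hVindep : iIndepFun V P) (hVmean : ∀ p, ∫ ω, V p ω ∂P = 0)
    (hVvar : ∀ p, ∫ ω, V p ω ^ 2 ∂P = 1)
    (hVthird : ∀ p, ∫⁻ ω, ENNReal.ofReal (|V p ω| ^ 3) ∂P ≤ K) : IsBoxNoise P V K where
  measurable := hVmeas
  indep := hVindep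
  mean := hVmean
  var := hVvar
  memLp p := by
    refine ⟨(hVmeas p).aestronglyMeasurable, ?_⟩
    rw [eLpNorm_lt_top_iff_lintegral_rpow_enorm_lt_top (by norm_num) (by norm_num)]
    refine lt_of_le_of_lt (lintegral_mono fun ω => ?_) ((hVthird p).trans_lt ENNReal.coe_lt_top)
    rw [Real.enorm_eq_ofReal_abs, ENNReal.ofReal_rpow_of_nonneg (abs_nonneg _) (by norm_num)]
    refine ENNReal.ofReal_le_ofReal (le_of_eq ?_)
    norm_num
  cube_le p := by
    rw [integral_eq_lintegral_of_nonneg_ae (ae_of_all _ fun ω => by positivity)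
      ((hVmeas p).abs.pow_const 3).aestronglyMeasurable]
    exact ENNReal.toReal_le_of_le_ofReal K.coe_nonneg (by simpa using hVthird p)

/-- The potential enters the transfer matrices with a minus sign, so the evolution is driven by
`-V`, a noise of the same kind. -/
theorem IsBoxNoise.neg (hV : IsBoxNoise P V K) : IsBoxNoise P (fun p ω => -V p ω) K where
  measurable p := (hV.measurable p).neg
  indep := hV.indep.comp (fun _ x => -x) fun _ => measurable_neg
  mean p := by rw [integral_neg, hV.mean, neg_zero]
  var p := by simpa using hV.var p
  memLp p := (hV.memLp p).neg
  cube_le p := by simpa using hV.cube_le p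

/-- The noise of the box as a sequence of slices. -/
def sliceNoise (V : Fin m × Fin n → Ω → ℝ) (k : ℕ) (a : Fin m) (ω : Ω) : ℝ :=
  slice (fun p => V p ω) k a

theorem sliceNoise_of_lt (V : Fin m × Fin n → Ω → ℝ) {k : ℕ} (hk : k < n) (a : Fin m) :
    sliceNoise V k a = V (a, ⟨k, hk⟩) := by
  ext ω
  simp [sliceNoise, slice, hk]

theorem sliceNoise_of_not_lt (V : Fin m × Fin n → Ω → ℝ) {k : ℕ} (hk : ¬ k < n) (a : Fin m) :
    sliceNoise V k a = fun _ => 0 := by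
  ext ω
  simp [sliceNoise, slice, hk]

/-- The filtration generated by the slices of the box. -/
def boxFiltration (V : Fin m × Fin n → Ω → ℝ) (hV : ∀ p, Measurable (V p)) :
    Filtration ℕ mΩ where
  seq k := ⨆ p ∈ {p : Fin m × Fin n | (p.2 : ℕ) < k}, MeasurableSpace.comap (V p) inferInstance
  mono' _ _ h := biSup_mono fun _ hp => lt_of_lt_of_le hp h
  le' _ := iSup₂_le fun p _ => (hV p).comap_le

/-- Different slices involve disjoint sets of independent variables. The slices beyond the end of
the box are zero, and this is where `0 ≤ K` enters. -/
theorem IsBoxNoise.isNoise (hV : IsBoxNoise P V K) (hK : 0 ≤ K) :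
    IsNoise P (boxFiltration V hV.measurable) (sliceNoise V) K where
  measurable_succ k a := by
    by_cases hk : k < n
    · rw [sliceNoise_of_lt V hk]
      refine (comap_measurable (V (a, ⟨k, hk⟩))).mono ?_ le_rfl
      exact le_iSup₂_of_le (f := fun p _ => MeasurableSpace.comap (V p) inferInstance)
        (a, ⟨k, hk⟩) (Nat.lt_succ_self k) le_rfl
    · rw [sliceNoise_of_not_lt V hk]
      exact measurable_const
  indep k a := by
    by_cases hk : k < n
    · rw [sliceNoise_of_lt V hk]
      have := indep_iSup_of_disjoint (fun p => (hV.measurable p).comap_le) hV.indep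
        (S := {(a, ⟨k, hk⟩)}) (T := {p : Fin m × Fin n | (p.2 : ℕ) < k}) (by simp)
      simp only [Set.mem_singleton_iff, iSup_iSup_eq_left] at this
      exact this
    · rw [sliceNoise_of_not_lt V hk, MeasurableSpace.comap_const]
      exact indep_bot_left _
  mean k a := by
    by_cases hk : k < n
    · rw [sliceNoise_of_lt V hk, hV.mean]
    · rw [sliceNoise_of_not_lt V hk, integral_zero]
  memLp k a := by
    by_cases hk : k < n
    · rw [sliceNoise_of_lt V hk]
      exact hV.memLp _
    · rw [sliceNoise_of_not_lt V hk]
      exact memLp_const _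
  sq_le k a := by
    by_cases hk : k < n
    · rw [sliceNoise_of_lt V hk, hV.var]
    · rw [sliceNoise_of_not_lt V hk]
      simp
  cube_le k a := by
    by_cases hk : k < n
    · rw [sliceNoise_of_lt V hk]
      exact hV.cube_le _
    · rw [sliceNoise_of_not_lt V hk]
      simpa using hK

theorem sum_box_eq {M : Type*} [AddCommMonoid M] (f : ℕ → Fin m → M) (n : ℕ) :
    ∑ p : Fin m × Fin n, f p.2 p.1 = ∑ k ∈ Finset.range n, ∑ a, f k a := by
  rw [Fintype.sum_prod_type_right, Finset.sum_range]

end BoxNoise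

/-! ### Step paths -/

section Paths

/-- The extended distance of uniform convergence. -/
instance {E : Type*} [PseudoEMetricSpace E] : PseudoEMetricSpace (PathSpace E) :=
  inferInstanceAs (PseudoEMetricSpace (UniformFun unitInterval E))

theorem PathSpace.edist_mk_le {E : Type*} [PseudoEMetricSpace E] {f g : unitInterval → E}
    {C : ENNReal} (h : ∀ t, edist (f t) (g t) ≤ C) :
    edist (PathSpace.mk f) (PathSpace.mk g) ≤ C :=
  UniformFun.edist_le.2 h

theorem PathSpace.edist_le_edist_mk {E : Type*} [PseudoEMetricSpace E] {f g : unitInterval → E}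
    (t : unitInterval) : edist (f t) (g t) ≤ edist (PathSpace.mk f) (PathSpace.mk g) :=
  UniformFun.edist_eval_le (f := UniformFun.ofFun f) (g := UniformFun.ofFun g)

/-- A step path depends on its finitely many values without increasing distances. Measurability of
step paths comes from this, since the space of paths with the uniform topology is not separable and
coordinates do not generate its Borel sets. -/
theorem PathSpace.continuous_mk_comp {E ι : Type*} [PseudoEMetricSpace E] [Fintype ι]
    (c : unitInterval → ι) : Continuous fun x : ι → E => PathSpace.mk fun t => x (c t) := by
  have : LipschitzWith 1 fun x : ι → E => PathSpace.mk fun t => x (c t) := by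
    intro x y
    rw [ENNReal.coe_one, one_mul]
    exact PathSpace.edist_mk_le fun t => edist_le_pi_edist x y (c t)
  exact this.continuous

/-- The last point of the grid of mesh `1 / (N + 1)` before a given time. -/
def gridPoint (N : ℕ) (i : Fin (N + 2)) : unitInterval :=
  ⟨(i : ℝ) / (N + 1), by positivity, by
    rw [div_le_one (by positivity)]
    have : (i : ℕ) ≤ N + 1 := Nat.lt_succ_iff.1 i.2
    exact_mod_cast this⟩

/-- The index of the last grid point before a given time. -/
def gridIndex (N : ℕ) (t : unitInterval) : Fin (N + 2) :=
  ⟨⌊((N : ℝ) + 1) * t⌋₊, by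
    rw [Nat.floor_lt (mul_nonneg (by positivity) t.2.1)]
    have := mul_le_mul_of_nonneg_left t.2.2 (by positivity : (0 : ℝ) ≤ (N : ℝ) + 1)
    push_cast
    linarith⟩

theorem gridPoint_le (N : ℕ) (t : unitInterval) : (gridPoint N (gridIndex N t) : ℝ) ≤ t := by
  simp only [gridPoint, gridIndex]
  rw [div_le_iff₀ (by positivity), mul_comm (t : ℝ)]
  exact Nat.floor_le (mul_nonneg (by positivity) t.2.1)

theorem le_gridPoint_add (N : ℕ) (t : unitInterval) :
    (t : ℝ) ≤ gridPoint N (gridIndex N t) + 1 / (N + 1) := by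
  simp only [gridPoint, gridIndex]
  rw [← add_div, le_div_iff₀ (by positivity), mul_comm]
  exact (Nat.lt_floor_add_one _).le

theorem tendsto_grid {E : Type*} [PseudoMetricSpace E] {g : unitInterval → E} (hg : Continuous g) :
    Tendsto (fun N => PathSpace.mk fun t => g (gridPoint N (gridIndex N t))) atTop
      (𝓝 (PathSpace.mk g)) := by
  have hu := CompactSpace.uniformContinuous_of_continuous hg
  rw [Metric.uniformContinuous_iff] at hu
  rw [EMetric.tendsto_atTop]
  intro ε hε
  obtain ⟨δ, hδ, hδε⟩ := ENNReal.lt_iff_exists_real_btwn.1 hε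
  have hδ0 : 0 < δ := ENNReal.ofReal_pos.1 (by exact hδε.1)
  obtain ⟨η, hη, h⟩ := hu δ hδ0
  obtain ⟨N₀, hN₀⟩ := exists_nat_one_div_lt hη
  refine ⟨N₀, fun N hN => lt_of_le_of_lt (PathSpace.edist_mk_le fun t => ?_) hδε.2⟩
  rw [edist_dist]
  refine ENNReal.ofReal_le_ofReal (h ?_).le
  rw [Subtype.dist_eq, Real.dist_eq, abs_lt]
  have h1 := gridPoint_le N t
  have h2 := le_gridPoint_add N t
  have h3 : 1 / ((N : ℝ) + 1) ≤ 1 / (N₀ + 1) := by gcongr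
  constructor <;> linarith

/-- Almost surely the path is a uniform limit of its step paths on grids, and these are continuous
images of finite-dimensional vectors. -/
theorem aestronglyMeasurable_path {E Ω : Type*} [NormedAddCommGroup E] [NormedSpace ℝ E]
    [FiniteDimensional ℝ E] [MeasurableSpace E] [BorelSpace E] [MeasurableSpace Ω] {P : Measure Ω}
    {G : unitInterval → Ω → E} (hG : ∀ t, AEMeasurable (G t) P)
    (hGc : ∀ᵐ ω ∂P, Continuous fun t => G t ω) :
    AEStronglyMeasurable (fun ω => PathSpace.mk fun t => G t ω) P := by
  refine aestronglyMeasurable_of_tendsto_ae atTop (f := fun N ω =>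
    PathSpace.mk fun t => G (gridPoint N (gridIndex N t)) ω) (fun N => ?_)
    (hGc.mono fun ω hω => tendsto_grid hω)
  have h1 : AEMeasurable (fun ω (i : Fin (N + 2)) => G (gridPoint N i) ω) P :=
    aemeasurable_pi_lambda _ fun i => hG _
  exact (PathSpace.continuous_mk_comp (gridIndex N)).comp_aestronglyMeasurable
    h1.aestronglyMeasurable

theorem floor_mul_lt_succ (n : ℕ) (t : unitInterval) : ⌊(n : ℝ) * t⌋₊ < n + 1 := by
  rw [Nat.floor_lt (mul_nonneg (by positivity) t.2.1)]
  have := mul_le_mul_of_nonneg_left t.2.2 (by positivity : (0 : ℝ) ≤ (n : ℝ))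
  push_cast
  linarith

theorem measurable_stepPath {E Ω : Type*} [NormedAddCommGroup E] [SecondCountableTopology E]
    [MeasurableSpace E] [BorelSpace E] [MeasurableSpace Ω] (n : ℕ)
    {S : ℕ → Ω → E} (hS : ∀ k, Measurable (S k)) :
    Measurable fun ω => PathSpace.mk fun t : unitInterval => S ⌊(n : ℝ) * t⌋₊ ω := by
  have h1 : Measurable fun ω (i : Fin (n + 1)) => S i ω := measurable_pi_lambda _ fun i => hS i
  exact (PathSpace.continuous_mk_comp
    (fun t => (⟨⌊(n : ℝ) * t⌋₊, floor_mul_lt_succ n t⟩ : Fin (n + 1)))).measurable.comp h1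

end Paths

/-! ### The functional central limit theorem -/

section FCLT

theorem sum_box_ite_eq {M : Type*} [AddCommMonoid M] {m n q : ℕ} (f : ℕ → Fin m → M) (hq : q ≤ n) :
    ∑ p : Fin m × Fin n, (if (p.2 : ℕ) < q then f p.2 p.1 else 0) =
      ∑ k ∈ Finset.range q, ∑ a, f k a := by
  rw [sum_box_eq (fun k a => if k < q then f k a else 0),
    ← Finset.sum_subset (Finset.range_mono hq) (f := fun k => ∑ a, if k < q then f k a else 0)]
  · exact Finset.sum_congr rfl fun k hk => Finset.sum_congr rfl fun a _ =>
      if_pos (Finset.mem_range.1 hk)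
  · intro k _ hk
    exact Finset.sum_eq_zero fun a _ => if_neg (by simpa using hk)

theorem map_noiseSum {Ω α E E' : Type*} [Fintype α] [AddCommMonoid E] [Module ℝ E]
    [AddCommMonoid E'] [Module ℝ E'] (L : E →ₗ[ℝ] E') (v : ℕ → α → Ω → ℝ) (H : ℕ → α → Ω → E)
    (k : ℕ) (ω : Ω) : L (noiseSum v H k ω) = noiseSum v (fun j a ω => L (H j a ω)) k ω := by
  simp [noiseSum, map_sum]

theorem noiseSum_add {Ω α E : Type*} [Fintype α] [AddCommMonoid E] [Module ℝ E]
    (v : ℕ → α → Ω → ℝ) (H : ℕ → α → Ω → E) (k₀ k : ℕ) (ω : Ω) :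
    noiseSum v H (k₀ + k) ω = noiseSum v H k₀ ω +
      noiseSum (fun j => v (k₀ + j)) (fun j => H (k₀ + j)) k ω := by
  simp only [noiseSum, Finset.sum_range_add]

/-! ### Oscillation of the noise over short blocks -/

section Modulus

variable {Ω : Type*} [mΩ : MeasurableSpace Ω] {P : Measure Ω} [IsProbabilityMeasure P] {α : Type*}
  [Fintype α] {F : Filtration ℕ mΩ} {v : ℕ → α → Ω → ℝ} {K : ℝ}

/-- Doob's inequality with exponent 3 for the martingale restarted at time `k₀`. The gain is the
power `ℓ ^ (3/2)`: as it exceeds 1, the sum over about `n / ℓ` blocks is still small when the blocks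
are short compared with `n`. Second moments would give only the power 1. -/
theorem IsNoise.measure_block_real_le (hv : IsNoise P F v K) (hK : 0 ≤ K) {h : ℕ → α → ℝ} {η : ℝ}
    (hη : ∀ k a, |h k a| ≤ η) (hη0 : 0 ≤ η) {δ : ℝ} (hδ : 0 < δ) (k₀ ℓ : ℕ) :
    P.real {ω | ∃ k ≤ ℓ, δ ≤ |noiseSum v (fun k a _ => h k a) (k₀ + k) ω -
        noiseSum v (fun k a _ => h k a) k₀ ω|} ≤
      (3 + K) * ((Fintype.card α : ℝ) * η / δ) ^ 3 * (ℓ * √ℓ) := by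
  have hs := hv.shift k₀
  have hH : IsPredictable P (shiftFiltration F k₀) (fun k a (_ : Ω) => h (k₀ + k) a) :=
    isPredictable_const _
  obtain ⟨h1, h2⟩ := hs.integral_abs_noiseSum_cube_le (h := fun k a => h (k₀ + k) a)
    (fun k a => hη _ a) hη0 ℓ
  have h3 := measure_exists_le_norm_le (hs.martingale_noiseSum hH) hδ ℓ 3 (by norm_num)
    (by simpa only [Real.norm_eq_abs] using h1)
  simp only [noiseSum_add, add_sub_cancel_left]
  simp only [Real.norm_eq_abs] at h3
  refine h3.trans ?_
  rw [div_pow, mul_div_assoc', div_mul_eq_mul_div]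
  gcongr
  refine h2.trans ?_
  -- This absorbs the term linear in `ℓ`, which comes from the third moments of single variables.
  have hℓ : (ℓ : ℝ) ≤ ℓ * √ℓ := by
    rcases Nat.eq_zero_or_pos ℓ with rfl | hpos
    · simp
    · have : (1 : ℝ) ≤ ℓ := by exact_mod_cast hpos
      exact le_mul_of_one_le_right (by positivity) (Real.one_le_sqrt.2 this)
  calc (3 * (ℓ * √ℓ) + ℓ * K) * ((Fintype.card α : ℝ) * η) ^ 3
      ≤ (3 * (ℓ * √ℓ) + (ℓ * √ℓ) * K) * ((Fintype.card α : ℝ) * η) ^ 3 := by gcongr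
    _ = _ := by ring

variable {E : Type*} [NormedAddCommGroup E] [NormedSpace ℝ E] [FiniteDimensional ℝ E]

/-- Maximal inequality for a block of the noise. -/
theorem IsNoise.exists_measure_block_le (α E : Type*) [Fintype α] [NormedAddCommGroup E]
    [NormedSpace ℝ E] [FiniteDimensional ℝ E] {K C δ : ℝ} (hK : 0 ≤ K) (hC : 0 ≤ C) (hδ : 0 < δ) :
    ∃ D : ℝ, 0 ≤ D ∧ ∀ {Ω : Type*} [mΩ : MeasurableSpace Ω] (P : Measure Ω)
      [IsProbabilityMeasure P] (F : Filtration ℕ mΩ) (v : ℕ → α → Ω → ℝ), IsNoise P F v K →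
      ∀ (h : ℕ → α → E) (θ : ℝ), 0 ≤ θ → (∀ k a, ‖h k a‖ ≤ C * θ) → ∀ k₀ ℓ : ℕ,
        P.real {ω | ∃ k ≤ ℓ, δ ≤ ‖noiseSum v (fun k a _ => h k a) (k₀ + k) ω -
          noiseSum v (fun k a _ => h k a) k₀ ω‖} ≤ D * θ ^ 3 * (ℓ * √ℓ) := by
  set d := Module.finrank ℝ E
  obtain ⟨e⟩ : Nonempty (E ≃L[ℝ] (Fin d → ℝ)) :=
    FiniteDimensional.nonempty_continuousLinearEquiv_of_finrank_eq (by simp [d])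
  -- The summand 1 keeps `M` positive, so that it may be divided by, also when `E` is trivial.
  set M : ℝ := ‖(e.symm : (Fin d → ℝ) →L[ℝ] E)‖ + 1 with hM
  set M' : ℝ := ‖(e : E →L[ℝ] (Fin d → ℝ))‖ with hM'
  have hM0 : 0 < M := by positivity
  refine ⟨d * ((3 + K) * ((Fintype.card α : ℝ) * (M' * C) / (δ / M)) ^ 3), by positivity, ?_⟩
  intro Ω _ P _ F v hv h θ hθ hh k₀ ℓ
  have hcoord : ∀ (b : Fin d), ∀ k a, |e (h k a) b| ≤ M' * C * θ := by
    intro b k a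
    have h1 : |e (h k a) b| ≤ ‖e (h k a)‖ := norm_le_pi_norm (e (h k a)) b
    have h2 : ‖e (h k a)‖ ≤ M' * ‖h k a‖ := (e : E →L[ℝ] (Fin d → ℝ)).le_opNorm _
    calc |e (h k a) b| ≤ M' * ‖h k a‖ := h1.trans h2
      _ ≤ M' * (C * θ) := by gcongr; exact hh k a
      _ = _ := by ring
  have hsub : {ω | ∃ k ≤ ℓ, δ ≤ ‖noiseSum v (fun k a _ => h k a) (k₀ + k) ω -
          noiseSum v (fun k a _ => h k a) k₀ ω‖} ⊆
      ⋃ b : Fin d, {ω | ∃ k ≤ ℓ, δ / M ≤ |noiseSum v (fun k a _ => e (h k a) b) (k₀ + k) ω -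
        noiseSum v (fun k a _ => e (h k a) b) k₀ ω|} := by
    rintro ω ⟨k, hk, hω⟩
    by_contra hcon
    simp only [Set.mem_iUnion, Set.mem_setOf_eq, not_exists, not_and, not_le] at hcon
    set x := noiseSum v (fun k a _ => h k a) (k₀ + k) ω - noiseSum v (fun k a _ => h k a) k₀ ω
    have hx : ∀ b, ‖e x b‖ < δ / M := by
      intro b
      have h1 := hcon b k hk
      have h2 : ∀ j, noiseSum v (fun k a _ => e (h k a) b) j ω =
          e (noiseSum v (fun k a _ => h k a) j ω) b := fun j =>
        (map_noiseSum ((LinearMap.proj b).comp (e : E →ₗ[ℝ] (Fin d → ℝ))) v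
          (fun k a _ => h k a) j ω).symm
      rw [h2, h2] at h1
      simpa [x, map_sub] using h1
    have h3 : ‖e x‖ < δ / M := (pi_norm_lt_iff (by positivity)).2 hx
    have h4 : ‖x‖ ≤ M * ‖e x‖ := by
      calc ‖x‖ = ‖(e.symm : (Fin d → ℝ) →L[ℝ] E) (e x)‖ := by simp
        _ ≤ ‖(e.symm : (Fin d → ℝ) →L[ℝ] E)‖ * ‖e x‖ := ContinuousLinearMap.le_opNorm _ _
        _ ≤ M * ‖e x‖ := by gcongr; linarith
    rw [lt_div_iff₀ hM0] at h3
    linarith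
  calc _ ≤ P.real (⋃ b : Fin d, {ω | ∃ k ≤ ℓ, δ / M ≤
        |noiseSum v (fun k a _ => e (h k a) b) (k₀ + k) ω -
        noiseSum v (fun k a _ => e (h k a) b) k₀ ω|}) := measureReal_mono hsub
    _ ≤ ∑ b : Fin d, P.real {ω | ∃ k ≤ ℓ, δ / M ≤
        |noiseSum v (fun k a _ => e (h k a) b) (k₀ + k) ω -
        noiseSum v (fun k a _ => e (h k a) b) k₀ ω|} := measureReal_iUnion_fintype_le _
    _ ≤ ∑ b : Fin d, (3 + K) * ((Fintype.card α : ℝ) * (M' * C * θ) / (δ / M)) ^ 3 * (ℓ * √ℓ) :=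
        Finset.sum_le_sum fun b _ => hv.measure_block_real_le hK (hcoord b) (by positivity)
          (by positivity) k₀ ℓ
    _ = _ := by
        rw [Finset.sum_const, Finset.card_univ, Fintype.card_fin, nsmul_eq_mul]
        ring

end Modulus

variable {Ω : ℕ → Type*} [∀ ν, MeasurableSpace (Ω ν)] {P : ∀ ν, Measure (Ω ν)}
  [∀ ν, IsProbabilityMeasure (P ν)] {Ω' : Type*} [MeasurableSpace Ω'] {P' : Measure Ω'}
  [IsProbabilityMeasure P'] {m : ℕ} {n : ℕ → ℕ} {V : ∀ ν, Fin m × Fin (n ν) → Ω ν → ℝ} {K : ℝ}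
  {E : Type*} [NormedAddCommGroup E] [NormedSpace ℝ E] [FiniteDimensional ℝ E]
  [MeasurableSpace E] [BorelSpace E]

/-- Coefficients of size `O(n ^ (-1/2))` whose covariances converge to those of a Brownian motion
with covariance form `Γ`. -/
structure HasBrownianCoefficients (n : ℕ → ℕ) (h : ∀ ν : ℕ, ℕ → Fin m → E) (C : ℝ)
    (Γ : (E →L[ℝ] ℝ) → (E →L[ℝ] ℝ) → ℝ) : Prop where
  nonneg : 0 ≤ C
  norm_le : ∀ ν k a, ‖h ν k a‖ ≤ C * (√(n ν))⁻¹
  tendsto : ∀ L L' (t : unitInterval), Tendsto (fun ν => ∑ k ∈ Finset.range ⌊(n ν : ℝ) * t⌋₊,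
    ∑ a, L (h ν k a) * L' (h ν k a)) atTop (𝓝 (t * Γ L L'))

/-- A continuous centred Gaussian process with the covariances of a Brownian motion with covariance
form `Γ`. -/
structure IsBrownian (G : unitInterval → Ω' → E) (P' : Measure Ω')
    (Γ : (E →L[ℝ] ℝ) → (E →L[ℝ] ℝ) → ℝ) : Prop where
  gaussian : IsGaussianProcess G P'
  continuous_paths : ∀ᵐ ω ∂P', Continuous fun t => G t ω
  mean : ∀ t (L : E →L[ℝ] ℝ), ∫ ω, L (G t ω) ∂P' = 0
  cov : ∀ (s t : unitInterval) (L L' : E →L[ℝ] ℝ), ∫ ω, L (G s ω) * L' (G t ω) ∂P' = min (s : ℝ) t * Γ L L'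

/-- A linear combination of the values of a Gaussian process is a real Gaussian variable. Here it is
centred, and its variance is read off from the covariances. -/
theorem IsBrownian.integral_exp_sum {ι : Type*} [Fintype ι] {G : unitInterval → Ω' → E}
    {Γ : (E →L[ℝ] ℝ) → (E →L[ℝ] ℝ) → ℝ} (hG : IsBrownian G P' Γ) (t : ι → unitInterval)
    (L : ι → E →L[ℝ] ℝ) :
    ∫ ω, Complex.exp (((∑ i, L i (G (t i) ω) : ℝ) : ℂ) * Complex.I) ∂P' =
      (Real.exp (-((∑ i, ∑ j, min (t i : ℝ) (t j) * Γ (L i) (L j)) / 2)) : ℂ) := by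
  classical
  have hlaw : HasGaussianLaw (fun ω => ∑ i, L i (G (t i) ω)) P' := by
    have h1 := hG.gaussian.hasGaussianLaw (Finset.univ.image t)
    have h2 := h1.map_fun (∑ i, (L i).comp (ContinuousLinearMap.proj
      (⟨t i, Finset.mem_image_of_mem t (Finset.mem_univ i)⟩ : (Finset.univ.image t : Finset _))))
    refine h2.congr (ae_of_all _ fun ω => ?_)
    simp [ContinuousLinearMap.sum_apply]
  have hL2 : ∀ i, MemLp (fun ω => L i (G (t i) ω)) 2 P' := fun i =>
    ((hG.gaussian.hasGaussianLaw_eval (t i)).map_fun (L i)).memLp_two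
  have hmean : ∫ ω, ∑ i, L i (G (t i) ω) ∂P' = 0 := by
    rw [integral_finsetSum _ fun i _ => (hL2 i).integrable (by norm_num)]
    exact Finset.sum_eq_zero fun i _ => hG.mean _ _
  have hvar : Var[fun ω => ∑ i, L i (G (t i) ω); P'] =
      ∑ i, ∑ j, min (t i : ℝ) (t j) * Γ (L i) (L j) := by
    rw [variance_of_integral_eq_zero hlaw.aemeasurable hmean]
    have : ∀ ω, (∑ i, L i (G (t i) ω)) ^ 2 = ∑ i, ∑ j, L i (G (t i) ω) * L j (G (t j) ω) :=
      fun ω => by rw [sq, Finset.sum_mul_sum]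
    simp only [this]
    have hint : ∀ i j, Integrable (fun ω => L i (G (t i) ω) * L j (G (t j) ω)) P' :=
      fun i j => (hL2 i).integrable_mul (hL2 j)
    rw [integral_finsetSum _ fun i _ => integrable_finsetSum _ fun j _ => hint i j]
    refine Finset.sum_congr rfl fun i _ => ?_
    rw [integral_finsetSum _ fun j _ => hint i j]
    exact Finset.sum_congr rfl fun j _ => hG.cov _ _ _ _
  have h1 : charFun (P'.map fun ω => ∑ i, L i (G (t i) ω)) 1 = _ :=
    congrArg (fun μ => charFun μ (1 : ℝ)) hlaw.map_eq_gaussianReal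
  rw [charFun_apply_real, integral_map hlaw.aemeasurable (by fun_prop), charFun_gaussianReal, hmean,
    hvar] at h1
  have h0 : 0 ≤ ∑ i, ∑ j, min (t i : ℝ) (t j) * Γ (L i) (L j) := hvar ▸ variance_nonneg _ _
  simp only [Complex.ofReal_one, one_mul] at h1
  rw [h1, Real.coe_toNNReal _ h0]
  push_cast
  congr 1
  ring

/-- When the square is expanded, the product of two indicators of initial segments is the indicator
of the shorter one. Hence the limits of the partial sums yield the factor `min` of Brownian
covariances. -/
theorem HasBrownianCoefficients.tendsto_sum_sq {Γ : (E →L[ℝ] ℝ) → (E →L[ℝ] ℝ) → ℝ} {h : ∀ ν : ℕ, ℕ → Fin m → E} {C : ℝ}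
    (hh : HasBrownianCoefficients n h C Γ) {ι : Type*} [Fintype ι] (t : ι → unitInterval)
    (L : ι → E →L[ℝ] ℝ) :
    Tendsto (fun ν => ∑ p : Fin m × Fin (n ν), (∑ i, if (p.2 : ℕ) < ⌊(n ν : ℝ) * t i⌋₊ then
      L i (h ν p.2 p.1) else 0) ^ 2) atTop
      (𝓝 (∑ i, ∑ j, min (t i : ℝ) (t j) * Γ (L i) (L j))) := by
  have h1 : ∀ i j, Tendsto (fun ν => ∑ k ∈ Finset.range ⌊(n ν : ℝ) * (min (t i) (t j) : unitInterval)⌋₊,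
      ∑ a, L i (h ν k a) * L j (h ν k a)) atTop (𝓝 (min (t i : ℝ) (t j) * Γ (L i) (L j))) := by
    intro i j
    have := hh.tendsto (L i) (L j) (min (t i) (t j))
    have e : ((min (t i) (t j) : unitInterval) : ℝ) = min (t i : ℝ) (t j) := by
      rcases le_total (t i) (t j) with h | h
      · rw [min_eq_left h, min_eq_left (Subtype.coe_le_coe.2 h)]
      · rw [min_eq_right h, min_eq_right (Subtype.coe_le_coe.2 h)]
    rwa [e] at this ⊢
  have h2 := tendsto_finsetSum Finset.univ fun i _ => tendsto_finsetSum Finset.univ fun j _ => h1 i j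
  refine h2.congr fun ν => ?_
  have h3 : ∀ p : Fin m × Fin (n ν), (∑ i, if (p.2 : ℕ) < ⌊(n ν : ℝ) * t i⌋₊ then
      L i (h ν p.2 p.1) else 0) ^ 2 = ∑ i, ∑ j, if (p.2 : ℕ) < ⌊(n ν : ℝ) * (min (t i) (t j) : unitInterval)⌋₊
        then L i (h ν p.2 p.1) * L j (h ν p.2 p.1) else 0 := by
    intro p
    rw [sq, Finset.sum_mul_sum]
    refine Finset.sum_congr rfl fun i _ => Finset.sum_congr rfl fun j _ => ?_
    have hmin : ⌊(n ν : ℝ) * (min (t i) (t j) : unitInterval)⌋₊ =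
        min ⌊(n ν : ℝ) * t i⌋₊ ⌊(n ν : ℝ) * t j⌋₊ := by
      have hmono : Monotone fun s : unitInterval => ⌊(n ν : ℝ) * s⌋₊ := fun s s' hs =>
        Nat.floor_mono (mul_le_mul_of_nonneg_left hs (Nat.cast_nonneg _))
      exact hmono.map_min
    rw [hmin]
    simp only [lt_min_iff]
    by_cases h1 : (p.2 : ℕ) < ⌊(n ν : ℝ) * t i⌋₊ <;>
      by_cases h2 : (p.2 : ℕ) < ⌊(n ν : ℝ) * t j⌋₊ <;> simp only [h1, h2, if_true, if_false,
        and_self, and_true, true_and, and_false, mul_zero, zero_mul]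
  symm
  rw [Finset.sum_congr rfl fun p _ => h3 p, Finset.sum_comm]
  refine Finset.sum_congr rfl fun i _ => ?_
  rw [Finset.sum_comm]
  refine Finset.sum_congr rfl fun j _ => ?_
  exact sum_box_ite_eq (fun k a => L i (h ν k a) * L j (h ν k a))
    (Nat.lt_succ_iff.1 (floor_mul_lt_succ (n ν) (min (t i) (t j))))

/-- Convergence of the finite-dimensional laws. A linear functional of the sums at several times is
a single weighted sum over the box, with weights `O(n ^ (-1/2))`, so the central limit theorem for
triangular arrays applies. -/
theorem tendstoInDistribution_grid (hn : Tendsto n atTop atTop)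
    (hV : ∀ ν, IsBoxNoise (P ν) (V ν) K) {h : ∀ ν : ℕ, ℕ → Fin m → E} {C : ℝ}
    {Γ : (E →L[ℝ] ℝ) → (E →L[ℝ] ℝ) → ℝ} (hh : HasBrownianCoefficients n h C Γ)
    {G : unitInterval → Ω' → E} (hG : IsBrownian G P' Γ) {ι : Type*} [Fintype ι]
    (t : ι → unitInterval) :
    TendstoInDistribution (fun ν ω (i : ι) => noiseSum (sliceNoise (V ν)) (fun k a _ => h ν k a)
      ⌊(n ν : ℝ) * t i⌋₊ ω) atTop (fun ω i => G (t i) ω) P P' := by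
  classical
  have hmeas : ∀ ν k, Measurable (noiseSum (sliceNoise (V ν)) (fun k a _ => h ν k a) k) := by
    intro ν k
    refine Finset.measurable_fun_sum _ fun j _ => Finset.measurable_fun_sum _ fun a _ => ?_
    refine Measurable.smul_const ?_ _
    by_cases hj : j < n ν
    · rw [sliceNoise_of_lt _ hj]
      exact (hV ν).measurable _
    · rw [sliceNoise_of_not_lt _ hj]
      exact measurable_const
  refine tendstoInDistribution_of_integral_exp
    (fun ν => (measurable_pi_lambda _ fun i => hmeas ν _).aemeasurable)
    (aemeasurable_pi_lambda _ fun i => hG.gaussian.aemeasurable _) fun L => ?_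
  set Li : ι → E →L[ℝ] ℝ := fun i => L.comp (ContinuousLinearMap.single ℝ (fun _ : ι => E) i)
  have hL : ∀ x : ι → E, L x = ∑ i, Li i (x i) := by
    intro x
    conv_lhs => rw [← Finset.univ_sum_single x, map_sum]
    rfl
  simp only [hL]
  rw [hG.integral_exp_sum t Li]
  set c : ∀ ν, Fin m × Fin (n ν) → ℝ := fun ν p => ∑ i, if (p.2 : ℕ) < ⌊(n ν : ℝ) * t i⌋₊ then
      Li i (h ν p.2 p.1) else 0 with hc
  have hsum : ∀ ν ω, ∑ i, Li i (noiseSum (sliceNoise (V ν)) (fun k a _ => h ν k a)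
      ⌊(n ν : ℝ) * t i⌋₊ ω) = ∑ p, c ν p * V ν p ω := by
    intro ν ω
    simp only [hc, Finset.sum_mul]
    rw [Finset.sum_comm]
    refine Finset.sum_congr rfl fun i _ => ?_
    have e1 : ∀ p : Fin m × Fin (n ν), (if (p.2 : ℕ) < ⌊(n ν : ℝ) * t i⌋₊ then
      Li i (h ν p.2 p.1) else 0) * V ν p ω = if (p.2 : ℕ) < ⌊(n ν : ℝ) * t i⌋₊ then
        sliceNoise (V ν) p.2 p.1 ω * Li i (h ν p.2 p.1) else 0 := by
      intro p
      rw [ite_mul, zero_mul, sliceNoise_of_lt _ p.2.2, mul_comm (Li i _)]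
    simp only [e1]
    rw [sum_box_ite_eq (fun k a => sliceNoise (V ν) k a ω * Li i (h ν k a))
      (Nat.lt_succ_iff.1 (floor_mul_lt_succ _ _))]
    exact map_noiseSum (Li i : E →ₗ[ℝ] ℝ) _ _ _ _
  simp only [hsum]
  refine tendsto_integral_exp_sum (fun ν => (hV ν).measurable) (fun ν => (hV ν).indep)
    (fun ν => (hV ν).memLp) (fun ν => (hV ν).mean) (fun ν => (hV ν).var) (fun ν => (hV ν).cube_le) c
    (η := fun ν => (∑ i, ‖Li i‖) * (C * (√(n ν))⁻¹)) ?_ ?_ (hh.tendsto_sum_sq t Li)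
  · have h1 : Tendsto (fun ν => (√(n ν : ℝ))⁻¹) atTop (𝓝 0) :=
      tendsto_inv_atTop_zero.comp (Real.tendsto_sqrt_atTop.comp
        (tendsto_natCast_atTop_atTop.comp hn))
    simpa using (h1.const_mul C).const_mul (∑ i, ‖Li i‖)
  · intro ν p
    refine (Finset.abs_sum_le_sum_abs _ _).trans ?_
    rw [Finset.sum_mul]
    refine Finset.sum_le_sum fun i _ => ?_
    have h0 : ‖Li i (h ν p.2 p.1)‖ ≤ ‖Li i‖ * (C * (√(n ν))⁻¹) :=
      ((Li i).le_opNorm _).trans (mul_le_mul_of_nonneg_left (hh.norm_le _ _ _) (norm_nonneg _))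
    split_ifs
    · exact h0
    · rw [abs_zero]; exact (norm_nonneg _).trans h0

theorem measurable_noiseSum_const {Ω : Type*} [MeasurableSpace Ω] {m n : ℕ}
    {V : Fin m × Fin n → Ω → ℝ} (hV : ∀ p, Measurable (V p)) (h : ℕ → Fin m → E) (k : ℕ) :
    Measurable (noiseSum (sliceNoise V) (fun k a _ => h k a) k) := by
  refine Finset.measurable_fun_sum _ fun j _ => Finset.measurable_fun_sum _ fun a _ => ?_
  refine Measurable.smul_const ?_ _
  by_cases hj : j < n
  · rw [sliceNoise_of_lt _ hj]
    exact hV _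
  · rw [sliceNoise_of_not_lt _ hj]
    exact measurable_const

/-- The functional central limit theorem for the noise of a long box. -/
theorem functional_clt (hn : Tendsto n atTop atTop) (hK : 0 ≤ K)
    (hV : ∀ ν, IsBoxNoise (P ν) (V ν) K) {h : ∀ ν : ℕ, ℕ → Fin m → E} {C : ℝ}
    {Γ : (E →L[ℝ] ℝ) → (E →L[ℝ] ℝ) → ℝ} (hh : HasBrownianCoefficients n h C Γ)
    {G : unitInterval → Ω' → E} (hG : IsBrownian G P' Γ) :
    TendstoInDistribution (fun ν ω => PathSpace.mk fun t : unitInterval =>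
        noiseSum (sliceNoise (V ν)) (fun k a _ => h ν k a) ⌊(n ν : ℝ) * t⌋₊ ω)
      atTop (fun ω => PathSpace.mk fun t => G t ω) P P' := by
  have hGm : ∀ t, AEMeasurable (G t) P' := hG.gaussian.aemeasurable
  have hGs := aestronglyMeasurable_path hGm hG.continuous_paths
  refine tendstoInDistribution_of_approx
    (fun ν => (measurable_stepPath (n ν)
      fun k => measurable_noiseSum_const (hV ν).measurable (h ν) k).aemeasurable)
    hGs.aemeasurable fun ε hε => ?_
  obtain ⟨D, hD, hblock⟩ := IsNoise.exists_measure_block_le (Fin m) E hK hh.nonneg hε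
  have hlim1 : TendstoInMeasure P' (fun N ω => PathSpace.mk fun t => G (gridPoint N (gridIndex N t)) ω)
      atTop (fun ω => PathSpace.mk fun t => G t ω) := by
    refine tendstoInMeasure_of_tendsto_ae (fun N => ?_)
      (hG.continuous_paths.mono fun ω hω => tendsto_grid hω)
    have h1 : AEMeasurable (fun ω (i : Fin (N + 2)) => G (gridPoint N i) ω) P' :=
      aemeasurable_pi_lambda _ fun i => hGm _
    exact (PathSpace.continuous_mk_comp (gridIndex N)).comp_aestronglyMeasurable
      h1.aestronglyMeasurable
  have hev1 : ∀ᶠ N : ℕ in atTop, P' {ω | ENNReal.ofReal ε ≤ edist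
      (PathSpace.mk fun t => G (gridPoint N (gridIndex N t)) ω) (PathSpace.mk fun t => G t ω)} ≤
      ENNReal.ofReal ε :=
    (hlim1 _ (ENNReal.ofReal_pos.2 hε)).eventually_le_const (ENNReal.ofReal_pos.2 hε)
  -- There will be `N + 2` blocks of length at most `2 n / (N + 1)`, each contributing at most `D *
  -- (2 / (N + 1)) ^ (3/2)`, and `(N + 2) * (2 / (N + 1)) ≤ 4`.
  have hlim2 : Tendsto (fun N : ℕ => 4 * D * √(2 / ((N : ℝ) + 1))) atTop (𝓝 0) := by
    have h1 : Tendsto (fun N : ℕ => 2 / ((N : ℝ) + 1)) atTop (𝓝 0) := by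
      have := (tendsto_one_div_add_atTop_nhds_zero_nat (𝕜 := ℝ)).const_mul 2
      simpa [div_eq_mul_inv] using this
    simpa using (((Real.continuous_sqrt.tendsto 0).comp h1).const_mul (4 * D))
  obtain ⟨N, hN1, hN2⟩ := (hev1.and (hlim2.eventually_le_const hε)).exists
  have hgrid := (tendstoInDistribution_grid hn hV hh hG (gridPoint N)).continuous_comp
    (PathSpace.continuous_mk_comp (gridIndex N))
  refine ⟨_, _, hgrid, ?_, ?_⟩
  · filter_upwards [hn.eventually_ge_atTop (N + 1)] with ν hν
    have hnpos : (0 : ℝ) < n ν := by exact_mod_cast (Nat.succ_pos N).trans_le hν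
    -- The summand 1 makes up for the roundings: between `⌊n t⌋` and the integer part at the
    -- preceding grid point lie at most `ℓ` steps.
    set ℓ : ℕ := ⌊(n ν : ℝ) / (N + 1)⌋₊ + 1 with hℓ
    set S : ℕ → Ω ν → E := noiseSum (sliceNoise (V ν)) (fun k a _ => h ν k a) with hS
    set k₀ : Fin (N + 2) → ℕ := fun i => ⌊(n ν : ℝ) * gridPoint N i⌋₊ with hk₀
    have hℓle : (ℓ : ℝ) ≤ n ν * (2 / ((N : ℝ) + 1)) := by
      have h1 : (1 : ℝ) ≤ (n ν : ℝ) / (N + 1) := by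
        rw [one_le_div (by positivity)]
        exact_mod_cast hν
      have h2 := Nat.floor_le (show (0 : ℝ) ≤ (n ν : ℝ) / (N + 1) by positivity)
      rw [hℓ]
      push_cast
      calc (⌊(n ν : ℝ) / (N + 1)⌋₊ : ℝ) + 1 ≤ (n ν : ℝ) / (N + 1) + (n ν : ℝ) / (N + 1) := by gcongr
        _ = _ := by ring
    have hsub : {ω | ENNReal.ofReal ε < edist
        (PathSpace.mk fun t : unitInterval => S ⌊(n ν : ℝ) * t⌋₊ ω)
        (PathSpace.mk fun t => S (k₀ (gridIndex N t)) ω)} ⊆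
        ⋃ i, {ω | ∃ k ≤ ℓ, ε ≤ ‖S (k₀ i + k) ω - S (k₀ i) ω‖} := by
      intro ω hω
      by_contra hcon
      simp only [Set.mem_iUnion, Set.mem_setOf_eq, not_exists, not_and, not_le] at hcon
      refine absurd hω (not_lt.2 (PathSpace.edist_mk_le fun t => ?_))
      have h1 : k₀ (gridIndex N t) ≤ ⌊(n ν : ℝ) * t⌋₊ :=
        Nat.floor_mono (mul_le_mul_of_nonneg_left (gridPoint_le N t) hnpos.le)
      have h2 : ⌊(n ν : ℝ) * t⌋₊ ≤ k₀ (gridIndex N t) + ℓ := by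
        have h3 := mul_le_mul_of_nonneg_left (le_gridPoint_add N t) hnpos.le
        have h4 := Nat.lt_floor_add_one ((n ν : ℝ) * gridPoint N (gridIndex N t))
        have h5 := Nat.lt_floor_add_one ((n ν : ℝ) / (N + 1))
        have h6 : (n ν : ℝ) * (gridPoint N (gridIndex N t) + 1 / (N + 1)) =
          (n ν : ℝ) * gridPoint N (gridIndex N t) + (n ν : ℝ) / (N + 1) := by ring
        refine Nat.lt_succ_iff.1 ((Nat.floor_lt (mul_nonneg hnpos.le t.2.1)).2 ?_)
        rw [hℓ]
        push_cast
        simp only [hk₀]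
        linarith
      obtain ⟨k, hk⟩ := Nat.exists_eq_add_of_le h1
      have h7 := hcon (gridIndex N t) k (by omega)
      rw [edist_dist, dist_eq_norm, hk]
      exact ENNReal.ofReal_le_ofReal h7.le
    have hprob : (P ν).real (⋃ i, {ω | ∃ k ≤ ℓ, ε ≤ ‖S (k₀ i + k) ω - S (k₀ i) ω‖}) ≤ ε := by
      refine (measureReal_iUnion_fintype_le _).trans ?_
      have h1 : ∀ i, (P ν).real {ω | ∃ k ≤ ℓ, ε ≤ ‖S (k₀ i + k) ω - S (k₀ i) ω‖} ≤
          D * (√(n ν))⁻¹ ^ 3 * (ℓ * √ℓ) := fun i =>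
        hblock (P ν) _ _ ((hV ν).isNoise hK) (h ν) (√(n ν))⁻¹ (by positivity) (hh.norm_le ν) _ _
      have h2 : (√(n ν : ℝ))⁻¹ ^ 3 * (ℓ * √ℓ) ≤ (2 / ((N : ℝ) + 1)) * √(2 / ((N : ℝ) + 1)) := by
        have h3 : √(ℓ : ℝ) ≤ √(n ν) * √(2 / ((N : ℝ) + 1)) := by
          rw [← Real.sqrt_mul hnpos.le]
          exact Real.sqrt_le_sqrt hℓle
        have hsq : √(n ν : ℝ) * √(n ν : ℝ) = n ν := Real.mul_self_sqrt hnpos.le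
        have hsp : 0 < √(n ν : ℝ) := Real.sqrt_pos.2 hnpos
        calc (√(n ν : ℝ))⁻¹ ^ 3 * (ℓ * √ℓ)
            ≤ (√(n ν : ℝ))⁻¹ ^ 3 * ((n ν * (2 / ((N : ℝ) + 1))) * (√(n ν) * √(2 / ((N : ℝ) + 1)))) := by
              gcongr
          _ = _ := by
              nth_rewrite 2 [← hsq]
              field_simp
      calc ∑ i, (P ν).real {ω | ∃ k ≤ ℓ, ε ≤ ‖S (k₀ i + k) ω - S (k₀ i) ω‖}
          ≤ ∑ i : Fin (N + 2), D * ((2 / ((N : ℝ) + 1)) * √(2 / ((N : ℝ) + 1))) := by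
            refine Finset.sum_le_sum fun i _ => (h1 i).trans ?_
            rw [mul_assoc]
            gcongr
        _ = (((N : ℝ) + 2) * (2 / ((N : ℝ) + 1))) * (D * √(2 / ((N : ℝ) + 1))) := by
            rw [Finset.sum_const, Finset.card_univ, Fintype.card_fin, nsmul_eq_mul]
            push_cast
            ring
        _ ≤ 4 * (D * √(2 / ((N : ℝ) + 1))) := by
            gcongr
            rw [mul_div_assoc', div_le_iff₀ (by positivity)]
            have : (0 : ℝ) ≤ N := Nat.cast_nonneg N
            linarith
        _ ≤ ε := by linarith
    refine (measure_mono hsub).trans ?_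
    rw [← ofReal_measureReal]
    exact ENNReal.ofReal_le_ofReal hprob
  · refine (measure_mono fun ω hω => ?_).trans hN1
    simp only [Set.mem_setOf_eq] at hω ⊢
    rw [edist_comm]
    exact hω.le

end FCLT

open scoped ComplexConjugate

/-! ### Diagonalization of the transfer matrix and the recursion for the regularized evolution -/

section TransferAlgebra

theorem normSq_unitRoot {e : ℝ} (he : |e| < 2) : unitRoot e * conj (unitRoot e) = 1 := by
  have h1 : (0 : ℝ) ≤ 1 - (e / 2) ^ 2 := by
    have := abs_lt.1 he
    nlinarith
  rw [Complex.mul_conj]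
  simp only [unitRoot, Complex.normSq_apply, Complex.add_re, Complex.add_im, Complex.ofReal_re,
    Complex.ofReal_im, Complex.mul_re, Complex.mul_im, Complex.I_re, Complex.I_im]
  rw [← Complex.ofReal_one]
  congr 1
  have := Real.mul_self_sqrt h1
  linear_combination this

theorem norm_unitRoot {e : ℝ} (he : |e| < 2) : ‖unitRoot e‖ = 1 := by
  have h := congrArg norm (normSq_unitRoot he)
  rw [norm_mul, RCLike.norm_conj, norm_one] at h
  nlinarith [norm_nonneg (unitRoot e)]

theorem unitRoot_im (e : ℝ) : (unitRoot e).im = √(1 - (e / 2) ^ 2) := by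
  simp [unitRoot]

theorem unitRoot_add_conj (e : ℝ) : unitRoot e + conj (unitRoot e) = e := by
  rw [Complex.add_conj]
  simp [unitRoot, mul_div_cancel₀]

theorem unitRoot_sq {e : ℝ} (he : |e| < 2) : unitRoot e ^ 2 = e * unitRoot e - 1 := by
  linear_combination unitRoot e * unitRoot_add_conj e - normSq_unitRoot he

theorem unitRoot_im_pos {e : ℝ} (he : |e| < 2) : 0 < (unitRoot e).im := by
  rw [unitRoot_im]
  refine Real.sqrt_pos.2 ?_
  have := abs_lt.1 he
  nlinarith

/-- The diagonal entries of `S₁₁`. -/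
def sEntry (e : ℝ) : ℝ := ‖conj (unitRoot e) - unitRoot e‖ ^ (-(1 / 2) : ℝ)

theorem norm_conj_sub_self (z : ℂ) : ‖conj z - z‖ = 2 * |z.im| := by
  rw [← norm_neg, neg_sub, Complex.sub_conj]
  simp

/-- The imaginary part of the root is positive, so `|z̄ - z| = i (z̄ - z)`. This is the
normalization under which `Q` has the explicit inverse `qInv`. -/
theorem I_mul_sEntry_sq {e : ℝ} (he : |e| < 2) :
    Complex.I * (sEntry e : ℂ) ^ 2 * (conj (unitRoot e) - unitRoot e) = 1 := by
  have hp := unitRoot_im_pos he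
  have h1 : sEntry e ^ 2 = (2 * (unitRoot e).im)⁻¹ := by
    rw [sEntry, norm_conj_sub_self, abs_of_pos hp, ← Real.rpow_natCast, ← Real.rpow_mul (by positivity)]
    norm_num
    rw [Real.rpow_neg_one, mul_inv]
    ring
  rw [← Complex.ofReal_pow, h1, ← neg_sub, Complex.sub_conj]
  have h2 : ((unitRoot e).im : ℂ) ≠ 0 := Complex.ofReal_ne_zero.2 hp.ne'
  push_cast
  field_simp
  rw [Complex.I_sq]
  norm_num

/-- Points of the unit circle are at distance at most 2. The uniform lower bound keeps the limit of
the weights away from zero. -/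
theorem sEntry_ge {e : ℝ} (he : |e| < 2) : (2 : ℝ) ^ (-(1 / 2) : ℝ) ≤ sEntry e := by
  refine Real.rpow_le_rpow_of_nonpos ?_ ?_ (by norm_num)
  · rw [norm_conj_sub_self]
    have := unitRoot_im_pos he
    positivity
  · refine (norm_sub_le _ _).trans ?_
    rw [RCLike.norm_conj, norm_unitRoot he]
    norm_num

variable {m : ℕ}

/-- The block matrix `i S [[a, b], [-b̄, -ā]] S`. -/
def noiseBlock (S : Matrix (Fin m ⊕ Fin m) (Fin m ⊕ Fin m) ℂ) (a b : Matrix (Fin m) (Fin m) ℂ) :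
    Matrix (Fin m ⊕ Fin m) (Fin m ⊕ Fin m) ℂ :=
  Complex.I • (S * Matrix.fromBlocks a b (-(b.map (starRingEnd ℂ))) (-(a.map (starRingEnd ℂ))) * S)

/-- The matrix `Oᵀ diag x O`. -/
def rotatedDiagonal (O : Matrix (Fin m) (Fin m) ℝ) (x : Fin m → ℝ) : Matrix (Fin m) (Fin m) ℝ :=
  O.transpose * Matrix.diagonal x * O

theorem rotatedDiagonal_apply (O : Matrix (Fin m) (Fin m) ℝ) (x : Fin m → ℝ) (i j : Fin m) :
    rotatedDiagonal O x i j = ∑ a, x a * (O a i * O a j) := by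
  rw [rotatedDiagonal, Matrix.mul_apply]
  exact Finset.sum_congr rfl fun a _ => by
    rw [Matrix.mul_diagonal, Matrix.transpose_apply]
    ring

/-- The matrix `Z^(k+1) g Z̄^(k+1)`. -/
def phaseA (z : Fin m → ℂ) (k : ℕ) (g : Matrix (Fin m) (Fin m) ℝ) : Matrix (Fin m) (Fin m) ℂ :=
  Matrix.of fun i j => z i ^ (k + 1) * conj (z j) ^ (k + 1) * (g i j : ℂ)

/-- The matrix `Z^(k+1) g Z^(k+1)`. -/
def phaseB (z : Fin m → ℂ) (k : ℕ) (g : Matrix (Fin m) (Fin m) ℝ) : Matrix (Fin m) (Fin m) ℂ :=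
  Matrix.of fun i j => z i ^ (k + 1) * z j ^ (k + 1) * (g i j : ℂ)

/-- `diag(O, O)` as a complex matrix. -/
def doubled (O : Matrix (Fin m) (Fin m) ℝ) : Matrix (Fin m ⊕ Fin m) (Fin m ⊕ Fin m) ℂ :=
  Matrix.fromBlocks (O.map (algebraMap ℝ ℂ)) 0 0 (O.map (algebraMap ℝ ℂ))

/-- `diag(Z̄, Z)`. -/
def rotation (e : Fin m → ℝ) : Matrix (Fin m ⊕ Fin m) (Fin m ⊕ Fin m) ℂ :=
  Matrix.fromBlocks (Matrix.diagonal fun j => conj (unitRoot (e j))) 0 0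
    (Matrix.diagonal fun j => unitRoot (e j))

/-- `diag(Z, Z̄)`. -/
def rotationInv (e : Fin m → ℝ) : Matrix (Fin m ⊕ Fin m) (Fin m ⊕ Fin m) ℂ :=
  Matrix.fromBlocks (Matrix.diagonal fun j => unitRoot (e j)) 0 0
    (Matrix.diagonal fun j => conj (unitRoot (e j)))

/-- The inverse of `Q`, that is, `i S [[I, -Z], [-I, Z̄]]`. -/
def qInv (e : Fin m → ℝ) : Matrix (Fin m ⊕ Fin m) (Fin m ⊕ Fin m) ℂ :=
  Matrix.fromBlocks (Matrix.diagonal fun j => Complex.I * sEntry (e j))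
    (Matrix.diagonal fun j => -(Complex.I * sEntry (e j) * unitRoot (e j)))
    (Matrix.diagonal fun j => -(Complex.I * sEntry (e j)))
    (Matrix.diagonal fun j => Complex.I * sEntry (e j) * conj (unitRoot (e j)))

theorem sBlock_eq (e : Fin m → ℝ) : sBlock e = Matrix.diagonal fun j => (sEntry (e j) : ℂ) := rfl

theorem zMatrix_map (e : Fin m → ℝ) :
    (zMatrix e).map (starRingEnd ℂ) = Matrix.diagonal fun j => conj (unitRoot (e j)) := by
  simp [zMatrix, Matrix.diagonal_map]

theorem qMatrix_eq (e : Fin m → ℝ) : qMatrix e =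
    Matrix.fromBlocks (Matrix.diagonal fun j => conj (unitRoot (e j)) * sEntry (e j))
      (Matrix.diagonal fun j => unitRoot (e j) * sEntry (e j))
      (Matrix.diagonal fun j => (sEntry (e j) : ℂ)) (Matrix.diagonal fun j => (sEntry (e j) : ℂ)) := by
  rw [qMatrix, zMatrix_map, zMatrix, sMatrix, sBlock_eq]
  simp only [Matrix.fromBlocks_multiply, Matrix.mul_zero, add_zero, zero_add, Matrix.one_mul,
    Matrix.diagonal_mul_diagonal]

theorem qInv_mul_qMatrix {e : Fin m → ℝ} (he : ∀ j, |e j| < 2) : qInv e * qMatrix e = 1 := by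
  rw [qInv, qMatrix_eq, ← Matrix.fromBlocks_one]
  simp only [Matrix.fromBlocks_multiply, Matrix.diagonal_mul_diagonal, Matrix.diagonal_add]
  have h := fun j => I_mul_sEntry_sq (he j)
  congr 1
  · rw [← Matrix.diagonal_one]
    congr 1; funext j
    linear_combination h j
  · rw [← Matrix.diagonal_zero]
    congr 1; funext j
    ring
  · rw [← Matrix.diagonal_zero]
    congr 1; funext j
    ring
  · rw [← Matrix.diagonal_one]
    congr 1; funext j
    linear_combination h j

theorem doubled_transpose_mul {O : Matrix (Fin m) (Fin m) ℝ} (hO : O ∈ Matrix.orthogonalGroup (Fin m) ℝ) :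
    doubled O.transpose * doubled O = 1 := by
  have h : O.transpose * O = 1 :=
    (Matrix.mem_orthogonalGroup_iff' _ _).1 hO
  rw [doubled, doubled, Matrix.fromBlocks_multiply, ← Matrix.map_mul, h]
  simp [Matrix.fromBlocks_one]

theorem qInv_doubled {e : Fin m → ℝ} (he : ∀ j, |e j| < 2) {O : Matrix (Fin m) (Fin m) ℝ}
    (hO : O ∈ Matrix.orthogonalGroup (Fin m) ℝ) :
    (doubled O * qMatrix e)⁻¹ = qInv e * doubled O.transpose := by
  refine Matrix.inv_eq_left_inv ?_
  rw [Matrix.mul_assoc, ← Matrix.mul_assoc _ (doubled O), doubled_transpose_mul hO, Matrix.one_mul,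
    qInv_mul_qMatrix he]

theorem rotationInv_mul {e : Fin m → ℝ} (he : ∀ j, |e j| < 2) : rotationInv e * rotation e = 1 := by
  rw [rotationInv, rotation, Matrix.fromBlocks_multiply]
  have h1 := fun j => normSq_unitRoot (he j)
  have h2 := fun j => (mul_comm _ _).trans (normSq_unitRoot (he j))
  simp [Matrix.diagonal_mul_diagonal, h1, h2, Matrix.fromBlocks_one]

/-- In the eigenbasis of `H` the transfer matrix splits into blocks `[[e, -1], [1, 0]]`. Their
eigenvalues are the roots `z̄, z` of `x ^ 2 = e x - 1`, with eigenvectors `(z̄, 1)` and `(z, 1)`,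
which are the columns of `Q` up to scaling. -/
theorem transferMatrix_mul {e : Fin m → ℝ} (he : ∀ j, |e j| < 2) {O H : Matrix (Fin m) (Fin m) ℝ}
    {lam : ℝ} (hH : H * O = O * Matrix.diagonal fun j => lam - e j) :
    transferMatrix H (lam : ℂ) 0 * (doubled O * qMatrix e) = (doubled O * qMatrix e) * rotation e := by
  have h1 : transferMatrix H (lam : ℂ) 0 * doubled O = doubled O *
      Matrix.fromBlocks (Matrix.diagonal fun j => (e j : ℂ)) (-1) 1 0 := by
    have h2 : H.map (algebraMap ℝ ℂ) * O.map (algebraMap ℝ ℂ) =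
        O.map (algebraMap ℝ ℂ) * Matrix.diagonal (fun j => (lam : ℂ) - e j) := by
      rw [← Matrix.map_mul, hH, Matrix.map_mul, Matrix.diagonal_map (map_zero _)]
      simp
    rw [transferMatrix, doubled, Matrix.fromBlocks_multiply, Matrix.fromBlocks_multiply]
    congr 1
    · simp only [Matrix.mul_zero, add_zero, Pi.zero_apply, Complex.ofReal_zero, sub_zero, Matrix.sub_mul,
        Matrix.diagonal_zero, Matrix.zero_mul, h2, Matrix.smul_mul, Matrix.one_mul]
      ext i j
      simp only [Matrix.sub_apply, Matrix.smul_apply, Matrix.mul_diagonal, smul_eq_mul]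
      ring
    all_goals simp
  rw [← Matrix.mul_assoc, h1, Matrix.mul_assoc, Matrix.mul_assoc]
  congr 1
  rw [qMatrix, zMatrix_map, zMatrix, sMatrix, sBlock_eq, rotation]
  have h3 := fun j => unitRoot_sq (he j)
  simp only [Matrix.fromBlocks_multiply, Matrix.mul_zero, Matrix.zero_mul,
    add_zero, zero_add, Matrix.mul_one, Matrix.one_mul, Matrix.mul_neg,
    Matrix.neg_mul, Matrix.diagonal_mul_diagonal, Matrix.diagonal_neg, Matrix.diagonal_add]
  congr 2 <;> funext j <;> have := h3 j <;> have h4 := congrArg conj this <;>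
    simp only [map_pow, map_sub, map_mul, Complex.conj_ofReal, map_one] at h4
  · linear_combination -(sEntry (e j) : ℂ) * h4
  · linear_combination -(sEntry (e j) : ℂ) * this
  · ring
  · ring

theorem rotation_pow (e : Fin m → ℝ) (k : ℕ) : rotation e ^ k =
    Matrix.fromBlocks (Matrix.diagonal fun j => conj (unitRoot (e j)) ^ k) 0 0
    (Matrix.diagonal fun j => unitRoot (e j) ^ k) := by
  rw [rotation, Matrix.fromBlocks_diagonal_pow, Matrix.diagonal_pow, Matrix.diagonal_pow]
  rfl

theorem rotationInv_pow (e : Fin m → ℝ) (k : ℕ) : rotationInv e ^ k =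
    Matrix.fromBlocks (Matrix.diagonal fun j => unitRoot (e j) ^ k) 0 0
    (Matrix.diagonal fun j => conj (unitRoot (e j)) ^ k) := by
  rw [rotationInv, Matrix.fromBlocks_diagonal_pow, Matrix.diagonal_pow, Matrix.diagonal_pow]
  rfl

theorem noiseBlock_sMatrix (e : Fin m → ℝ) (a b : Matrix (Fin m) (Fin m) ℂ) :
    noiseBlock (sMatrix e) a b = Matrix.fromBlocks
      (Matrix.of fun i j => Complex.I * (sEntry (e i) * a i j * sEntry (e j)))
      (Matrix.of fun i j => Complex.I * (sEntry (e i) * b i j * sEntry (e j)))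
      (Matrix.of fun i j => -(Complex.I * (sEntry (e i) * conj (b i j) * sEntry (e j))))
      (Matrix.of fun i j => -(Complex.I * (sEntry (e i) * conj (a i j) * sEntry (e j)))) := by
  rw [noiseBlock, sMatrix, sBlock_eq]
  simp only [Matrix.fromBlocks_multiply, Matrix.mul_zero, Matrix.zero_mul, add_zero, zero_add,
    Matrix.fromBlocks_smul]
  congr 1 <;> ext i j <;> simp [Matrix.mul_diagonal, Matrix.diagonal_mul]

theorem mul_qInv_mul {e : Fin m → ℝ} (he : ∀ j, |e j| < 2) {O : Matrix (Fin m) (Fin m) ℝ}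
    (hO : O ∈ Matrix.orthogonalGroup (Fin m) ℝ) :
    (doubled O * qMatrix e) * (qInv e * doubled O.transpose) = 1 := by
  rw [mul_eq_one_comm, Matrix.mul_assoc, ← Matrix.mul_assoc _ (doubled O),
    doubled_transpose_mul hO, Matrix.one_mul, qInv_mul_qMatrix he]

theorem qInv_mul_mul {e : Fin m → ℝ} (he : ∀ j, |e j| < 2) {O : Matrix (Fin m) (Fin m) ℝ}
    (hO : O ∈ Matrix.orthogonalGroup (Fin m) ℝ) :
    (qInv e * doubled O.transpose) * (doubled O * qMatrix e) = 1 :=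
  mul_eq_one_comm.1 (mul_qInv_mul he hO)

theorem transferMatrix_pow_eq {e : Fin m → ℝ} (he : ∀ j, |e j| < 2) {O H : Matrix (Fin m) (Fin m) ℝ}
    (hO : O ∈ Matrix.orthogonalGroup (Fin m) ℝ) {lam : ℝ}
    (hH : H * O = O * Matrix.diagonal fun j => lam - e j) (k : ℕ) :
    (qInv e * doubled O.transpose) * (transferMatrix H (lam : ℂ) 0)⁻¹ ^ k =
      rotationInv e ^ k * (qInv e * doubled O.transpose) := by
  obtain ⟨U, hU⟩ : ∃ U, U = doubled O * qMatrix e := ⟨_, rfl⟩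
  obtain ⟨W, hW⟩ : ∃ W, W = qInv e * doubled O.transpose := ⟨_, rfl⟩
  have h1 : W * U = 1 := by rw [hU, hW, qInv_mul_mul he hO]
  have h1' : U * W = 1 := by rw [hU, hW, mul_qInv_mul he hO]
  have h2 := transferMatrix_mul he hH
  rw [← hU] at h2
  rw [← hW]
  have h3 : (transferMatrix H (lam : ℂ) 0)⁻¹ = U * rotationInv e * W := by
    refine Matrix.inv_eq_right_inv ?_
    rw [← Matrix.mul_assoc, ← Matrix.mul_assoc, h2, Matrix.mul_assoc U,
      mul_eq_one_comm.1 (rotationInv_mul he), Matrix.mul_one, h1']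
  have h4 : W * (transferMatrix H (lam : ℂ) 0)⁻¹ = rotationInv e * W := by
    rw [h3, ← Matrix.mul_assoc, ← Matrix.mul_assoc, h1, Matrix.one_mul]
  exact (show SemiconjBy W _ _ from h4).pow_right k

theorem regularizedEvolution_eq {e : Fin m → ℝ} (he : ∀ j, |e j| < 2) {O H : Matrix (Fin m) (Fin m) ℝ}
    (hO : O ∈ Matrix.orthogonalGroup (Fin m) ℝ) {lam : ℝ}
    (hH : H * O = O * Matrix.diagonal fun j => lam - e j) (w : ℕ → Fin m → ℝ) (E : ℂ) (k : ℕ) :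
    regularizedEvolution H O e lam w E k = rotationInv e ^ k *
      ((qInv e * doubled O.transpose) * transferProduct H E w k * (doubled O * qMatrix e)) := by
  have h0 : regularizedEvolution H O e lam w E k = (doubled O * qMatrix e)⁻¹ *
    ((transferMatrix H (lam : ℂ) 0)⁻¹ ^ k * transferProduct H E w k) * (doubled O * qMatrix e) := rfl
  have h1 := transferMatrix_pow_eq he hO hH k
  rw [h0, qInv_doubled he hO]
  generalize qInv e * doubled O.transpose = W at *
  rw [← Matrix.mul_assoc W, h1]
  simp only [Matrix.mul_assoc]

theorem regularizedEvolution_zero {e : Fin m → ℝ} (he : ∀ j, |e j| < 2) {O H : Matrix (Fin m) (Fin m) ℝ}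
    (hO : O ∈ Matrix.orthogonalGroup (Fin m) ℝ) {lam : ℝ}
    (hH : H * O = O * Matrix.diagonal fun j => lam - e j) (w : ℕ → Fin m → ℝ) (E : ℂ) :
    regularizedEvolution H O e lam w E 0 = 1 := by
  rw [regularizedEvolution_eq he hO hH, pow_zero, Matrix.one_mul, transferProduct, Matrix.mul_one,
    qInv_mul_mul he hO]

theorem transferMatrix_eq_add (H : Matrix (Fin m) (Fin m) ℝ) (E : ℂ) (lam : ℝ) (w : Fin m → ℝ) :
    transferMatrix H E w = transferMatrix H (lam : ℂ) 0 +
      Matrix.fromBlocks (Matrix.diagonal fun j => E - lam - w j) 0 0 0 := by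
  rw [transferMatrix, transferMatrix, Matrix.fromBlocks_add]
  rw [add_zero, add_zero, add_zero]
  congr 1
  ext i j
  rcases eq_or_ne i j with rfl | hij
  · simp only [Matrix.sub_apply, Matrix.add_apply, Matrix.smul_apply, Matrix.one_apply_eq,
      Matrix.diagonal_apply_eq, smul_eq_mul, Pi.zero_apply, Complex.ofReal_zero]
    ring
  · simp only [Matrix.sub_apply, Matrix.add_apply, Matrix.smul_apply, Matrix.one_apply_ne hij,
      Matrix.diagonal_apply_ne _ hij, smul_eq_mul]
    ring

/-- Both sides carry the power `k + 1` although the rotation on the right has only the power `k`: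
the first row of `Q` contributes one more factor `z̄` or `z`. The signs in the lower row come from
`qInv`. -/
theorem rotationInv_pow_mul_qInv_mul (e : Fin m → ℝ) (g : Matrix (Fin m) (Fin m) ℝ) (c : ℂ) (k : ℕ) :
    rotationInv e ^ (k + 1) * (qInv e * Matrix.fromBlocks (c • 1 - g.map (algebraMap ℝ ℂ)) 0 0 0 *
        qMatrix e) * rotation e ^ k =
      c • noiseBlock (sMatrix e) (phaseA (fun j => unitRoot (e j)) k 1)
          (phaseB (fun j => unitRoot (e j)) k 1) -
        noiseBlock (sMatrix e) (phaseA (fun j => unitRoot (e j)) k g)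
          (phaseB (fun j => unitRoot (e j)) k g) := by
  rw [rotationInv_pow, rotation_pow, noiseBlock_sMatrix, noiseBlock_sMatrix, qMatrix_eq, qInv]
  simp only [Matrix.fromBlocks_multiply, Matrix.mul_zero, Matrix.zero_mul, add_zero, zero_add,
    Matrix.fromBlocks_smul, sub_eq_add_neg, Matrix.fromBlocks_neg, Matrix.fromBlocks_add]
  congr 1 <;> ext i j <;>
    simp only [Matrix.diagonal_mul, Matrix.mul_diagonal, Matrix.add_apply, Matrix.neg_apply,
      Matrix.smul_apply, Matrix.of_apply, phaseA, phaseB, Matrix.map_apply, smul_eq_mul,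
      map_mul, map_pow, Complex.conj_conj, Complex.conj_ofReal, Complex.coe_algebraMap,
      Matrix.one_apply, apply_ite Complex.ofReal, Complex.ofReal_one, Complex.ofReal_zero,
      apply_ite (starRingEnd ℂ), map_one, map_zero] <;> ring

/-- The one-step recursion of the regularized evolution. -/
theorem regularizedEvolution_succ {e : Fin m → ℝ} (he : ∀ j, |e j| < 2)
    {O H : Matrix (Fin m) (Fin m) ℝ}
    (hO : O ∈ Matrix.orthogonalGroup (Fin m) ℝ) {lam : ℝ}
    (hH : H * O = O * Matrix.diagonal fun j => lam - e j) (w : ℕ → Fin m → ℝ) (E : ℂ) (k : ℕ) :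
    regularizedEvolution H O e lam w E (k + 1) =
      (1 + (E - lam) • noiseBlock (sMatrix e) (phaseA (fun j => unitRoot (e j)) k 1)
          (phaseB (fun j => unitRoot (e j)) k 1)
        - noiseBlock (sMatrix e) (phaseA (fun j => unitRoot (e j)) k (rotatedDiagonal O (w k)))
          (phaseB (fun j => unitRoot (e j)) k (rotatedDiagonal O (w k))))
      * regularizedEvolution H O e lam w E k := by
  obtain ⟨U, hU⟩ : ∃ U, U = doubled O * qMatrix e := ⟨_, rfl⟩
  obtain ⟨W, hW⟩ : ∃ W, W = qInv e * doubled O.transpose := ⟨_, rfl⟩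
  have h1 : W * U = 1 := by rw [hU, hW, qInv_mul_mul he hO]
  have h1' : U * W = 1 := by rw [hU, hW, mul_qInv_mul he hO]
  have h2 := transferMatrix_mul he hH
  rw [← hU] at h2
  have h5 : rotation e ^ k * rotationInv e ^ k = 1 := by
    have hc : rotation e * rotationInv e = 1 := mul_eq_one_comm.1 (rotationInv_mul he)
    have hc' : Commute (rotation e) (rotationInv e) := hc.trans (rotationInv_mul he).symm
    rw [← hc'.mul_pow, hc, one_pow]
  have h5' : rotationInv e ^ k * rotation e ^ k = 1 := mul_eq_one_comm.1 h5
  set Δ : Matrix (Fin m ⊕ Fin m) (Fin m ⊕ Fin m) ℂ :=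
    Matrix.fromBlocks (Matrix.diagonal fun j => E - lam - w k j) 0 0 0 with hΔ
  have h6 : W * transferMatrix H E (w k) * U = rotation e + W * Δ * U := by
    rw [transferMatrix_eq_add H E lam, Matrix.mul_add, Matrix.add_mul, Matrix.mul_assoc W, h2,
      ← Matrix.mul_assoc, h1, Matrix.one_mul]
  -- The identity, written as `rotation e ^ k * rotationInv e ^ k`, is inserted between the new
  -- factor and the previous product.
  have h7 : regularizedEvolution H O e lam w E (k + 1) =
      rotationInv e ^ (k + 1) * (rotation e + W * Δ * U) * rotation e ^ k *
        regularizedEvolution H O e lam w E k := by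
    rw [regularizedEvolution_eq he hO hH, regularizedEvolution_eq he hO hH, ← hU, ← hW,
      Matrix.mul_assoc _ (rotation e ^ k), ← Matrix.mul_assoc (rotation e ^ k), h5, Matrix.one_mul, ← h6,
      transferProduct]
    calc _ = rotationInv e ^ (k + 1) * (W * transferMatrix H E (w k) * 1 * transferProduct H E w k * U) := by
          simp only [Matrix.mul_assoc, Matrix.one_mul, Matrix.mul_one]
      _ = _ := by
          rw [← h1']
          simp only [Matrix.mul_assoc]
  rw [h7]
  congr 1
  rw [Matrix.mul_add, Matrix.add_mul, pow_succ, Matrix.mul_assoc _ (rotationInv e),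
    rotationInv_mul he, Matrix.mul_one, h5', ← pow_succ, add_sub_assoc]
  congr 1
  have h8 : W * Δ * U = qInv e * Matrix.fromBlocks
      ((E - lam) • 1 - (rotatedDiagonal O (w k)).map (algebraMap ℝ ℂ)) 0 0 0 * qMatrix e := by
    rw [hW, hU]
    have h9 : doubled O.transpose * Δ * doubled O = Matrix.fromBlocks
      ((E - lam) • 1 - (rotatedDiagonal O (w k)).map (algebraMap ℝ ℂ)) 0 0 0 := by
      have h : O.transpose * O = 1 := (Matrix.mem_orthogonalGroup_iff' _ _).1 hO
      have h' : O.transpose.map (algebraMap ℝ ℂ) * O.map (algebraMap ℝ ℂ) = 1 := by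
        rw [← Matrix.map_mul, h]; simp
      have hd : (Matrix.diagonal fun j => E - lam - (w k j : ℂ)) =
          (E - lam) • 1 - (Matrix.diagonal (w k)).map (algebraMap ℝ ℂ) := by
        rw [Matrix.diagonal_map (map_zero _), Matrix.smul_one_eq_diagonal, Matrix.diagonal_sub]
        rfl
      rw [doubled, doubled, hΔ, hd, Matrix.fromBlocks_multiply, Matrix.fromBlocks_multiply]
      simp only [Matrix.mul_zero, Matrix.zero_mul, add_zero, zero_add]
      congr 1
      rw [Matrix.mul_sub, Matrix.sub_mul, Matrix.mul_smul, Matrix.smul_mul, Matrix.mul_one, h',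
        rotatedDiagonal, Matrix.map_mul, Matrix.map_mul]
    rw [← h9]
    simp only [Matrix.mul_assoc]
  rw [h8, rotationInv_pow_mul_qInv_mul]

end TransferAlgebra

/-! ### The characteristic polynomial of the box as an `m × m` determinant -/

section BlockDeterminant

variable {m : ℕ}

theorem det_of_lower_block {m N : ℕ} (M : Matrix (Fin m × Fin N) (Fin m × Fin N) ℂ)
    (h : ∀ a b i j, i < j → M (a, i) (b, j) = 0) :
    M.det = ∏ k, (Matrix.of fun a b => M (a, k) (b, k)).det := by
  have h1 : M.transpose.BlockTriangular Prod.snd := fun p q hpq => h q.1 p.1 q.2 p.2 hpq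
  rw [← Matrix.det_transpose, h1.det_fintype]
  refine Finset.prod_congr rfl fun k _ => ?_
  let φ : Fin m ≃ {p : Fin m × Fin N // p.2 = k} :=
    { toFun := fun a => ⟨(a, k), rfl⟩
      invFun := fun p => p.1.1
      left_inv := fun a => rfl
      right_inv := fun p => Subtype.ext (Prod.ext rfl p.2.symm) }
  rw [← Matrix.det_submatrix_equiv_self φ, ← Matrix.det_transpose]
  rfl

/-- The block Jacobi matrix with diagonal blocks `A k` and off-diagonal blocks `-1`. -/
def blockJacobi (A : ℕ → Matrix (Fin m) (Fin m) ℂ) (N : ℕ) :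
    Matrix (Fin m × Fin N) (Fin m × Fin N) ℂ :=
  Matrix.of fun p q => (if p.2 = q.2 then A p.2 p.1 q.1 else 0) -
    (if p.1 = q.1 then if (p.2 : ℕ) + 1 = q.2 ∨ (q.2 : ℕ) + 1 = p.2 then 1 else 0 else 0)

/-- The orthogonal polynomials of a block Jacobi matrix. -/
def blockSolution (A : ℕ → Matrix (Fin m) (Fin m) ℂ) : ℕ → Matrix (Fin m) (Fin m) ℂ
  | 0 => 1
  | 1 => A 0
  | k + 2 => A (k + 1) * blockSolution A (k + 1) - blockSolution A k

theorem sum_neighbours {N : ℕ} (i : Fin N) (f : ℕ → ℂ) :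
    ∑ l : Fin N, (if (i : ℕ) + 1 = l ∨ (l : ℕ) + 1 = i then f l else 0) =
      (if (i : ℕ) + 1 < N then f (i + 1) else 0) + (if 0 < (i : ℕ) then f (i - 1) else 0) := by
  have h1 : ∀ l : Fin N, (if (i : ℕ) + 1 = l ∨ (l : ℕ) + 1 = i then f l else 0) =
      (if (l : ℕ) = i + 1 then f l else 0) + (if 0 < (i : ℕ) then (if (l : ℕ) = i - 1 then f l else 0) else 0) := by
    intro l
    split_ifs <;> first | omega | simp
  rw [Finset.sum_congr rfl fun l _ => h1 l, Finset.sum_add_distrib,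
    Fin.sum_univ_eq_sum_range (fun l => if l = i + 1 then f l else 0),
    Fin.sum_univ_eq_sum_range (fun l => if 0 < (i : ℕ) then (if l = i - 1 then f l else 0) else 0),
    Finset.sum_ite_eq' ]
  congr 1
  · simp only [Finset.mem_range]
  · split_ifs with h
    · rw [Finset.sum_ite_eq', if_pos]
      have := i.2
      exact Finset.mem_range.2 (by omega)
    · simp

/-- The three-term recursion solves the eigenvalue equation in every slice but the last. There the
missing neighbour leaves the next polynomial as a residue. -/
theorem blockJacobi_mul_blockSolution (A : ℕ → Matrix (Fin m) (Fin m) ℂ) {N : ℕ} (p : Fin m × Fin N)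
    (b : Fin m) :
    ∑ q, blockJacobi A N p q * blockSolution A q.2 q.1 b =
      if (p.2 : ℕ) + 1 < N then 0 else blockSolution A N p.1 b := by
  obtain ⟨a, i⟩ := p
  have h1 : ∀ c (l : Fin N), blockJacobi A N (a, i) (c, l) * blockSolution A l c b =
      (if i = l then A i a c * blockSolution A l c b else 0) -
      (if a = c then if (i : ℕ) + 1 = l ∨ (l : ℕ) + 1 = i then blockSolution A l c b else 0 else 0) := by
    intro c l
    rw [blockJacobi, Matrix.of_apply, sub_mul]
    simp only [ite_mul, zero_mul, one_mul]
  rw [Fintype.sum_prod_type, Finset.sum_congr rfl fun c _ => Finset.sum_congr rfl fun l _ => h1 c l]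
  simp only [Finset.sum_sub_distrib, Finset.sum_ite_eq, Finset.mem_univ, if_true]
  rw [Finset.sum_comm (f := fun c (l : Fin N) => if a = c then if (i : ℕ) + 1 = l ∨ (l : ℕ) + 1 = i then blockSolution A l c b else 0 else 0)]
  simp only [Finset.sum_ite_eq, Finset.mem_univ, if_true]
  rw [sum_neighbours i fun l => blockSolution A l a b, ← Matrix.mul_apply]
  have hi := i.2
  rcases Nat.eq_zero_or_pos (i : ℕ) with h0 | h0
  · rw [h0, if_neg (lt_irrefl 0)]
    split_ifs with h
    · simp [blockSolution]
    · obtain rfl : N = 1 := by omega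
      simp [blockSolution]
  · obtain ⟨k, hk⟩ : ∃ k, (i : ℕ) = k + 1 := ⟨i - 1, by omega⟩
    rw [hk, if_pos (Nat.succ_pos k), Nat.add_sub_cancel]
    split_ifs with h
    · rw [blockSolution, Matrix.sub_apply]
      ring
    · obtain rfl : N = k + 2 := by omega
      rw [blockSolution, Matrix.sub_apply]
      ring

/-- Column operations of determinant one replace the first block column by one whose only nonzero
block is the solution at `N`, in the last slice. A cyclic shift of the block columns then makes the
matrix block triangular, with diagonal blocks `-1` and finally this solution. The constant depends
on the sizes only, not on the diagonal blocks. -/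
theorem det_blockJacobi (N : ℕ) : ∃ c : ℂ, c ≠ 0 ∧ ∀ A : ℕ → Matrix (Fin m) (Fin m) ℂ,
    (blockJacobi A N).det = c * (blockSolution A N).det := by
  rcases N with _ | N
  · exact ⟨1, one_ne_zero, fun A => by simp [blockSolution]⟩
  -- The shift that sends the last block column to the first and every other one to its successor.
  set τ : Equiv.Perm (Fin m × Fin (N + 1)) := (Equiv.refl _).prodCongr (finRotate (N + 1)) with hτ
  refine ⟨((Equiv.Perm.sign τ : ℤ) : ℂ) * (∏ k : Fin N, (-1 : Matrix (Fin m) (Fin m) ℂ).det), ?_, fun A => ?_⟩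
  · refine mul_ne_zero ?_ (Finset.prod_ne_zero_iff.2 fun k _ => ?_)
    · exact_mod_cast (Equiv.Perm.sign τ).ne_zero
    · rw [Matrix.det_neg]
      simp
  -- The identity with its first block column replaced by the solution. It is block lower triangular
  -- with unit diagonal blocks, because the solution starts at 1.
  set B : Matrix (Fin m × Fin (N + 1)) (Fin m × Fin (N + 1)) ℂ := Matrix.of fun p q =>
    if q.2 = 0 then blockSolution A p.2 p.1 q.1 else (1 : Matrix _ _ ℂ) p q with hB
  have hBdet : B.det = 1 := by
    rw [det_of_lower_block]
    · refine Finset.prod_eq_one fun k _ => ?_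
      have : (Matrix.of fun a b => B (a, k) (b, k)) = 1 := by
        ext a b
        simp only [hB, Matrix.of_apply]
        split_ifs with h
        · rw [h]; rfl
        · simp [Matrix.one_apply]
      rw [this, Matrix.det_one]
    · intro a b i j hij
      simp only [hB, Matrix.of_apply]
      rw [if_neg (Fin.pos_iff_ne_zero.1 (lt_of_le_of_lt (Fin.zero_le i) hij)), Matrix.one_apply_ne]
      intro h
      exact hij.ne (Prod.mk.inj h).2
  set C := blockJacobi A (N + 1) * B with hC
  have hC0 : ∀ p b, C p (b, 0) = if (p.2 : ℕ) + 1 < N + 1 then 0 else blockSolution A (N + 1) p.1 b := by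
    intro p b
    rw [← blockJacobi_mul_blockSolution, hC, Matrix.mul_apply]
    simp [hB]
  have hC1 : ∀ p b j, j ≠ 0 → C p (b, j) = blockJacobi A (N + 1) p (b, j) := by
    intro p b j hj
    rw [hC, Matrix.mul_apply]
    simp only [hB, Matrix.of_apply, if_neg hj]
    rw [← Matrix.mul_apply, Matrix.mul_one]
  have hCdet : C.det = (blockJacobi A (N + 1)).det := by
    rw [hC, Matrix.det_mul, hBdet, mul_one]
  have hperm : (C.submatrix id τ).det = ((Equiv.Perm.sign τ : ℤ) : ℂ) * C.det := Matrix.det_permute' τ C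
  have hsq : ((Equiv.Perm.sign τ : ℤ) : ℂ) * ((Equiv.Perm.sign τ : ℤ) : ℂ) = 1 := by
    rw [← Int.cast_mul, ← Units.val_mul, Int.units_mul_self]
    simp
  have hlast : finRotate (N + 1) (Fin.last N) = 0 := finRotate_last
  have hcast : ∀ k : Fin N, finRotate (N + 1) k.castSucc = k.succ := fun k =>
    finRotate_of_lt k.2
  have hlow : (C.submatrix id τ).det = (∏ k : Fin N, (-1 : Matrix (Fin m) (Fin m) ℂ).det) *
      (blockSolution A (N + 1)).det := by
    rw [det_of_lower_block, Fin.prod_univ_castSucc]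
    · congr 1
      · refine Finset.prod_congr rfl fun k _ => congrArg _ ?_
        ext a b
        simp only [Matrix.of_apply, Matrix.submatrix_apply, id, hτ, Equiv.prodCongr_apply, Prod.map,
          Equiv.refl_apply, hcast]
        rw [hC1 _ _ _ (Fin.succ_ne_zero k), blockJacobi]
        have : ¬ (k.castSucc = k.succ) := fun h => by simpa using congrArg Fin.val h
        simp [this, Matrix.one_apply]
      · congr 1
        ext a b
        simp only [Matrix.of_apply, Matrix.submatrix_apply, id, hτ, Equiv.prodCongr_apply, Prod.map,
          Equiv.refl_apply, hlast]
        rw [hC0, if_neg (by simp)]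
    · intro a b i j hij
      simp only [Matrix.submatrix_apply, id, hτ, Equiv.prodCongr_apply, Prod.map, Equiv.refl_apply]
      rcases Fin.eq_castSucc_or_eq_last j with ⟨k, rfl⟩ | rfl
      · rw [hcast, hC1 _ _ _ (Fin.succ_ne_zero k), blockJacobi]
        have hij' : (i : ℕ) < k := hij
        have h1 : ¬ (i = k.succ) := fun h => by
          have := congrArg Fin.val h
          simp at this
          omega
        simp only [Matrix.of_apply, if_neg h1, Fin.val_succ]
        rw [if_neg (by omega : ¬ ((i : ℕ) + 1 = (k : ℕ) + 1 ∨ (k : ℕ) + 1 + 1 = i))]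
        simp
      · rw [hlast, hC0, if_pos]
        have : (i : ℕ) < N := hij
        simpa using this
  rw [← hCdet, mul_assoc, ← hlow, hperm, ← mul_assoc, hsq, one_mul]

/-- The first block column of the product consists of two consecutive terms of the solution of the
three-term recursion, so the upper left block inherits that recursion. -/
theorem transferProduct_toBlocks (H : Matrix (Fin m) (Fin m) ℝ) (E : ℂ) (w : ℕ → Fin m → ℝ) (k : ℕ) :
    (transferProduct H E w k).toBlocks₁₁ = blockSolution (fun k => E • 1 - H.map (algebraMap ℝ ℂ) -
      Matrix.diagonal (fun j => (w k j : ℂ))) k := by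
  set A : ℕ → Matrix (Fin m) (Fin m) ℂ := fun k => E • 1 - H.map (algebraMap ℝ ℂ) -
      Matrix.diagonal (fun j => (w k j : ℂ)) with hA
  have h1 : ∀ k, (transferProduct H E w (k + 1)).toBlocks₁₁ =
      A k * (transferProduct H E w k).toBlocks₁₁ - (transferProduct H E w k).toBlocks₂₁ ∧
      (transferProduct H E w (k + 1)).toBlocks₂₁ = (transferProduct H E w k).toBlocks₁₁ := by
    intro k
    rw [transferProduct, transferMatrix, ← Matrix.fromBlocks_toBlocks (transferProduct H E w k),
      Matrix.fromBlocks_multiply]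
    simp [hA, sub_eq_add_neg]
  have h0 : (transferProduct H E w 0).toBlocks₁₁ = 1 ∧ (transferProduct H E w 0).toBlocks₂₁ = 0 := by
    have h11 := Matrix.toBlocks_fromBlocks₁₁ (1 : Matrix (Fin m) (Fin m) ℂ) (0 : Matrix (Fin m) (Fin m) ℂ) 0 (1 : Matrix (Fin m) (Fin m) ℂ)
    have h21 := Matrix.toBlocks_fromBlocks₂₁ (1 : Matrix (Fin m) (Fin m) ℂ) (0 : Matrix (Fin m) (Fin m) ℂ) 0 (1 : Matrix (Fin m) (Fin m) ℂ)
    rw [Matrix.fromBlocks_one] at h11 h21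
    exact ⟨h11, h21⟩
  have h2 : ∀ k, (transferProduct H E w k).toBlocks₁₁ = blockSolution A k ∧
      (transferProduct H E w (k + 1)).toBlocks₁₁ = blockSolution A (k + 1) := by
    intro k
    induction k with
    | zero => exact ⟨h0.1, by rw [(h1 0).1, h0.1, h0.2, Matrix.mul_one, sub_zero, blockSolution]⟩
    | succ k ih => exact ⟨ih.2, by rw [(h1 (k + 1)).1, (h1 k).2, ih.1, ih.2, blockSolution]⟩
  exact (h2 k).1

theorem sub_cartesianProduct_eq {n : ℕ} (H : Matrix (Fin m) (Fin m) ℝ) (E : ℂ) (v : Fin m × Fin n → ℝ) :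
    E • (1 : Matrix (Fin m × Fin n) (Fin m × Fin n) ℂ) -
      (cartesianProduct H (pathMatrix n) + Matrix.diagonal v).map (algebraMap ℝ ℂ) =
    blockJacobi (fun k => E • 1 - H.map (algebraMap ℝ ℂ) -
      Matrix.diagonal (fun j => (slice v k j : ℂ))) n := by
  ext ⟨a, i⟩ ⟨b, j⟩
  have hs : slice v i a = v (a, i) := by simp [slice]
  simp only [Matrix.sub_apply, Matrix.smul_apply, Matrix.one_apply, Matrix.map_apply, Matrix.add_apply,
    cartesianProduct, Matrix.kroneckerMap_apply, Matrix.diagonal_apply, blockJacobi, Matrix.of_apply,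
    Prod.mk.injEq, pathMatrix, smul_eq_mul, Complex.coe_algebraMap]
  rcases eq_or_ne a b with rfl | hab <;> rcases eq_or_ne i j with rfl | hij
  · have h3 : ¬ ((i : ℕ) + 1 = i ∨ (i : ℕ) + 1 = i) := by omega
    simp [hs, h3]
    ring
  · simp only [hij, if_false, and_false, if_true]
    split_ifs <;> simp
  · simp [hab]
  · simp [hab, hij]

/-- The characteristic function of the operator on the box is, up to a constant, the determinant
of the upper left block of the product of the transfer matrices. -/
theorem det_sub_cartesianProduct (m n : ℕ) : ∃ c : ℂ, c ≠ 0 ∧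
    ∀ (H : Matrix (Fin m) (Fin m) ℝ) (E : ℂ) (v : Fin m × Fin n → ℝ),
    (E • (1 : Matrix (Fin m × Fin n) (Fin m × Fin n) ℂ) -
      (cartesianProduct H (pathMatrix n) + Matrix.diagonal v).map (algebraMap ℝ ℂ)).det =
    c * (transferProduct H E (slice v) n).toBlocks₁₁.det := by
  obtain ⟨c, hc, h⟩ := det_blockJacobi (m := m) n
  exact ⟨c, hc, fun H E v => by rw [sub_cartesianProduct_eq, h, transferProduct_toBlocks]⟩

/-- The upper left block of the transfer matrix product in terms of the regularized evolution `X`,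
in the eigenbasis of the base. -/
def reducedBlock (e : Fin m → ℝ) (n : ℕ) (X : Matrix (Fin m ⊕ Fin m) (Fin m ⊕ Fin m) ℂ) :
    Matrix (Fin m) (Fin m) ℂ :=
  Matrix.of fun i j => Complex.I * sEntry (e i) * sEntry (e j) *
    ((starRingEnd ℂ) (unitRoot (e i)) ^ (n + 1) * (X (.inl i) (.inl j) - X (.inl i) (.inr j)) +
      unitRoot (e i) ^ (n + 1) * (X (.inr i) (.inl j) - X (.inr i) (.inr j)))

/-- Undoing the conjugation writes the product as `O Q R ^ n X Q⁻¹ Oᵀ` with `R` the rotation. The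
orthogonal factors drop out of the determinant, and the first row of `Q` raises the exponent `n` of
the phases to `n + 1`. -/
theorem det_transferProduct_toBlocks {e : Fin m → ℝ} (he : ∀ j, |e j| < 2) {O H : Matrix (Fin m) (Fin m) ℝ}
    (hO : O ∈ Matrix.orthogonalGroup (Fin m) ℝ) {lam : ℝ}
    (hH : H * O = O * Matrix.diagonal fun j => lam - e j) (w : ℕ → Fin m → ℝ) (E : ℂ) (n : ℕ) :
    (transferProduct H E w n).toBlocks₁₁.det =
      (reducedBlock e n (regularizedEvolution H O e lam w E n)).det := by
  have h1 : transferProduct H E w n = doubled O * (qMatrix e * rotation e ^ n *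
      regularizedEvolution H O e lam w E n * qInv e) * doubled O.transpose := by
    have h2 := mul_qInv_mul he hO
    have h5 : rotation e ^ n * rotationInv e ^ n = 1 := by
      have hc : rotation e * rotationInv e = 1 := mul_eq_one_comm.1 (rotationInv_mul he)
      have hc' : Commute (rotation e) (rotationInv e) := hc.trans (rotationInv_mul he).symm
      rw [← hc'.mul_pow, hc, one_pow]
    rw [regularizedEvolution_eq he hO hH]
    calc _ = ((doubled O * qMatrix e) * (qInv e * doubled O.transpose)) * transferProduct H E w n *
          ((doubled O * qMatrix e) * (qInv e * doubled O.transpose)) := by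
          rw [h2, Matrix.one_mul, Matrix.mul_one]
      _ = (doubled O * qMatrix e) * (rotation e ^ n * rotationInv e ^ n) * (qInv e * doubled O.transpose)
          * transferProduct H E w n *
          ((doubled O * qMatrix e) * (qInv e * doubled O.transpose)) := by
          rw [h5, Matrix.mul_one]
      _ = _ := by simp only [Matrix.mul_assoc]
  rw [h1]
  generalize regularizedEvolution H O e lam w E n = X
  have h3 : (doubled O * (qMatrix e * rotation e ^ n * X * qInv e) * doubled O.transpose).toBlocks₁₁ =
      O.map (algebraMap ℝ ℂ) * (qMatrix e * rotation e ^ n * X * qInv e).toBlocks₁₁ *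
        O.transpose.map (algebraMap ℝ ℂ) := by
    generalize qMatrix e * rotation e ^ n * X * qInv e = Y
    rw [doubled, doubled, ← Matrix.fromBlocks_toBlocks Y, Matrix.fromBlocks_multiply,
      Matrix.fromBlocks_multiply]
    simp
  have h4 : (qMatrix e * rotation e ^ n * X * qInv e).toBlocks₁₁ = reducedBlock e n X := by
    conv_lhs => rw [← Matrix.fromBlocks_toBlocks X, qMatrix_eq, rotation_pow, qInv]
    simp only [Matrix.fromBlocks_multiply, Matrix.toBlocks_fromBlocks₁₁, Matrix.mul_zero,
      add_zero, zero_add, Matrix.diagonal_mul_diagonal]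
    ext i j
    simp only [Matrix.add_apply, Matrix.mul_diagonal, Matrix.diagonal_mul, reducedBlock,
      Matrix.of_apply, Matrix.toBlocks₁₁, Matrix.toBlocks₁₂, Matrix.toBlocks₂₁, Matrix.toBlocks₂₂]
    ring
  have h6 : (O.transpose.map (algebraMap ℝ ℂ)).det * (O.map (algebraMap ℝ ℂ)).det = 1 := by
    rw [← Matrix.det_mul, ← Matrix.map_mul, (Matrix.mem_orthogonalGroup_iff' _ _).1 hO]
    simp
  rw [h3, h4, Matrix.det_mul, Matrix.det_mul]
  linear_combination (reducedBlock e n X).det * h6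

end BlockDeterminant

/-! ### From characteristic polynomials to vague convergence of eigenvalues -/

section Vague

/-- The kernel `log (u² + 4) - log (u² + 1)`. -/
def logKernel (u : ℝ) : ℝ := Real.log (u ^ 2 + 4) - Real.log (u ^ 2 + 1)

/-- From `log x ≤ x - 1`; the matching lower bound below uses `1 - 1 / x ≤ log x`. The kernel is
thus comparable to the Cauchy kernel: positive, integrable, and with quadratic decay. -/
theorem logKernel_le (u : ℝ) : logKernel u ≤ 3 * (1 + u ^ 2)⁻¹ := by
  have h1 : 0 < u ^ 2 + 1 := by positivity
  have h4 : 0 < u ^ 2 + 4 := by positivity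
  rw [logKernel, ← Real.log_div h4.ne' h1.ne']
  refine (Real.log_le_sub_one_of_pos (by positivity)).trans (le_of_eq ?_)
  rw [add_comm 1]
  field_simp
  ring

theorem le_logKernel (u : ℝ) : 3 / 4 * (1 + u ^ 2)⁻¹ ≤ logKernel u := by
  have h1 : 0 < u ^ 2 + 1 := by positivity
  have h4 : 0 < u ^ 2 + 4 := by positivity
  rw [logKernel, ← Real.log_div h4.ne' h1.ne']
  refine le_trans ?_ (Real.one_sub_inv_le_log_of_pos (by positivity))
  rw [add_comm 1, inv_div, ← sub_nonneg]
  have : 1 - (u ^ 2 + 1) / (u ^ 2 + 4) - 3 / 4 * (u ^ 2 + 1)⁻¹ =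
      3 * (3 * u ^ 2) / (4 * ((u ^ 2 + 4) * (u ^ 2 + 1))) := by
    field_simp
    ring
  rw [this]
  positivity

theorem logKernel_nonneg (u : ℝ) : 0 ≤ logKernel u :=
  le_trans (by positivity) (le_logKernel u)

theorem continuous_logKernel : Continuous logKernel := by
  unfold logKernel
  refine Continuous.sub (Continuous.log (by fun_prop) fun u => ?_) (Continuous.log (by fun_prop) fun u => ?_)
  · positivity
  · positivity

theorem integrable_logKernel : Integrable logKernel := by
  refine (integrable_inv_one_add_sq.const_mul 3).mono' continuous_logKernel.aestronglyMeasurable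
    (ae_of_all _ fun u => ?_)
  rw [Real.norm_of_nonneg (logKernel_nonneg u)]
  exact logKernel_le u

theorem integral_logKernel_pos : 0 < ∫ u, logKernel u := by
  have h := integral_mono (integrable_inv_one_add_sq.const_mul (3 / 4)) integrable_logKernel
    fun u => le_logKernel u
  rw [integral_const_mul, integral_univ_inv_one_add_sq] at h
  exact lt_of_lt_of_le (by positivity) h

/-- This explains the choice of the kernel: it compares `log |z - a|` at heights `2 y` and `y` above
`x`. Summed over eigenvalues it is a logarithm of a ratio of values of the characteristic
polynomial, so unknown normalizations cancel. -/
theorem logKernel_div {x a y : ℝ} (hy : 0 < y) :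
    logKernel ((x - a) / y) = 2 * Real.log ‖((x : ℂ) + (2 * y : ℝ) * Complex.I) - a‖ -
      2 * Real.log ‖((x : ℂ) + y * Complex.I) - a‖ := by
  have hn : ∀ t : ℝ, ‖((x : ℂ) + t * Complex.I) - a‖ ^ 2 = (x - a) ^ 2 + t ^ 2 := by
    intro t
    rw [← Complex.normSq_eq_norm_sq, Complex.normSq_apply]
    simp
    ring
  have hl : ∀ t : ℝ, 2 * Real.log ‖((x : ℂ) + t * Complex.I) - a‖ = Real.log ((x - a) ^ 2 + t ^ 2) := by
    intro t
    rw [← hn, Real.log_pow]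
    norm_num
  rw [hl, hl, logKernel]
  have e1 : ((x - a) / y) ^ 2 + 4 = ((x - a) ^ 2 + (2 * y) ^ 2) / y ^ 2 := by
    field_simp; ring
  have e2 : ((x - a) / y) ^ 2 + 1 = ((x - a) ^ 2 + y ^ 2) / y ^ 2 := by
    field_simp
  rw [e1, e2, Real.log_div (by positivity) (by positivity), Real.log_div (by positivity) (by positivity)]
  ring

theorem ofReal_add_mul_I_sub_ne_zero (x : ℝ) {t : ℝ} (ht : 0 < t) (u : ℝ) :
    ((x : ℂ) + t * Complex.I) - u ≠ 0 := by
  intro h0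
  have := congrArg Complex.im h0
  simp at this
  exact ht.ne' this

theorem sum_logKernel_div {J : Type*} [Fintype J] (u : J → ℝ) {w : ℂ} (hw : w ≠ 0) (x : ℝ) {y : ℝ}
    (hy : 0 < y) : ∑ i, logKernel ((x - u i) / y) =
      2 * Real.log ‖w * ∏ i, (((x : ℂ) + (2 * y : ℝ) * Complex.I) - u i)‖ -
        2 * Real.log ‖w * ∏ i, (((x : ℂ) + y * Complex.I) - u i)‖ := by
  have hlog : ∀ t : ℝ, 0 < t → Real.log ‖w * ∏ i, (((x : ℂ) + t * Complex.I) - u i)‖ =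
        Real.log ‖w‖ + ∑ i, Real.log ‖((x : ℂ) + t * Complex.I) - u i‖ := by
    intro t ht
    have hne := fun i => norm_ne_zero_iff.2 (ofReal_add_mul_I_sub_ne_zero x ht (u i))
    rw [norm_mul, norm_prod, Real.log_mul (norm_ne_zero_iff.2 hw)
      (Finset.prod_ne_zero_iff.2 fun i _ => hne i), Real.log_prod fun i _ => hne i]
  rw [hlog _ (by positivity), hlog _ hy, Finset.sum_congr rfl fun i _ => logKernel_div hy,
    Finset.sum_sub_distrib, ← Finset.mul_sum, ← Finset.mul_sum]
  ring

theorem tendsto_sum_logKernel {κ : Type*} {l : Filter κ} {ι : κ → Type*} [∀ k, Fintype (ι k)]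
    {ι' : Type*} [Fintype ι'] {a : ∀ k, ι k → ℝ} {b : ι' → ℝ} {c : κ → ℂ} {c' : ℂ}
    (hc : ∀ k, c k ≠ 0) (hc' : c' ≠ 0)
    (h : ∀ z : ℂ, 0 < z.im → Tendsto (fun k => c k * ∏ i, (z - a k i)) l (𝓝 (c' * ∏ i, (z - b i))))
    (x : ℝ) {y : ℝ} (hy : 0 < y) :
    Tendsto (fun k => ∑ i, logKernel ((x - a k i) / y)) l (𝓝 (∑ i, logKernel ((x - b i) / y))) := by
  have hT : ∀ t : ℝ, 0 < t → Tendsto (fun k => Real.log ‖c k * ∏ i, (((x : ℂ) + t * Complex.I) - a k i)‖) l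
      (𝓝 (Real.log ‖c' * ∏ i, (((x : ℂ) + t * Complex.I) - b i)‖)) := by
    intro t ht
    refine (Real.continuousAt_log ?_).tendsto.comp ((h _ ?_).norm)
    · exact norm_ne_zero_iff.2 (mul_ne_zero hc' (Finset.prod_ne_zero_iff.2 fun i _ =>
        ofReal_add_mul_I_sub_ne_zero x ht _))
    · simpa using ht
  have h2 := ((hT (2 * y) (by positivity)).const_mul 2).sub ((hT y hy).const_mul 2)
  rw [sum_logKernel_div b hc' x hy]
  exact h2.congr fun k => (sum_logKernel_div (a k) (hc k) x hy).symm

/-- The smoothing of `f` by the logarithmic kernel at scale `y`. -/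
def smoothing (f : ℝ → ℝ) (y a : ℝ) : ℝ :=
  ((∫ u, logKernel u) * y)⁻¹ * ∫ x, f x * logKernel ((x - a) / y)

/-- For `x` in a bounded set the kernel is dominated by `(1 + a ^ 2)⁻¹` uniformly in `x`. This turns
a bound for the sum of these weights over the eigenvalues into a dominating function. -/
theorem logKernel_div_le {x a y R : ℝ} (hy : 0 < y) (hx : |x| ≤ R) :
    logKernel ((x - a) / y) ≤ (3 * y ^ 2 * (2 + (1 + 2 * R ^ 2) / y ^ 2)) * (1 + a ^ 2)⁻¹ := by
  refine (logKernel_le _).trans ?_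
  have e1 : (1 + ((x - a) / y) ^ 2) = ((x - a) ^ 2 + y ^ 2) / y ^ 2 := by
    field_simp
    ring
  have hxR : x ^ 2 ≤ R ^ 2 := sq_le_sq' (by linarith [abs_le.1 hx]) (abs_le.1 hx).2
  rw [e1, inv_div, ← div_eq_mul_inv, mul_div_assoc', div_le_div_iff₀ (by positivity) (by positivity)]
  have key : 1 + a ^ 2 ≤ (2 + (1 + 2 * R ^ 2) / y ^ 2) * ((x - a) ^ 2 + y ^ 2) := by
    have h1 : (2 + (1 + 2 * R ^ 2) / y ^ 2) * ((x - a) ^ 2 + y ^ 2) =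
        2 * (x - a) ^ 2 + 2 * y ^ 2 + (1 + 2 * R ^ 2) + (1 + 2 * R ^ 2) / y ^ 2 * (x - a) ^ 2 := by
      field_simp
      ring
    rw [h1]
    have : 0 ≤ (1 + 2 * R ^ 2) / y ^ 2 * (x - a) ^ 2 := by positivity
    nlinarith [sq_nonneg (x - a - x), sq_nonneg (a - 2 * x), sq_nonneg y]
  calc 3 * y ^ 2 * (1 + a ^ 2) ≤ 3 * y ^ 2 * ((2 + (1 + 2 * R ^ 2) / y ^ 2) * ((x - a) ^ 2 + y ^ 2)) :=
        mul_le_mul_of_nonneg_left key (by positivity)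
    _ = _ := by ring

theorem integrable_mul_logKernel (f : C_c(ℝ, ℝ)) (y a : ℝ) :
    Integrable fun x => f x * logKernel ((x - a) / y) := by
  refine Continuous.integrable_of_hasCompactSupport ?_ ?_
  · exact f.continuous.mul (continuous_logKernel.comp (by fun_prop))
  · exact f.hasCompactSupport.mul_right

theorem exists_bound_support (f : C_c(ℝ, ℝ)) : ∃ R M : ℝ, 1 ≤ R ∧ 0 ≤ M ∧ (∀ x, |f x| ≤ M) ∧
    ∀ x, R < |x| → f x = 0 := by
  obtain ⟨M, hM⟩ := f.hasCompactSupport.exists_bound_of_continuous f.continuous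
  obtain ⟨R, hR⟩ := f.hasCompactSupport.isCompact.isBounded.subset_closedBall 0
  refine ⟨max R 1, M, le_max_right _ _, (norm_nonneg _).trans (hM 0), hM, fun x hx => ?_⟩
  refine image_eq_zero_of_notMem_tsupport fun h => ?_
  have := hR h
  rw [Metric.mem_closedBall, dist_zero_right, Real.norm_eq_abs] at this
  exact absurd this (not_le.2 (lt_of_le_of_lt (le_max_left _ _) hx))

theorem smoothing_eq (f : ℝ → ℝ) {y : ℝ} (hy : 0 < y) (a : ℝ) :
    smoothing f y a = (∫ u, logKernel u)⁻¹ * ∫ u, f (a + y * u) * logKernel u := by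
  rw [smoothing, ← integral_add_left_eq_self (fun x => f x * logKernel ((x - a) / y)) a]
  have h1 := Measure.integral_comp_div (fun u => f (a + y * u) * logKernel u) y
  have h2 : ∀ x, f (a + y * (x / y)) * logKernel (x / y) = f (a + x) * logKernel ((a + x - a) / y) := by
    intro x
    rw [mul_div_cancel₀ _ hy.ne', add_sub_cancel_left]
  simp only [h2] at h1
  rw [h1, abs_of_pos hy, smul_eq_mul, mul_inv]
  field_simp

/-- The usual approximate identity argument: uniform continuity of `f` on the bulk of the kernel,
boundedness of `f` on its tails. -/
theorem exists_smoothing_near (f : C_c(ℝ, ℝ)) {ε : ℝ} (hε : 0 < ε) :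
    ∃ y₀ > 0, ∀ y, 0 < y → y ≤ y₀ → ∀ a, |smoothing f y a - f a| ≤ ε := by
  obtain ⟨R, M, hR, hM, hfM, hf0⟩ := exists_bound_support f
  have hκ := integral_logKernel_pos
  set κ := ∫ u, logKernel u with hκd
  have hT : Tendsto (fun N : ℕ => ∫ u in {u : ℝ | (N : ℝ) ≤ |u|}, logKernel u) atTop (𝓝 0) := by
    have hms : ∀ N : ℕ, MeasurableSet {u : ℝ | (N : ℝ) ≤ |u|} := fun N =>
      measurableSet_le measurable_const (by fun_prop)
    simp only [← integral_indicator (hms _)]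
    have := tendsto_integral_of_dominated_convergence (μ := volume)
      (F := fun (N : ℕ) u => Set.indicator {u : ℝ | (N : ℝ) ≤ |u|} logKernel u) (f := fun _ => 0)
      logKernel (fun N => (continuous_logKernel.measurable.indicator (hms N)).aestronglyMeasurable)
      integrable_logKernel (fun N => ae_of_all _ fun u => ?_) (ae_of_all _ fun u => ?_)
    · simpa using this
    · rw [Real.norm_of_nonneg (Set.indicator_nonneg (fun u _ => logKernel_nonneg u) _)]
      exact Set.indicator_le_self' (fun u _ => logKernel_nonneg u) _
    · obtain ⟨N, hN⟩ := exists_nat_gt |u|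
      refine tendsto_const_nhds.congr' ((eventually_ge_atTop N).mono fun k hk => ?_)
      refine (Set.indicator_of_notMem ?_ _).symm
      have : (N : ℝ) ≤ k := Nat.cast_le.2 hk
      simp only [Set.mem_setOf_eq, not_le]
      linarith
  -- On the tail the oscillation of `f` is at most `2 * M`, so this threshold costs at most half of
  -- `ε`; writing `M + 1` avoids division by zero.
  obtain ⟨N, hN⟩ := ((tendsto_order.1 hT).2 (κ * ε / (4 * (M + 1))) (by positivity)).exists
  have huc : UniformContinuous f := f.hasCompactSupport.uniformContinuous_of_continuous f.continuous
  obtain ⟨δ, hδ, hfδ⟩ := Metric.uniformContinuous_iff.1 huc (ε / 2) (by positivity)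
  refine ⟨δ / (N + 1), by positivity, fun y hy hyy a => ?_⟩
  have hint1 : Integrable fun u => f (a + y * u) * logKernel u := by
    refine (integrable_logKernel.const_mul M).mono' ?_ (ae_of_all _ fun u => ?_)
    · exact ((f.continuous.comp (by fun_prop)).mul continuous_logKernel).aestronglyMeasurable
    · rw [norm_mul, Real.norm_of_nonneg (logKernel_nonneg u)]
      exact mul_le_mul_of_nonneg_right (hfM _) (logKernel_nonneg u)
  have hms : MeasurableSet {u : ℝ | (N : ℝ) ≤ |u|} := measurableSet_le measurable_const (by fun_prop)
  have e1 : smoothing f y a - f a = κ⁻¹ * ∫ u, (f (a + y * u) - f a) * logKernel u := by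
    have : ∫ u, (f (a + y * u) - f a) * logKernel u = (∫ u, f (a + y * u) * logKernel u) - f a * κ := by
      simp only [sub_mul]
      rw [integral_sub hint1 (integrable_logKernel.const_mul _), integral_const_mul]
    rw [smoothing_eq _ hy, this, ← hκd, mul_sub, mul_left_comm, inv_mul_cancel₀ hκ.ne', mul_one]
  have hbd : ∀ u, ‖(f (a + y * u) - f a) * logKernel u‖ ≤ ε / 2 * logKernel u +
      2 * M * Set.indicator {u : ℝ | (N : ℝ) ≤ |u|} logKernel u := by
    intro u
    rw [norm_mul, Real.norm_of_nonneg (logKernel_nonneg u)]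
    by_cases hu : (N : ℝ) ≤ |u|
    · rw [Set.indicator_of_mem (show u ∈ {u : ℝ | (N : ℝ) ≤ |u|} from hu), ← add_mul]
      refine mul_le_mul_of_nonneg_right ?_ (logKernel_nonneg u)
      refine (norm_sub_le _ _).trans ?_
      have h1 := hfM (a + y * u)
      have h2 := hfM a
      rw [Real.norm_eq_abs, Real.norm_eq_abs]
      linarith
    · rw [Set.indicator_of_notMem (show u ∉ {u : ℝ | (N : ℝ) ≤ |u|} from hu), mul_zero, add_zero]
      refine mul_le_mul_of_nonneg_right ?_ (logKernel_nonneg u)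
      rw [← dist_eq_norm]
      refine (hfδ ?_).le
      rw [Real.dist_eq, add_sub_cancel_left, abs_mul, abs_of_pos hy]
      have hu' : |u| < N + 1 := by linarith [not_le.1 hu]
      calc y * |u| < y * (N + 1) := mul_lt_mul_of_pos_left hu' hy
        _ ≤ δ / (N + 1) * (N + 1) := by gcongr
        _ = δ := by field_simp
  have h3 : |∫ u, (f (a + y * u) - f a) * logKernel u| ≤ ε / 2 * κ + 2 * M * (κ * ε / (4 * (M + 1))) := by
    rw [← Real.norm_eq_abs]
    refine (norm_integral_le_integral_norm _).trans ?_
    refine (integral_mono_of_nonneg (ae_of_all _ fun u => norm_nonneg _)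
      ((integrable_logKernel.const_mul _).add ((integrable_logKernel.indicator hms).const_mul _))
      (ae_of_all _ hbd)).trans ?_
    rw [integral_add' (integrable_logKernel.const_mul _) ((integrable_logKernel.indicator hms).const_mul _),
      integral_const_mul, integral_const_mul, integral_indicator hms]
    have := hN.le
    gcongr
  rw [e1, abs_mul, abs_of_pos (inv_pos.2 hκ)]
  have h4 : ε / 2 * κ + 2 * M * (κ * ε / (4 * (M + 1))) ≤ κ * ε := by
    have : 2 * M * (κ * ε / (4 * (M + 1))) = κ * ε / 2 * (M / (M + 1)) := by
      field_simp; ring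
    rw [this]
    have h5 : M / (M + 1) ≤ 1 := (div_le_one (by positivity)).2 (by linarith)
    have := mul_le_mul_of_nonneg_left h5 (by positivity : 0 ≤ κ * ε / 2)
    linarith
  calc κ⁻¹ * _ ≤ κ⁻¹ * (κ * ε) := mul_le_mul_of_nonneg_left (h3.trans h4) (inv_pos.2 hκ).le
    _ = ε := by field_simp

/-- Uniform closeness is not sufficient, because the number of eigenvalues is unbounded; an error
summable against the weights `(1 + a ^ 2)⁻¹` is needed. Near the support of `f` these weights are
bounded below, and far away the quadratic decay of the kernel provides them. -/
theorem exists_smoothing_le (f : C_c(ℝ, ℝ)) {ε : ℝ} (hε : 0 < ε) :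
    ∃ y > 0, ∀ a, |smoothing f y a - f a| ≤ ε * (1 + a ^ 2)⁻¹ := by
  obtain ⟨R, M, hR, hM, hfM, hf0⟩ := exists_bound_support f
  have hκ := integral_logKernel_pos
  obtain ⟨y₀, hy₀, hnear⟩ := exists_smoothing_near f (show 0 < ε / (1 + 4 * R ^ 2) by positivity)
  set κ := ∫ u, logKernel u with hκd
  -- The second bound serves `2 * R ≤ |a|`, where `f a = 0` and the smoothing is at most `24 * M * R
  -- * y / (κ * a ^ 2)`. As `1 ≤ a ^ 2`, this is at most `ε * (1 + a ^ 2)⁻¹`.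
  set y := min y₀ (κ * ε / (48 * (M + 1) * R)) with hyd
  have hy : 0 < y := lt_min hy₀ (by positivity)
  refine ⟨y, hy, fun a => ?_⟩
  rcases le_total |a| (2 * R) with ha | ha
  · refine (hnear y hy (min_le_left _ _) a).trans ?_
    rw [div_eq_mul_inv]
    have : a ^ 2 ≤ 4 * R ^ 2 := by
      have := sq_le_sq' (by linarith [abs_le.1 ha]) (abs_le.1 ha).2
      nlinarith
    gcongr
  · have ha0 : f a = 0 := hf0 a (by linarith)
    have ha1 : 1 ≤ a ^ 2 := by
      rw [← sq_abs]; nlinarith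
    rw [ha0, sub_zero, smoothing, abs_mul, abs_of_pos (by positivity : 0 < (κ * y)⁻¹)]
    have h1 : ∫ x, f x * logKernel ((x - a) / y) = ∫ x in Set.Icc (-R) R, f x * logKernel ((x - a) / y) := by
      refine (setIntegral_eq_integral_of_forall_compl_eq_zero fun x hx => ?_).symm
      rw [hf0 x, zero_mul]
      rw [Set.mem_Icc, ← abs_le, not_le] at hx
      exact hx
    have h2 : |∫ x in Set.Icc (-R) R, f x * logKernel ((x - a) / y)| ≤ (M * (12 * y ^ 2 / a ^ 2)) * (2 * R) := by
      rw [← Real.norm_eq_abs]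
      refine (norm_setIntegral_le_of_norm_le_const (f := fun x => f x * logKernel ((x - a) / y)) (C := M * (12 * y ^ 2 / a ^ 2)) (measure_Icc_lt_top (μ := (volume : Measure ℝ)) (a := -R) (b := R)) fun x hx => ?_).trans ?_
      · rw [norm_mul, Real.norm_of_nonneg (logKernel_nonneg _)]
        refine mul_le_mul (hfM x) ?_ (logKernel_nonneg _) hM
        refine (logKernel_le _).trans ?_
        have hx' : |x| ≤ R := abs_le.2 hx
        have h3 : a ^ 2 / 4 ≤ (x - a) ^ 2 := by
          have h5 : |a| / 2 ≤ |x - a| := by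
            have := abs_sub_abs_le_abs_sub a x
            rw [abs_sub_comm] at this
            linarith
          rw [← sq_abs a, ← sq_abs (x - a)]
          nlinarith [abs_nonneg a, abs_nonneg (x - a)]
        have h6 : 0 < (x - a) ^ 2 := by linarith
        calc 3 * (1 + ((x - a) / y) ^ 2)⁻¹ ≤ 3 * (((x - a) / y) ^ 2)⁻¹ := by
              have : 0 < ((x - a) / y) ^ 2 := by rw [div_pow]; positivity
              gcongr
              linarith
          _ = 3 * y ^ 2 / (x - a) ^ 2 := by rw [div_pow, inv_div]; ring
          _ ≤ 3 * y ^ 2 / (a ^ 2 / 4) := by gcongr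
          _ = 12 * y ^ 2 / a ^ 2 := by field_simp; ring
      · rw [Real.volume_real_Icc_of_le (by linarith)]
        refine le_of_eq ?_
        ring
    rw [h1]
    have h7 : y ≤ κ * ε / (48 * (M + 1) * R) := min_le_right _ _
    calc (κ * y)⁻¹ * _ ≤ (κ * y)⁻¹ * ((M * (12 * y ^ 2 / a ^ 2)) * (2 * R)) := by gcongr
      _ = 24 * M * R / κ * y * (a ^ 2)⁻¹ := by field_simp; ring
      _ ≤ 24 * M * R / κ * (κ * ε / (48 * (M + 1) * R)) * (a ^ 2)⁻¹ := by gcongr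
      _ = (M / (M + 1)) * ε * (2 * a ^ 2)⁻¹ := by field_simp; ring
      _ ≤ 1 * ε * (1 + a ^ 2)⁻¹ := by
          have h5 : M / (M + 1) ≤ 1 := (div_le_one (by positivity)).2 (by linarith)
          gcongr
          linarith
      _ = _ := by ring

theorem sum_smoothing {J : Type*} [Fintype J] (f : C_c(ℝ, ℝ)) (y : ℝ) (u : J → ℝ) :
    ∑ i, smoothing f y (u i) =
      ((∫ u, logKernel u) * y)⁻¹ * ∫ x, f x * ∑ i, logKernel ((x - u i) / y) := by
  simp only [smoothing, ← Finset.mul_sum]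
  rw [← integral_finsetSum _ fun i _ => integrable_mul_logKernel f y (u i)]
  simp only [Finset.mul_sum]

/-- The sum of the smoothings is an integral over `x` of sums of the kernel, which converge
pointwise. The bound `B` gives the domination on the support of `f`. -/
theorem tendsto_sum_smoothing {κ : Type*} {l : Filter κ} [l.IsCountablyGenerated]
    {ι : κ → Type*} [∀ k, Fintype (ι k)]
    {ι' : Type*} [Fintype ι'] {a : ∀ k, ι k → ℝ} {b : ι' → ℝ} {B : ℝ}
    (h : ∀ x y : ℝ, 0 < y → Tendsto (fun k => ∑ i, logKernel ((x - a k i) / y)) l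
      (𝓝 (∑ i, logKernel ((x - b i) / y))))
    (hB : ∀ᶠ k in l, ∑ i, (1 + a k i ^ 2)⁻¹ ≤ B) (f : C_c(ℝ, ℝ)) {y : ℝ} (hy : 0 < y) :
    Tendsto (fun k => ∑ i, smoothing f y (a k i)) l (𝓝 (∑ i, smoothing f y (b i))) := by
  obtain ⟨R, M, hR, hM, hfM, hf0⟩ := exists_bound_support f
  simp only [sum_smoothing f y (a _), sum_smoothing f y b]
  refine Tendsto.const_mul _ ?_
  set C := 3 * y ^ 2 * (2 + (1 + 2 * R ^ 2) / y ^ 2) with hC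
  refine tendsto_integral_filter_of_dominated_convergence (fun x => |f x| * (C * B)) ?_ ?_ ?_ ?_
  · refine Eventually.of_forall fun k => Continuous.aestronglyMeasurable ?_
    exact f.continuous.mul (continuous_finset_sum _ fun i _ => continuous_logKernel.comp (by fun_prop))
  · filter_upwards [hB] with k hk
    refine ae_of_all _ fun x => ?_
    rw [norm_mul, Real.norm_eq_abs]
    rcases le_or_gt |x| R with hx | hx
    · refine mul_le_mul_of_nonneg_left ?_ (abs_nonneg _)
      rw [Real.norm_of_nonneg (Finset.sum_nonneg fun i _ => logKernel_nonneg _)]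
      calc _ ≤ ∑ i, C * (1 + a k i ^ 2)⁻¹ := Finset.sum_le_sum fun i _ => logKernel_div_le hy hx
        _ = C * ∑ i, (1 + a k i ^ 2)⁻¹ := by rw [Finset.mul_sum]
        _ ≤ C * B := mul_le_mul_of_nonneg_left hk (by positivity)
    · rw [hf0 x hx]
      simp
  · exact (f.continuous.integrable_of_hasCompactSupport f.hasCompactSupport).abs.mul_const _
  · exact ae_of_all _ fun x => (h x y hy).const_mul _

/-- The kernel at height 1 above the origin dominates the Cauchy weights, so its convergence
prevents eigenvalues from accumulating in bounded sets. -/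
theorem sum_inv_one_add_sq_le {J : Type*} [Fintype J] (u : J → ℝ) :
    ∑ i, (1 + u i ^ 2)⁻¹ ≤ 4 / 3 * ∑ i, logKernel ((0 - u i) / 1) := by
  rw [Finset.mul_sum]
  refine Finset.sum_le_sum fun i _ => ?_
  have := le_logKernel ((0 - u i) / 1)
  rw [zero_sub, div_one, neg_sq] at *
  linarith

/-- An `ε/4` argument: the smoothing of `f` has convergent sums, and passing between `f` and its
smoothing costs a multiple of the sum of `(1 + a ^ 2)⁻¹`, which is bounded along the filter and in
the limit. -/
theorem tendsto_sum_of_tendsto_prod {κ : Type*} {l : Filter κ} [l.IsCountablyGenerated]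
    {ι : κ → Type*} [∀ k, Fintype (ι k)]
    {ι' : Type*} [Fintype ι'] {a : ∀ k, ι k → ℝ} {b : ι' → ℝ} {c : κ → ℂ} {c' : ℂ}
    (hc : ∀ k, c k ≠ 0) (hc' : c' ≠ 0)
    (h : ∀ z : ℂ, 0 < z.im → Tendsto (fun k => c k * ∏ i, (z - a k i)) l (𝓝 (c' * ∏ i, (z - b i))))
    (f : C_c(ℝ, ℝ)) : Tendsto (fun k => ∑ i, f (a k i)) l (𝓝 (∑ i, f (b i))) := by
  have hlog := fun x y hy => tendsto_sum_logKernel hc hc' h x (y := y) hy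
  -- The summand 1 leaves room for the bound to hold eventually along the filter, and not just in
  -- the limit.
  set B := 4 / 3 * (∑ i, logKernel ((0 - b i) / 1) + 1) with hBd
  have hB : ∀ᶠ k in l, ∑ i, (1 + a k i ^ 2)⁻¹ ≤ B := by
    filter_upwards [(tendsto_order.1 (hlog 0 1 one_pos)).2 _ (lt_add_one _)] with k hk
    exact (sum_inv_one_add_sq_le _).trans (mul_le_mul_of_nonneg_left hk.le (by norm_num))
  have hBb : ∑ i, (1 + b i ^ 2)⁻¹ ≤ B :=
    (sum_inv_one_add_sq_le _).trans (mul_le_mul_of_nonneg_left (lt_add_one _).le (by norm_num))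
  have hB0 : 0 ≤ B := (Finset.sum_nonneg fun i _ => by positivity).trans hBb
  rw [Metric.tendsto_nhds]
  intro ε hε
  obtain ⟨y, hy, hsm⟩ := exists_smoothing_le f (show 0 < ε / (4 * (B + 1)) by positivity)
  filter_upwards [hB, Metric.tendsto_nhds.1 (tendsto_sum_smoothing hlog hB f hy) (ε / 4) (by positivity)]
    with k hk hk2
  have h1 : |∑ i, smoothing f y (a k i) - ∑ i, f (a k i)| ≤ ε / 4 := by
    rw [← Finset.sum_sub_distrib]
    refine (Finset.abs_sum_le_sum_abs _ _).trans ((Finset.sum_le_sum fun i _ => hsm _).trans ?_)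
    rw [← Finset.mul_sum]
    calc _ ≤ ε / (4 * (B + 1)) * (B + 1) := by gcongr; linarith
      _ = ε / 4 := by field_simp
  have h2 : |∑ i, smoothing f y (b i) - ∑ i, f (b i)| ≤ ε / 4 := by
    rw [← Finset.sum_sub_distrib]
    refine (Finset.abs_sum_le_sum_abs _ _).trans ((Finset.sum_le_sum fun i _ => hsm _).trans ?_)
    rw [← Finset.mul_sum]
    calc _ ≤ ε / (4 * (B + 1)) * (B + 1) := by gcongr; linarith
      _ = ε / 4 := by field_simp
  rw [Real.dist_eq] at hk2 ⊢
  rw [abs_lt] at *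
  rw [abs_le] at h1 h2
  constructor <;> linarith

theorem isHermitian_map {ι : Type*} {H : Matrix ι ι ℝ} (hH : H.IsSymm) : H.IsHermitian := by
  rw [Matrix.IsHermitian, Matrix.conjTranspose_eq_transpose_of_trivial]
  exact hH

theorem integral_eigenvalueProcess {ι : Type*} [Fintype ι] [DecidableEq ι] {H : Matrix ι ι ℝ}
    (hH : H.IsHermitian) (f : C_c(ℝ, ℝ)) :
    ∫ x, f x ∂(eigenvalueProcess H).1 = ∑ i, f (hH.eigenvalues i) := by
  have h1 : H.charpoly.roots = Finset.univ.val.map hH.eigenvalues := by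
    simpa using hH.roots_charpoly_eq_eigenvalues
  have h2 : (eigenvalueProcess H).1 = ∑ i, Measure.dirac (hH.eigenvalues i) := by
    change (Multiset.map _ H.charpoly.roots).sum = _
    rw [h1, Multiset.map_map]
    rfl
  have hint : ∀ i ∈ Finset.univ, Integrable (fun x => f x) (Measure.dirac (hH.eigenvalues i)) :=
    fun i _ => f.continuous.integrable_of_hasCompactSupport f.hasCompactSupport
  rw [h2, integral_finset_sum_measure hint]
  exact Finset.sum_congr rfl fun i _ => integral_dirac _ _

theorem det_smul_one_sub {ι : Type*} [Fintype ι] [DecidableEq ι] {H : Matrix ι ι ℝ}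
    (hH : H.IsHermitian) (z : ℂ) :
    (z • (1 : Matrix ι ι ℂ) - H.map (algebraMap ℝ ℂ)).det = ∏ i, (z - hH.eigenvalues i) := by
  have h1 := congrArg (fun p : Polynomial ℝ => (p.map (algebraMap ℝ ℂ)).eval z) hH.charpoly_eq
  simp only [← Matrix.charpoly_map, Matrix.eval_charpoly] at h1
  rw [Matrix.scalar_apply, ← Matrix.smul_one_eq_diagonal] at h1
  rw [h1, Polynomial.map_prod, Polynomial.eval_prod]
  exact Finset.prod_congr rfl fun i _ => by simp

/-- Convergence of characteristic polynomials, up to normalization, on the upper half plane implies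
vague convergence of the eigenvalue processes. -/
theorem tendsto_eigenvalueProcess {κ : Type*} {l : Filter κ} [l.IsCountablyGenerated]
    {ι : κ → Type*} [∀ k, Fintype (ι k)] [∀ k, DecidableEq (ι k)]
    {ι' : Type*} [Fintype ι'] [DecidableEq ι'] {H : ∀ k, Matrix (ι k) (ι k) ℝ} {H' : Matrix ι' ι' ℝ}
    (hH : ∀ k, (H k).IsHermitian) (hH' : H'.IsHermitian) {c : κ → ℂ} {c' : ℂ}
    (hc : ∀ k, c k ≠ 0) (hc' : c' ≠ 0)
    (h : ∀ z : ℂ, 0 < z.im → Tendsto (fun k => c k * (z • 1 - (H k).map (algebraMap ℝ ℂ)).det) l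
      (𝓝 (c' * (z • 1 - H'.map (algebraMap ℝ ℂ)).det))) :
    Tendsto (fun k => eigenvalueProcess (H k)) l (𝓝 (eigenvalueProcess H')) := by
  rw [nhds_induced, tendsto_comap_iff, tendsto_pi_nhds]
  intro f
  simp only [Function.comp_apply, integral_eigenvalueProcess (hH _), integral_eigenvalueProcess hH']
  refine tendsto_sum_of_tendsto_prod hc hc' (fun z hz => ?_) f
  have := h z hz
  rw [det_smul_one_sub hH'] at this
  exact this.congr fun k => by rw [det_smul_one_sub (hH k)]

/-- The eigenvalue process depends continuously on a symmetric matrix. -/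
theorem continuous_eigenvalueProcess {T ι : Type*} [TopologicalSpace T] [FirstCountableTopology T]
    [Fintype ι] [DecidableEq ι] {H : T → Matrix ι ι ℝ} (hH : Continuous H) (hs : ∀ x, (H x).IsHermitian) :
    Continuous fun x => eigenvalueProcess (H x) := by
  refine continuous_iff_continuousAt.2 fun x => ?_
  refine tendsto_eigenvalueProcess (c := fun _ => 1) (c' := 1) hs (hs x) (fun _ => one_ne_zero)
    one_ne_zero fun z _ => ?_
  have : Continuous fun x => 1 * (z • (1 : Matrix ι ι ℂ) - (H x).map (algebraMap ℝ ℂ)).det := by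
    refine continuous_const.mul (Continuous.matrix_det ?_)
    exact continuous_const.sub (hH.matrix_map Complex.continuous_ofReal)
  exact this.tendsto x

end Vague

/-! ### Deterministic perturbation of a recursion near the identity -/

section Perturbation

/-- The Neumann series gives the inverse; `y - 1 = y * (1 - x)` gives the bounds. -/
theorem exists_inverse_near_one {A : Type*} [NormedRing A] [NormOneClass A] [CompleteSpace A] {x : A}
    {δ : ℝ} (hx : ‖x - 1‖ ≤ δ) (hδ : δ ≤ 1 / 2) :
    ∃ y, y * x = 1 ∧ x * y = 1 ∧ ‖y‖ ≤ 2 ∧ ‖y - 1‖ ≤ 2 * δ := by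
  have h1 : ‖1 - x‖ < 1 := by
    rw [norm_sub_rev]; linarith
  set u := Units.oneSub (1 - x) h1 with hu
  have hux : (u : A) = x := by simp [hu]
  have hy : ((u⁻¹ : Aˣ) : A) * x = 1 := by rw [← hux]; exact u.inv_mul
  have hy' : x * ((u⁻¹ : Aˣ) : A) = 1 := by rw [← hux]; exact u.mul_inv
  generalize ((u⁻¹ : Aˣ) : A) = y at hy hy'
  have h2 : y - 1 = y * (1 - x) := by rw [mul_sub, hy, mul_one]
  have h3 : ‖y - 1‖ ≤ ‖y‖ * δ := by
    rw [h2]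
    refine (norm_mul_le _ _).trans (mul_le_mul_of_nonneg_left ?_ (norm_nonneg _))
    rwa [norm_sub_rev]
  have h4 : ‖y‖ ≤ 1 + ‖y - 1‖ := by
    have := norm_add_le (1 : A) (y - 1)
    rwa [norm_one, add_sub_cancel] at this
  have h5 : ‖y‖ ≤ 2 := by nlinarith [norm_nonneg y]
  refine ⟨y, hy, hy', h5, h3.trans ?_⟩
  have : 0 ≤ δ := (norm_nonneg _).trans hx
  nlinarith

/-- A bounded perturbation of a recursion that stays close to the identity. -/
theorem norm_perturbation_le {A : Type*} [NormedRing A] [NormOneClass A] [CompleteSpace A]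
    {X Y M D : ℕ → A} {n : ℕ} {d δ : ℝ} (hX0 : X 0 = 1) (hY0 : Y 0 = 1)
    (hX : ∀ k < n, X (k + 1) = (1 + M k) * X k) (hY : ∀ k < n, Y (k + 1) = (1 + D k + M k) * Y k)
    (hD : ∀ k < n, ‖D k‖ ≤ d) (hδX : ∀ k ≤ n, ‖X k - 1‖ ≤ δ) (hδ : δ ≤ 1 / 2)
    (hnd : 6 * (n * d) ≤ 1) {k : ℕ} (hk : k ≤ n) :
    ‖Y k - X k - ∑ j ∈ Finset.range k, D j‖ ≤ 14 * δ * (n * d) + 6 * (n * d) ^ 2 := by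
  have hδ0 : 0 ≤ δ := (norm_nonneg _).trans (hδX 0 (Nat.zero_le n))
  rcases Nat.eq_zero_or_pos n with rfl | hn
  · obtain rfl : k = 0 := by omega
    simp [hX0, hY0]
  have hd0 : 0 ≤ d := (norm_nonneg _).trans (hD 0 hn)
  choose! I hI using fun k (hk : k ≤ n) => exists_inverse_near_one (hδX k hk) hδ
  -- Variation of constants: for `W = X⁻¹ Y` the terms `M` cancel, and only `W (k + 1) - W k = X (k
  -- + 1)⁻¹ * D k * X k * W k` remains. No smallness of the single `M k` is needed.
  set W : ℕ → A := fun k => I k * Y k with hW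
  have hXn : ∀ k ≤ n, ‖X k‖ ≤ 3 / 2 := by
    intro k hk
    have := norm_add_le (1 : A) (X k - 1)
    rw [norm_one, add_sub_cancel] at this
    linarith [hδX k hk]
  have hYW : ∀ k ≤ n, Y k = X k * W k := by
    intro k hk
    rw [hW, ← mul_assoc, (hI k hk).2.1, one_mul]
  have hWs : ∀ k < n, W (k + 1) = W k + I (k + 1) * D k * X k * W k := by
    intro k hk
    have h1 : W (k + 1) = I (k + 1) * ((1 + D k + M k) * (X k * W k)) := by
      rw [← hYW k hk.le, ← hY k hk]
    rw [h1, show (1 + D k + M k) * (X k * W k) = (1 + M k) * X k * W k + D k * X k * W k by noncomm_ring,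
      ← hX k hk, mul_add, ← mul_assoc (I (k + 1)) (X (k + 1)),
      (hI (k + 1) hk).1, one_mul]
    simp only [mul_assoc]
  -- The factor 6 is `2 * (3 / 2) * 2`, from the bounds for the inverse, for `X` and for `W`. The
  -- last one is part of the induction and persists because `6 * (n * d) ≤ 1`.
  have hW1 : ∀ k ≤ n, ‖W k - 1‖ ≤ 6 * (k * d) := by
    intro k
    induction k with
    | zero =>
      intro h0
      have : I 0 = 1 := by
        have := (hI 0 h0).1
        rwa [hX0, mul_one] at this
      simp [hW, this, hY0]
    | succ k ih =>
      intro hk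
      have hk' : k ≤ n := by omega
      have h1 := ih hk'
      have hkn : (k : ℝ) * d ≤ n * d := mul_le_mul_of_nonneg_right (Nat.cast_le.2 hk') hd0
      have hWn : ‖W k‖ ≤ 2 := by
        have := norm_add_le (1 : A) (W k - 1)
        rw [norm_one, add_sub_cancel] at this
        linarith
      rw [hWs k hk, add_sub_right_comm]
      have h2 : ‖I (k + 1) * D k * X k * W k‖ ≤ 2 * d * (3 / 2) * 2 := by
        refine (norm_mul_le _ _).trans ?_
        refine mul_le_mul ((norm_mul_le _ _).trans (mul_le_mul ((norm_mul_le _ _).trans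
          (mul_le_mul (hI _ hk).2.2.1 (hD k hk) (norm_nonneg _) (by norm_num))) (hXn k hk')
          (norm_nonneg _) (by positivity))) hWn (norm_nonneg _) (by positivity)
      refine (norm_add_le _ _).trans ?_
      push_cast
      linarith
  have hW2 : ∀ k ≤ n, ‖W k‖ ≤ 2 := by
    intro k hk
    have hkn : (k : ℝ) * d ≤ n * d := mul_le_mul_of_nonneg_right (Nat.cast_le.2 hk) hd0
    have := norm_add_le (1 : A) (W k - 1)
    rw [norm_one, add_sub_cancel] at this
    linarith [hW1 k hk]
  -- Each increment of `W` differs from `D k` by the deviations from 1 of the inverse, of `X` and of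
  -- `W`, which contribute `6 δ d`, `2 δ d` and `6 (n d) d`.
  have hW3 : ∀ k ≤ n, ‖W k - 1 - ∑ j ∈ Finset.range k, D j‖ ≤ k * (8 * δ * d + 6 * (n * d) * d) := by
    intro k
    induction k with
    | zero => intro h0; simpa using hW1 0 h0
    | succ k ih =>
      intro hk
      have hk' : k ≤ n := by omega
      have hkn : (k : ℝ) * d ≤ n * d := mul_le_mul_of_nonneg_right (Nat.cast_le.2 hk') hd0
      rw [hWs k hk, Finset.sum_range_succ,
        show W k + I (k + 1) * D k * X k * W k - 1 - (∑ j ∈ Finset.range k, D j + D k) =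
          (W k - 1 - ∑ j ∈ Finset.range k, D j) + ((I (k + 1) - 1) * D k * X k * W k +
            D k * (X k - 1) * W k + D k * (W k - 1)) by noncomm_ring]
      have h1 : ‖(I (k + 1) - 1) * D k * X k * W k‖ ≤ 2 * δ * d * (3 / 2) * 2 := by
        refine (norm_mul_le _ _).trans ?_
        refine mul_le_mul ((norm_mul_le _ _).trans (mul_le_mul ((norm_mul_le _ _).trans
          (mul_le_mul (hI _ hk).2.2.2 (hD k hk) (norm_nonneg _) (by positivity))) (hXn k hk')
          (norm_nonneg _) (by positivity))) (hW2 k hk') (norm_nonneg _) (by positivity)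
      have h2 : ‖D k * (X k - 1) * W k‖ ≤ d * δ * 2 := by
        refine (norm_mul_le _ _).trans (mul_le_mul ((norm_mul_le _ _).trans
          (mul_le_mul (hD k hk) (hδX k hk') (norm_nonneg _) hd0)) (hW2 k hk') (norm_nonneg _)
          (by positivity))
      have h3 : ‖D k * (W k - 1)‖ ≤ d * (6 * (n * d)) :=
        (norm_mul_le _ _).trans (mul_le_mul (hD k hk) ((hW1 k hk').trans (by linarith))
          (norm_nonneg _) hd0)
      have h4 := norm_add_le (W k - 1 - ∑ j ∈ Finset.range k, D j) ((I (k + 1) - 1) * D k * X k * W k +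
            D k * (X k - 1) * W k + D k * (W k - 1))
      have h5 := norm_add_le ((I (k + 1) - 1) * D k * X k * W k + D k * (X k - 1) * W k) (D k * (W k - 1))
      have h6 := norm_add_le ((I (k + 1) - 1) * D k * X k * W k) (D k * (X k - 1) * W k)
      have h7 := ih hk'
      push_cast
      linarith
  have hkn : (k : ℝ) * d ≤ n * d := mul_le_mul_of_nonneg_right (Nat.cast_le.2 hk) hd0
  have hkn' : (k : ℝ) ≤ n := Nat.cast_le.2 hk
  rw [hYW k hk, show X k * W k - X k - ∑ j ∈ Finset.range k, D j =
    (X k - 1) * (W k - 1) + (W k - 1 - ∑ j ∈ Finset.range k, D j) by noncomm_ring]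
  have h1 : ‖(X k - 1) * (W k - 1)‖ ≤ δ * (6 * (n * d)) :=
    (norm_mul_le _ _).trans (mul_le_mul (hδX k hk) ((hW1 k hk).trans (by linarith)) (norm_nonneg _) hδ0)
  have h2 := hW3 k hk
  have h3 : (k : ℝ) * (8 * δ * d + 6 * (n * d) * d) ≤ n * (8 * δ * d + 6 * (n * d) * d) :=
    mul_le_mul_of_nonneg_right hkn' (by positivity)
  refine (norm_add_le _ _).trans ?_
  nlinarith

end Perturbation

/-! ### Matrix recursions driven by noise and their linearization -/

section NoisyEvolution

variable {Ω α I : Type*} {mΩ : MeasurableSpace Ω} [Fintype α] [Fintype I] [DecidableEq I]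
  {P : Measure Ω} [IsProbabilityMeasure P] {F : Filtration ℕ mΩ} {v : ℕ → α → Ω → ℝ} {K : ℝ}

/-- The sum of the mean squares of the entries of a random matrix. -/
def meanSq (P : Measure Ω) (M : Ω → Matrix I I ℂ) : ℝ := ∑ i, ∑ j, ∫ ω, ‖M ω i j‖ ^ 2 ∂P

/-- Doob's inequality for the noise against a predictable sequence of matrices. -/
theorem IsNoise.measure_exists_entry_le (hv : IsNoise P F v K) {H : ℕ → α → Ω → Matrix I I ℂ}
    (hH : ∀ i j, IsPredictable P F fun k a ω => H k a ω i j) {ε : ℝ} (hε : 0 < ε) (n : ℕ) :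
    P.real {ω | ∃ k ≤ n, ∃ i j, ε ≤ ‖noiseSum v H k ω i j‖} ≤
      Fintype.card α * (∑ j ∈ Finset.range n, ∑ a, meanSq P (H j a)) / ε ^ 2 := by
  have e : ∀ k ω i j, noiseSum v H k ω i j = noiseSum v (fun k a ω => H k a ω i j) k ω := by
    intro k ω i j
    simp [noiseSum, Matrix.sum_apply]
  have h1 : {ω | ∃ k ≤ n, ∃ i j, ε ≤ ‖noiseSum v H k ω i j‖} ⊆ ⋃ i ∈ (Finset.univ : Finset I),
      ⋃ j ∈ (Finset.univ : Finset I), {ω | ∃ k ≤ n, ε ≤ ‖noiseSum v (fun k a ω => H k a ω i j) k ω‖} := by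
    rintro ω ⟨k, hk, i, j, h⟩
    simp only [Set.mem_iUnion]
    exact ⟨i, Finset.mem_univ i, j, Finset.mem_univ j, k, hk, by rwa [← e]⟩
  refine (measureReal_mono h1 (measure_ne_top _ _)).trans ((measureReal_biUnion_finset_le _ _).trans
    ((Finset.sum_le_sum fun i _ => measureReal_biUnion_finset_le _ _).trans
    ((Finset.sum_le_sum fun i _ => Finset.sum_le_sum fun j _ =>
      hv.measure_exists_le_noiseSum_le (hH i j) hε n).trans (le_of_eq ?_))))
  simp only [← Finset.sum_div, ← Finset.mul_sum]
  congr 2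
  simp only [meanSq]
  rw [Finset.sum_congr rfl fun i _ => Finset.sum_comm, Finset.sum_comm]
  refine Finset.sum_congr rfl fun k _ => ?_
  rw [Finset.sum_congr rfl fun i _ => Finset.sum_comm, Finset.sum_comm]

theorem IsNoise.meanSq_noiseSum_le (hv : IsNoise P F v K) {H : ℕ → α → Ω → Matrix I I ℂ}
    (hH : ∀ i j, IsPredictable P F fun k a ω => H k a ω i j) (n : ℕ) :
    meanSq P (noiseSum v H n) ≤
      Fintype.card α * (∑ j ∈ Finset.range n, ∑ a, meanSq P (H j a)) := by
  have e : ∀ k ω i j, noiseSum v H k ω i j = noiseSum v (fun k a ω => H k a ω i j) k ω := by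
    intro k ω i j
    simp [noiseSum, Matrix.sum_apply]
  simp only [meanSq, e]
  refine ((Finset.sum_le_sum fun i _ => Finset.sum_le_sum fun j _ =>
      hv.integral_norm_sq_noiseSum_le (hH i j) n).trans (le_of_eq ?_))
  simp only [← Finset.mul_sum]
  congr 1
  rw [Finset.sum_congr rfl fun i _ => Finset.sum_comm, Finset.sum_comm]
  refine Finset.sum_congr rfl fun k _ => ?_
  rw [Finset.sum_congr rfl fun i _ => Finset.sum_comm, Finset.sum_comm]

theorem sum_norm_sq_mul_le {N Y : Matrix I I ℂ} {c : ℝ} (hN : ∀ i j, ‖N i j‖ ≤ c) (i j : I) :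
    ‖(N * Y) i j‖ ^ 2 ≤ c ^ 2 * Fintype.card I * ∑ q, ‖Y q j‖ ^ 2 := by
  have h1 : ‖(N * Y) i j‖ ≤ c * ∑ q, ‖Y q j‖ := by
    rw [Matrix.mul_apply, Finset.mul_sum]
    refine (norm_sum_le _ _).trans (Finset.sum_le_sum fun q _ => ?_)
    rw [norm_mul]
    exact mul_le_mul_of_nonneg_right (hN i q) (norm_nonneg _)
  calc ‖(N * Y) i j‖ ^ 2 ≤ (c * ∑ q, ‖Y q j‖) ^ 2 := pow_le_pow_left₀ (norm_nonneg _) h1 2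
    _ = c ^ 2 * (∑ q, ‖Y q j‖) ^ 2 := by ring
    _ ≤ c ^ 2 * (Fintype.card I * ∑ q, ‖Y q j‖ ^ 2) := by
        refine mul_le_mul_of_nonneg_left ?_ (sq_nonneg c)
        simpa using sq_sum_le_card_mul_sum_sq (s := Finset.univ) (f := fun q => ‖Y q j‖)
    _ = _ := by ring

theorem meanSq_mul_le {N : Matrix I I ℂ} {Y : Ω → Matrix I I ℂ} {c : ℝ} (hN : ∀ i j, ‖N i j‖ ≤ c)
    (hY : ∀ i j, MemLp (fun ω => Y ω i j) 2 P) :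
    meanSq P (fun ω => N * Y ω) ≤ c ^ 2 * (Fintype.card I : ℝ) ^ 2 * meanSq P Y := by
  have hint : ∀ i j, Integrable (fun ω => ‖Y ω i j‖ ^ 2) P := fun i j => (hY i j).norm.integrable_sq
  have h1 : ∀ i j, ∫ ω, ‖(N * Y ω) i j‖ ^ 2 ∂P ≤ c ^ 2 * Fintype.card I * ∑ q, ∫ ω, ‖Y ω q j‖ ^ 2 ∂P := by
    intro i j
    rw [← integral_finsetSum _ fun q _ => hint q j, ← integral_const_mul]
    exact integral_mono_of_nonneg (ae_of_all _ fun ω => by positivity)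
      ((integrable_finsetSum _ fun q _ => hint q j).const_mul _)
      (ae_of_all _ fun ω => sum_norm_sq_mul_le hN i j)
  refine (Finset.sum_le_sum fun i _ => Finset.sum_le_sum fun j _ => h1 i j).trans (le_of_eq ?_)
  rw [Finset.sum_const, meanSq, Finset.sum_comm (f := fun i j => ∫ ω, ‖Y ω i j‖ ^ 2 ∂P),
    ← Finset.mul_sum, Finset.card_univ, nsmul_eq_mul]
  ring

theorem memLp_mul_entry {N : Matrix I I ℂ} {Y : Ω → Matrix I I ℂ}
    (hY : ∀ i j, MemLp (fun ω => Y ω i j) 2 P) (i j : I) :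
    MemLp (fun ω => (N * Y ω) i j) 2 P := by
  simp only [Matrix.mul_apply]
  exact memLp_finsetSum _ fun q _ => (hY q j).const_mul _

theorem measurable_mul_entry {m₀ : MeasurableSpace Ω} {N : Matrix I I ℂ} {Y : Ω → Matrix I I ℂ}
    (hY : ∀ i j, Measurable fun ω => Y ω i j) (i j : I) :
    Measurable fun ω => (N * Y ω) i j := by
  simp only [Matrix.mul_apply]
  exact Finset.measurable_fun_sum _ fun q _ => (hY q j).const_mul _

/-- A random matrix recursion driven by noise, started at the identity. -/
structure IsNoisyEvolution (v : ℕ → α → Ω → ℝ) (N : ℕ → α → Matrix I I ℂ) (σ : ℝ)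
    (X : ℕ → Ω → Matrix I I ℂ) : Prop where
  zero : ∀ ω, X 0 ω = 1
  succ : ∀ k ω, X (k + 1) ω = (1 + σ • ∑ a, v k a ω • N k a) * X k ω

variable {N : ℕ → α → Matrix I I ℂ} {σ : ℝ} {X : ℕ → Ω → Matrix I I ℂ}

/-- The recursion in summed form: a noise sum with coefficients that contain the solution itself and
depend only on earlier slices. -/
theorem IsNoisyEvolution.eq_add (hX : IsNoisyEvolution v N σ X) (k : ℕ) (ω : Ω) :
    X k ω = 1 + σ • noiseSum v (fun j a ω => N j a * X j ω) k ω := by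
  induction k with
  | zero => simp [hX.zero, noiseSum]
  | succ k ih =>
    rw [hX.succ, add_mul, one_mul, noiseSum, Finset.sum_range_succ, smul_add, ← add_assoc]
    nth_rewrite 1 [ih]
    simp only [noiseSum, Matrix.smul_mul, Finset.sum_mul]

/-- After `k` steps only the first `k` slices have been used, and independence of the next slice
preserves square integrability under multiplication. -/
theorem IsNoisyEvolution.predictable (hX : IsNoisyEvolution v N σ X) (hv : IsNoise P F v K) (k : ℕ) :
    ∀ i j, Measurable[F k] (fun ω => X k ω i j) ∧ MemLp (fun ω => X k ω i j) 2 P := by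
  induction k with
  | zero =>
    intro i j
    simp only [hX.zero]
    exact ⟨measurable_const, memLp_const _⟩
  | succ k ih =>
    intro i j
    have hm : ∀ a, Measurable[F k] fun ω => (N k a * X k ω) i j := fun a =>
      measurable_mul_entry (fun i j => (ih i j).1) i j
    have hp : ∀ a, MemLp (fun ω => (N k a * X k ω) i j) 2 P := fun a =>
      memLp_mul_entry (fun i j => (ih i j).2) i j
    -- The single step from `k` to `k + 1` is regarded as a noise sum of length one for the
    -- filtration shifted by `k`, so that the general facts about noise sums apply.
    have hH : IsPredictable P (shiftFiltration F k) fun l (a : α) ω =>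
        if l = 0 then (N k a * X k ω) i j else 0 := by
      constructor
      · intro l a
        by_cases hl : l = 0
        · subst hl
          simp only [if_true]
          exact hm a
        · simp only [hl, if_false]
          exact measurable_const
      · intro l a
        by_cases hl : l = 0
        · simpa [hl] using hp a
        · simp only [hl, if_false]
          exact memLp_const _
    have e : (fun ω => X (k + 1) ω i j) = fun ω => X k ω i j +
        (σ : ℂ) * noiseSum (fun l => v (k + l)) (fun l (a : α) ω => if l = 0 then (N k a * X k ω) i j else 0) 1 ω := by
      funext ω
      rw [hX.succ, add_mul, one_mul, Matrix.add_apply]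
      simp [noiseSum, Finset.sum_mul, Matrix.sum_apply]
    rw [e]
    refine ⟨?_, ?_⟩
    · exact ((ih i j).1.mono (F.mono (Nat.le_succ k)) le_rfl).add
        (((hv.shift k).measurable_noiseSum hH 1).const_mul _)
    · exact (ih i j).2.add (((hv.shift k).memLp_noiseSum hH 1).const_mul _)

theorem meanSq_one_add_le {Y : Ω → Matrix I I ℂ} (hY : ∀ i j, MemLp (fun ω => Y ω i j) 2 P) :
    meanSq P Y ≤ 2 * Fintype.card I + 2 * meanSq P fun ω => Y ω - 1 := by
  have h1 : ∀ i j, ∫ ω, ‖Y ω i j‖ ^ 2 ∂P ≤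
      2 * ‖(1 : Matrix I I ℂ) i j‖ ^ 2 + 2 * ∫ ω, ‖(Y ω - 1) i j‖ ^ 2 ∂P := by
    intro i j
    have hint : Integrable (fun ω => ‖(Y ω - 1) i j‖ ^ 2) P :=
      ((hY i j).sub (memLp_const ((1 : Matrix I I ℂ) i j))).norm.integrable_sq
    have h2 : ∫ ω, (2 * ‖(1 : Matrix I I ℂ) i j‖ ^ 2 + 2 * ‖(Y ω - 1) i j‖ ^ 2) ∂P =
        2 * ‖(1 : Matrix I I ℂ) i j‖ ^ 2 + 2 * ∫ ω, ‖(Y ω - 1) i j‖ ^ 2 ∂P := by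
      rw [integral_add (integrable_const _) (hint.const_mul 2), integral_const, probReal_univ, one_smul,
        integral_const_mul]
    rw [← h2]
    refine integral_mono_of_nonneg (ae_of_all _ fun ω => by positivity)
      ((integrable_const _).add (hint.const_mul 2)) (ae_of_all _ fun ω => ?_)
    have h3 : ‖Y ω i j‖ ≤ ‖(1 : Matrix I I ℂ) i j‖ + ‖(Y ω - 1) i j‖ := by
      have := norm_add_le ((1 : Matrix I I ℂ) i j) ((Y ω - 1) i j)
      rwa [Matrix.sub_apply, add_sub_cancel] at this
    calc ‖Y ω i j‖ ^ 2 ≤ (‖(1 : Matrix I I ℂ) i j‖ + ‖(Y ω - 1) i j‖) ^ 2 :=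
          pow_le_pow_left₀ (norm_nonneg _) h3 2
      _ ≤ _ := by nlinarith [sq_nonneg (‖(1 : Matrix I I ℂ) i j‖ - ‖(Y ω - 1) i j‖)]
  refine (Finset.sum_le_sum fun i _ => Finset.sum_le_sum fun j _ => h1 i j).trans (le_of_eq ?_)
  simp only [Finset.sum_add_distrib, ← Finset.mul_sum, meanSq]
  congr 2
  have : ∀ i, ∑ j, ‖(1 : Matrix I I ℂ) i j‖ ^ 2 = 1 := by
    intro i
    rw [Finset.sum_eq_single i]
    · simp
    · intro j _ hj
      simp [Matrix.one_apply_ne hj.symm]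
    · simp
  simp [this]

theorem IsNoisyEvolution.predictable_mul_sub (hX : IsNoisyEvolution v N σ X) (hv : IsNoise P F v K)
    (B : Matrix I I ℂ) (i j : I) :
    IsPredictable P F fun k a ω => (N k a * (X k ω - B)) i j := by
  constructor
  · intro k a
    refine measurable_mul_entry (m₀ := F k) (fun i j => ?_) i j
    exact (hX.predictable hv k i j).1.sub_const _
  · intro k a
    refine memLp_mul_entry (fun i j => ?_) i j
    exact (hX.predictable hv k i j).2.sub (memLp_const _)

section Bounds

variable {C θ : ℝ} {n : ℕ}

/-- In the application `θ` is `n ^ (-1/2)`: at most `n` slices with coefficients of square size `θ ^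
2` add up to a bounded quantity. -/
theorem IsNoise.meanSq_bound {H : ℕ → α → Ω → Matrix I I ℂ} {B : ℝ} (hB : 0 ≤ B) (hn : n * θ ^ 2 ≤ 1)
    {k : ℕ} (hk : k ≤ n)
    (hH : ∀ j < k, ∀ a, meanSq P (H j a) ≤ (C * θ) ^ 2 * (Fintype.card I : ℝ) ^ 2 * B) :
    Fintype.card α * (∑ j ∈ Finset.range k, ∑ a, meanSq P (H j a)) ≤
      ((Fintype.card α : ℝ) * C * Fintype.card I) ^ 2 * B := by
  have h1 : ∑ j ∈ Finset.range k, ∑ a, meanSq P (H j a) ≤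
      ∑ j ∈ Finset.range k, ∑ a : α, (C * θ) ^ 2 * (Fintype.card I : ℝ) ^ 2 * B :=
    Finset.sum_le_sum fun j hj => Finset.sum_le_sum fun a _ => hH j (Finset.mem_range.1 hj) a
  have h2 : (k : ℝ) * θ ^ 2 ≤ 1 :=
    (mul_le_mul_of_nonneg_right (Nat.cast_le.2 hk) (sq_nonneg θ)).trans hn
  refine (mul_le_mul_of_nonneg_left h1 (Nat.cast_nonneg _)).trans ?_
  simp only [Finset.sum_const, Finset.card_univ, Finset.card_range, nsmul_eq_mul]
  have h3 : (Fintype.card α : ℝ) * (k * (Fintype.card α * ((C * θ) ^ 2 * (Fintype.card I : ℝ) ^ 2 * B))) =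
      (k * θ ^ 2) * (((Fintype.card α : ℝ) * C * Fintype.card I) ^ 2 * B) := by ring
  rw [h3]
  exact mul_le_of_le_one_left (by positivity) h2

/-- Strong induction closes the estimate: if the earlier matrices are within the claimed distance of
1, the smallness of `σ` bounds their mean squares by `4 * Fintype.card I`, which reproduces the
claim for the noise sum they drive. -/
theorem IsNoisyEvolution.meanSq_sub_one_le (hX : IsNoisyEvolution v N σ X) (hv : IsNoise P F v K)
    (hN : ∀ k a i j, ‖N k a i j‖ ≤ C * θ) (hn : n * θ ^ 2 ≤ 1)
    (hσ : 4 * σ ^ 2 * ((Fintype.card α : ℝ) * C * Fintype.card I) ^ 2 ≤ 1) (k : ℕ) (hk : k ≤ n) :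
    meanSq P (fun ω => X k ω - 1) ≤
      4 * Fintype.card I * ((Fintype.card α : ℝ) * C * Fintype.card I) ^ 2 * σ ^ 2 := by
  set κ := ((Fintype.card α : ℝ) * C * Fintype.card I) ^ 2 with hκ
  have hκ0 : 0 ≤ κ := sq_nonneg _
  induction k using Nat.strong_induction_on with
  | _ k ih =>
    have h1 : meanSq P (fun ω => X k ω - 1) = σ ^ 2 * meanSq P (noiseSum v (fun j a ω => N j a * X j ω) k) := by
      simp only [meanSq, Finset.mul_sum]
      refine Finset.sum_congr rfl fun i _ => Finset.sum_congr rfl fun j _ => ?_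
      rw [← integral_const_mul]
      refine integral_congr_ae (ae_of_all _ fun ω => ?_)
      simp only [hX.eq_add k ω, add_sub_cancel_left, Matrix.smul_apply, norm_smul, mul_pow,
        Real.norm_eq_abs, sq_abs]
    have hp : ∀ i j, IsPredictable P F fun k a ω => (N k a * X k ω) i j := fun i j => by
      simpa using hX.predictable_mul_sub hv 0 i j
    have h2 : meanSq P (noiseSum v (fun j a ω => N j a * X j ω) k) ≤ κ * (4 * Fintype.card I) := by
      refine (hv.meanSq_noiseSum_le hp k).trans
        (IsNoise.meanSq_bound (by positivity) hn hk fun j hj a => ?_)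
      refine (meanSq_mul_le (hN j a) fun i j' => (hX.predictable hv j i j').2).trans ?_
      refine mul_le_mul_of_nonneg_left ?_ (by positivity)
      refine (meanSq_one_add_le fun i j' => (hX.predictable hv j i j').2).trans ?_
      have := ih j hj (by omega)
      have hc : (0 : ℝ) ≤ Fintype.card I := Nat.cast_nonneg _
      nlinarith
    rw [h1]
    calc σ ^ 2 * _ ≤ σ ^ 2 * (κ * (4 * Fintype.card I)) := mul_le_mul_of_nonneg_left h2 (sq_nonneg _)
      _ = _ := by ring

theorem IsNoise.measure_exists_noise_le (hv : IsNoise P F v K)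
    (hN : ∀ k a i j, ‖N k a i j‖ ≤ C * θ) (hn : n * θ ^ 2 ≤ 1) {ε : ℝ} (hε : 0 < ε) :
    P.real {ω | ∃ k ≤ n, ∃ i j, ε ≤ ‖noiseSum v (fun k a _ => N k a) k ω i j‖} ≤
      ((Fintype.card α : ℝ) * C * Fintype.card I) ^ 2 / ε ^ 2 := by
  refine (hv.measure_exists_entry_le (fun i j => isPredictable_const fun k a => N k a i j) hε n).trans ?_
  refine div_le_div_of_nonneg_right ?_ (by positivity)
  refine (IsNoise.meanSq_bound zero_le_one hn le_rfl fun j hj a => ?_).trans (by rw [mul_one])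
  rw [mul_one]
  simp only [meanSq, integral_const, probReal_univ, one_smul]
  calc _ ≤ ∑ i : I, ∑ j : I, (C * θ) ^ 2 := Finset.sum_le_sum fun i _ => Finset.sum_le_sum fun j' _ =>
        pow_le_pow_left₀ (norm_nonneg _) (hN j a i j') 2
    _ = _ := by
        simp only [Finset.sum_const, Finset.card_univ, nsmul_eq_mul]
        ring

/-- The remainder of the linearization is `σ` times the noise sum with coefficients `N * (X - 1)`.
As `X - 1` is `O(σ)` in mean square, Doob's inequality shows that the remainder is of order `σ ^ 2`
up to time `n`. -/
theorem IsNoisyEvolution.measure_exists_remainder_le (hX : IsNoisyEvolution v N σ X)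
    (hv : IsNoise P F v K) (hσ0 : 0 < σ)
    (hN : ∀ k a i j, ‖N k a i j‖ ≤ C * θ) (hn : n * θ ^ 2 ≤ 1)
    (hσ : 4 * σ ^ 2 * ((Fintype.card α : ℝ) * C * Fintype.card I) ^ 2 ≤ 1) {ε : ℝ} (hε : 0 < ε) :
    P.real {ω | ∃ k ≤ n, ∃ i j, σ * ε ≤
        ‖(X k ω - 1 - σ • noiseSum v (fun k a _ => N k a) k ω) i j‖} ≤
      ((Fintype.card α : ℝ) * C * Fintype.card I) ^ 2 *
        (4 * Fintype.card I * ((Fintype.card α : ℝ) * C * Fintype.card I) ^ 2 * σ ^ 2) / ε ^ 2 := by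
  have e : ∀ k ω, X k ω - 1 - σ • noiseSum v (fun k a _ => N k a) k ω =
      σ • noiseSum v (fun k a ω => N k a * (X k ω - 1)) k ω := by
    intro k ω
    rw [hX.eq_add k ω, add_sub_cancel_left, ← smul_sub]
    congr 1
    simp only [noiseSum, ← Finset.sum_sub_distrib, mul_sub, mul_one, smul_sub]
  have e2 : ∀ k ω i j, (σ * ε ≤ ‖(X k ω - 1 - σ • noiseSum v (fun k a _ => N k a) k ω) i j‖) ↔
      ε ≤ ‖noiseSum v (fun k a ω => N k a * (X k ω - 1)) k ω i j‖ := by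
    intro k ω i j
    rw [e, Matrix.smul_apply, norm_smul, Real.norm_of_nonneg hσ0.le, mul_le_mul_iff_right₀ hσ0]
  simp only [e2]
  refine (hv.measure_exists_entry_le (fun i j => hX.predictable_mul_sub hv 1 i j) hε n).trans ?_
  refine div_le_div_of_nonneg_right ?_ (by positivity)
  refine IsNoise.meanSq_bound (by positivity) hn le_rfl fun j hj a => ?_
  refine (meanSq_mul_le (hN j a) fun i j' => ((hX.predictable hv j i j').2.sub
    (memLp_const ((1 : Matrix I I ℂ) i j')) :)).trans ?_
  exact mul_le_mul_of_nonneg_left (hX.meanSq_sub_one_le hv hN hn hσ j hj.le) (by positivity)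

end Bounds

end NoisyEvolution

/-! ### Averages of rotating phases -/

section Phases

theorem unitRoot_eq_exp {e : ℝ} (he : |e| < 2) :
    unitRoot e = Complex.exp (Complex.I * (criticalAngle e : ℝ)) := by
  have h := abs_lt.1 he
  rw [mul_comm, Complex.exp_mul_I, ← Complex.ofReal_cos, ← Complex.ofReal_sin, criticalAngle,
    Real.cos_arccos (by linarith) (by linarith), Real.sin_arccos, unitRoot, mul_comm Complex.I]

theorem norm_angle_le_pi (θ : ℝ) : ‖(θ : Real.Angle)‖ ≤ Real.pi := by
  have h : ‖(θ : AddCircle (2 * Real.pi))‖ ≤ |2 * Real.pi| / 2 :=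
    AddCircle.norm_le_half_period _ (by positivity)
  rw [abs_of_pos Real.two_pi_pos] at h
  have h' : ‖(θ : Real.Angle)‖ ≤ 2 * Real.pi / 2 := h
  linarith

/-- A chord is at least `2 / π` times its arc, after reducing the angle to its representative of
least modulus. -/
theorem norm_angle_le_norm_exp_sub_one (θ : ℝ) :
    2 / Real.pi * ‖(θ : Real.Angle)‖ ≤ ‖Complex.exp (Complex.I * θ) - 1‖ := by
  set θ' := θ - round ((2 * Real.pi)⁻¹ * θ) * (2 * Real.pi) with hθ'
  have h1 : ‖(θ : Real.Angle)‖ = |θ'| := AddCircle.norm_eq (2 * Real.pi)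
  have h2 : Complex.exp (Complex.I * θ) = Complex.exp (Complex.I * θ') := by
    rw [Complex.exp_eq_exp_iff_exists_int]
    refine ⟨round ((2 * Real.pi)⁻¹ * θ), ?_⟩
    rw [hθ']
    push_cast
    ring
  have h3 : |θ'| ≤ Real.pi := h1 ▸ norm_angle_le_pi θ
  have h4 := Real.mul_abs_le_abs_sin (x := θ' / 2) (by rw [abs_div, abs_two]; linarith)
  rw [h1, h2, Complex.norm_exp_I_mul_ofReal_sub_one, norm_mul, Real.norm_eq_abs, Real.norm_eq_abs, abs_two]
  rw [abs_div, abs_two] at h4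
  linarith

theorem norm_exp_I_mul (θ : ℝ) : ‖Complex.exp (Complex.I * θ)‖ = 1 := by
  rw [mul_comm]
  exact Complex.norm_exp_ofReal_mul_I θ

/-- The geometric series formula; the bound does not depend on the number of terms. -/
theorem norm_geom_sum_le {θ : ℝ} (hθ : 0 < ‖(θ : Real.Angle)‖) (K : ℕ) :
    ‖∑ k ∈ Finset.range K, Complex.exp (Complex.I * θ) ^ (k + 1)‖ ≤ Real.pi / ‖(θ : Real.Angle)‖ := by
  have h1 := norm_angle_le_norm_exp_sub_one θ
  have h0 : 0 < 2 / Real.pi * ‖(θ : Real.Angle)‖ := by positivity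
  have h2 : Complex.exp (Complex.I * θ) ≠ 1 := by
    intro h
    rw [h, sub_self, norm_zero] at h1
    linarith
  simp only [pow_succ, ← Finset.sum_mul]
  rw [geom_sum_eq h2, norm_mul, norm_div, norm_exp_I_mul, mul_one]
  have h3 : ‖Complex.exp (Complex.I * θ) ^ K - 1‖ ≤ 2 := by
    refine (norm_sub_le _ _).trans ?_
    rw [norm_pow, norm_exp_I_mul, one_pow, norm_one]
    norm_num
  calc _ ≤ 2 / (2 / Real.pi * ‖(θ : Real.Angle)‖) := div_le_div₀ (by norm_num) h3 h0 h1
    _ = _ := by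
      have := hθ.ne'
      field_simp

/-- The phase `θ ν` is not resonant on the scale `n ν`. -/
def IsNonresonant (n : ℕ → ℕ) (θ : ℕ → ℝ) : Prop :=
  Tendsto (fun ν => (n ν : ℝ) * ‖(θ ν : Real.Angle)‖) atTop atTop

variable {n : ℕ → ℕ}

theorem IsNonresonant.neg {θ : ℕ → ℝ} (h : IsNonresonant n θ) : IsNonresonant n fun ν => -θ ν := by
  unfold IsNonresonant at *
  simpa only [Real.Angle.coe_neg, norm_neg] using h

theorem IsNonresonant.of_eq {θ θ' : ℕ → ℝ} (h : IsNonresonant n θ) (he : ∀ ν, θ ν = θ' ν) :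
    IsNonresonant n θ' :=
  funext he ▸ h

/-- Uniform smallness of the averages of a nonresonant phase. -/
theorem IsNonresonant.exists_bound {θ : ℕ → ℝ} (h : IsNonresonant n θ) :
    ∃ η : ℕ → ℝ, Tendsto η atTop (𝓝 0) ∧ ∀ᶠ ν in atTop, ∀ K : ℕ,
      ‖(n ν : ℂ)⁻¹ * ∑ k ∈ Finset.range K, Complex.exp (Complex.I * θ ν) ^ (k + 1)‖ ≤ η ν := by
  refine ⟨fun ν => Real.pi * (((n ν : ℝ) * ‖(θ ν : Real.Angle)‖)⁻¹), ?_, ?_⟩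
  · simpa using (tendsto_inv_atTop_zero.comp h).const_mul Real.pi
  · filter_upwards [h.eventually_gt_atTop 0] with ν hν K
    have h1 : 0 < ‖(θ ν : Real.Angle)‖ := by
      by_contra hc
      have := le_antisymm (not_lt.1 hc) (norm_nonneg _)
      rw [this, mul_zero] at hν
      exact lt_irrefl _ hν
    rw [norm_mul, norm_inv, Complex.norm_natCast, mul_inv]
    calc _ ≤ (n ν : ℝ)⁻¹ * (Real.pi / ‖(θ ν : Real.Angle)‖) :=
          mul_le_mul_of_nonneg_left (norm_geom_sum_le h1 K) (by positivity)
      _ = _ := by rw [div_eq_mul_inv]; ring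

theorem abs_floor_div_sub_le {n : ℕ} (hn : 0 < n) (t : unitInterval) :
    |(⌊(n : ℝ) * t⌋₊ : ℝ) / n - t| ≤ 1 / n := by
  have hn' : (0 : ℝ) < n := Nat.cast_pos.2 hn
  have h1 := Nat.floor_le (mul_nonneg hn'.le t.2.1)
  have h2 := Nat.lt_floor_add_one ((n : ℝ) * t)
  rw [div_sub' hn'.ne', abs_div, abs_of_pos hn']
  gcongr
  rw [abs_le]
  constructor <;> linarith

theorem tendsto_floor_div (hn : Tendsto n atTop atTop) (t : unitInterval) :
    Tendsto (fun ν => (⌊(n ν : ℝ) * t⌋₊ : ℝ) / n ν) atTop (𝓝 (t : ℝ)) := by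
  rw [tendsto_iff_norm_sub_tendsto_zero]
  refine squeeze_zero' (Eventually.of_forall fun _ => norm_nonneg _) ?_
    (tendsto_one_div_atTop_nhds_zero_nat.comp hn)
  filter_upwards [hn.eventually_gt_atTop 0] with ν hν
  exact abs_floor_div_sub_le hν t

/-- The dichotomy behind all limiting covariances: a phase that vanishes identically averages to the
elapsed time, and a nonresonant one averages to zero. -/
theorem tendsto_average_phase (hn : Tendsto n atTop atTop) {θ : ℕ → ℝ} {b : Prop} [Decidable b]
    (h0 : b → ∀ ν, θ ν = 0) (h1 : ¬ b → IsNonresonant n θ) (t : unitInterval) (w : ℝ) :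
    Tendsto (fun ν => ∑ k ∈ Finset.range ⌊(n ν : ℝ) * t⌋₊,
      (n ν : ℂ)⁻¹ * Complex.exp (Complex.I * θ ν) ^ (k + 1) * w) atTop
      (𝓝 ((t * (if b then w else 0) : ℝ) : ℂ)) := by
  by_cases hb : b
  · simp only [h0 hb, Complex.ofReal_zero, mul_zero, Complex.exp_zero, one_pow, mul_one,
      Finset.sum_const, Finset.card_range, nsmul_eq_mul, if_pos hb]
    have := (Complex.continuous_ofReal.tendsto _).comp ((tendsto_floor_div hn t).mul_const w)
    refine this.congr fun ν => ?_
    simp only [Function.comp_apply]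
    push_cast
    ring
  · obtain ⟨η, hη, hb2⟩ := (h1 hb).exists_bound
    rw [if_neg hb, mul_zero, Complex.ofReal_zero, tendsto_zero_iff_norm_tendsto_zero]
    refine squeeze_zero' (Eventually.of_forall fun _ => norm_nonneg _) ?_
      (by simpa using hη.mul_const |w|)
    filter_upwards [hb2] with ν hν
    rw [← Finset.sum_mul, ← Finset.mul_sum, norm_mul _ (w : ℂ), Complex.norm_real, Real.norm_eq_abs]
    exact mul_le_mul_of_nonneg_right (hν _) (abs_nonneg _)

end Phases

/-! ### Nonresonant combinations of the critical angles -/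

section Resonances

variable {m : ℕ} {n : ℕ → ℕ} {q : ℕ → Fin m → ℝ}

/-- The lengths tend to infinity faster than the inverse chaoticities. -/
def IsChaotic (n : ℕ → ℕ) (q : ℕ → Fin m → ℝ) : Prop :=
  Tendsto (fun ν => (n ν : ℝ) * chaoticity (fun j => (q ν j : Real.Angle))) atTop atTop

theorem IsChaotic.isNonresonant (h : IsChaotic n q) {θ : ℕ → ℝ}
    (hθ : ∀ ν, (θ ν : Real.Angle) ∈ resonanceSet fun j => (q ν j : Real.Angle)) : IsNonresonant n θ := by
  refine tendsto_atTop_mono (fun ν => ?_) h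
  refine mul_le_mul_of_nonneg_left ?_ (Nat.cast_nonneg _)
  have := Metric.infDist_le_dist_of_mem (x := (0 : Real.Angle)) (hθ ν)
  rwa [dist_zero_left] at this

/-- For `m = 0` the resonance set is empty and `Metric.infDist` takes its default value 0, which
excludes divergence. -/
theorem IsChaotic.nonempty (h : IsChaotic n q) : Nonempty (Fin m) := by
  by_contra hm
  have hm' : IsEmpty (Fin m) := not_nonempty_iff.1 hm
  have h0 : ∀ ν, (n ν : ℝ) * chaoticity (fun j => (q ν j : Real.Angle)) = 0 := by
    intro ν
    have : resonanceSet (fun j => (q ν j : Real.Angle)) = ∅ := by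
      ext a
      simp [resonanceSet]
    rw [chaoticity, this, Metric.infDist_empty, mul_zero]
  unfold IsChaotic at h
  simp only [h0] at h
  exact not_tendsto_const_atTop _ _ h

theorem IsChaotic.four (h : IsChaotic n q) (i j k l : Fin m) :
    IsNonresonant n fun ν => q ν i + q ν j + q ν k + q ν l :=
  h.isNonresonant fun ν => Or.inl (Or.inl ⟨i, j, k, l, by simp only [Real.Angle.coe_add]⟩)

theorem IsChaotic.three (h : IsChaotic n q) (i j k l : Fin m) :
    IsNonresonant n fun ν => q ν i + q ν j + q ν k - q ν l :=
  h.isNonresonant fun ν => Or.inr ⟨i, j, k, l, by simp only [Real.Angle.coe_add, Real.Angle.coe_sub]⟩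

theorem IsChaotic.two (h : IsChaotic n q) {i j k l : Fin m} (h1 : i ≠ k) (h2 : i ≠ l) (h3 : j ≠ k)
    (h4 : j ≠ l) : IsNonresonant n fun ν => q ν i + q ν j - q ν k - q ν l :=
  h.isNonresonant fun ν => Or.inl (Or.inr ⟨i, j, k, l, h1, h2, h3, h4, by
    simp only [Real.Angle.coe_add, Real.Angle.coe_sub]⟩)

/-- Distances on the circle are at most `π`, so only the lengths can diverge. -/
theorem IsChaotic.tendsto_length (h : IsChaotic n q) : Tendsto n atTop atTop := by
  obtain ⟨i⟩ := h.nonempty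
  have h1 : Tendsto (fun ν => (n ν : ℝ) * Real.pi) atTop atTop :=
    tendsto_atTop_mono (fun ν => mul_le_mul_of_nonneg_left (norm_angle_le_pi _) (Nat.cast_nonneg _))
      (h.four i i i i)
  have h2 := h1.atTop_mul_const (inv_pos.2 Real.pi_pos)
  refine tendsto_natCast_atTop_iff.1 (h2.congr fun ν => ?_)
  field_simp

/-- Twice the difference is in the resonance set, and doubling at most doubles the distance from 0.
The sum of two angles is treated in the same way below. -/
theorem IsChaotic.difference (h : IsChaotic n q) {i j : Fin m} (hij : i ≠ j) :
    IsNonresonant n fun ν => q ν i - q ν j := by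
  have h1 := (h.two hij hij hij hij).atTop_mul_const (show (0 : ℝ) < 1 / 2 by norm_num)
  refine tendsto_atTop_mono (fun ν => ?_) h1
  rw [mul_assoc]
  refine mul_le_mul_of_nonneg_left ?_ (Nat.cast_nonneg _)
  have e : ((q ν i + q ν i - q ν j - q ν j : ℝ) : Real.Angle) =
      ((q ν i - q ν j : ℝ) : Real.Angle) + ((q ν i - q ν j : ℝ) : Real.Angle) := by
    rw [← Real.Angle.coe_add]
    congr 1
    ring
  rw [e]
  have := norm_add_le ((q ν i - q ν j : ℝ) : Real.Angle) ((q ν i - q ν j : ℝ) : Real.Angle)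
  linarith

theorem IsChaotic.sum (h : IsChaotic n q) (i j : Fin m) : IsNonresonant n fun ν => q ν i + q ν j := by
  have h1 := (h.four i i j j).atTop_mul_const (show (0 : ℝ) < 1 / 2 by norm_num)
  refine tendsto_atTop_mono (fun ν => ?_) h1
  rw [mul_assoc]
  refine mul_le_mul_of_nonneg_left ?_ (Nat.cast_nonneg _)
  have e : ((q ν i + q ν i + q ν j + q ν j : ℝ) : Real.Angle) =
      ((q ν i + q ν j : ℝ) : Real.Angle) + ((q ν i + q ν j : ℝ) : Real.Angle) := by
    rw [← Real.Angle.coe_add]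
    congr 1
    ring
  rw [e]
  have := norm_add_le ((q ν i + q ν j : ℝ) : Real.Angle) ((q ν i + q ν j : ℝ) : Real.Angle)
  linarith

/-- If the two pairs share an index it cancels, and a difference of two distinct angles remains;
otherwise the combination is itself in the resonance set. -/
theorem IsChaotic.pairs (h : IsChaotic n q) {i j k l : Fin m}
    (hne : ¬ ((i = k ∧ j = l) ∨ (i = l ∧ j = k))) :
    IsNonresonant n fun ν => q ν i + q ν j - q ν k - q ν l := by
  by_cases h1 : i = k
  · subst h1
    have h2 : j ≠ l := fun h => hne (Or.inl ⟨rfl, h⟩)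
    refine (h.difference h2).of_eq fun ν => ?_
    ring
  by_cases h2 : i = l
  · subst h2
    have h3 : j ≠ k := fun h => hne (Or.inr ⟨rfl, h⟩)
    refine (h.difference h3).of_eq fun ν => ?_
    ring
  by_cases h3 : j = k
  · subst h3
    refine (h.difference h2).of_eq fun ν => ?_
    ring
  by_cases h4 : j = l
  · subst h4
    refine (h.difference h1).of_eq fun ν => ?_
    ring
  exact h.two h1 h2 h3 h4

end Resonances

/-! ### Limiting covariances of the noise coefficients -/

section BrownianCoefficients

variable {m : ℕ}

/-- Indices of the entries of the pair `(A, B)`. -/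
abbrev NoiseIndex (m : ℕ) : Type := (Fin m × Fin m) ⊕ (Fin m × Fin m)

/-- The phase advance of an entry of the noise. -/
def noisePhase (q : Fin m → ℝ) : NoiseIndex m → ℝ :=
  Sum.elim (fun p => q p.1 - q p.2) (fun p => q p.1 + q p.2)

/-- The weight with which a vertex of the base contributes to an entry of the noise. -/
def noiseWeight (O : Matrix (Fin m) (Fin m) ℝ) (a : Fin m) : NoiseIndex m → ℝ :=
  Sum.elim (fun p => O a p.1 * O a p.2) (fun p => O a p.1 * O a p.2)

/-- The coefficients of the noise in the entries of `(A, B)`. -/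
def noiseCoeff (O : Matrix (Fin m) (Fin m) ℝ) (q : Fin m → ℝ) (n k : ℕ) (a : Fin m) :
    NoiseIndex m → ℂ := fun J =>
  ((√(n : ℝ))⁻¹ : ℝ) * (Complex.exp (Complex.I * noisePhase q J) ^ (k + 1) * noiseWeight O a J)

/-- The covariances of the entries of `(A, B)`. -/
def covTable (O : Matrix (Fin m) (Fin m) ℝ) : NoiseIndex m → NoiseIndex m → ℝ
  | .inl p, .inl p' => if p.1 = p'.1 ∧ p.2 = p'.2 then eigenvectorOverlap O p.1 p.2
      else if p.1 = p.2 ∧ p'.1 = p'.2 then eigenvectorOverlap O p.1 p'.1 else 0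
  | .inr p, .inr p' => if (p.1 = p'.1 ∧ p.2 = p'.2) ∨ (p.1 = p'.2 ∧ p.2 = p'.1) then
      eigenvectorOverlap O p.1 p.2 else 0
  | _, _ => 0

/-- The pseudo-covariances of the entries of `(A, B)`. -/
def pseudoCovTable (O : Matrix (Fin m) (Fin m) ℝ) : NoiseIndex m → NoiseIndex m → ℝ
  | .inl p, .inl p' => covTable O (.inl p) (.inl p'.swap)
  | _, _ => 0

variable {n : ℕ → ℕ} {q : ℕ → Fin m → ℝ}

theorem sum_noiseWeight_mul (O : Matrix (Fin m) (Fin m) ℝ) (J J' : NoiseIndex m) (i j k l : Fin m)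
    (hJ : J = .inl (i, j) ∨ J = .inr (i, j)) (hJ' : J' = .inl (k, l) ∨ J' = .inr (k, l)) :
    ∑ a, noiseWeight O a J * noiseWeight O a J' = ∑ a, O a i * O a j * (O a k * O a l) := by
  rcases hJ with rfl | rfl <;> rcases hJ' with rfl | rfl <;> rfl

theorem inv_sqrt_mul_self (n : ℕ) : (((√(n : ℝ))⁻¹ : ℝ) : ℂ) * (((√(n : ℝ))⁻¹ : ℝ) : ℂ) = (n : ℂ)⁻¹ := by
  rw [← Complex.ofReal_mul, ← mul_inv, Real.mul_self_sqrt (Nat.cast_nonneg n)]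
  push_cast
  rfl

theorem conj_exp_I_mul (θ : ℝ) :
    (starRingEnd ℂ) (Complex.exp (Complex.I * θ)) = Complex.exp (Complex.I * (-θ : ℝ)) := by
  rw [← Complex.exp_conj]
  simp

theorem noiseCoeff_mul (O : Matrix (Fin m) (Fin m) ℝ) (q : Fin m → ℝ) (n k : ℕ) (J J' : NoiseIndex m) :
    ∑ a, noiseCoeff O q n k a J * noiseCoeff O q n k a J' = (n : ℂ)⁻¹ *
      Complex.exp (Complex.I * (noisePhase q J + noisePhase q J' : ℝ)) ^ (k + 1) *
      (∑ a, noiseWeight O a J * noiseWeight O a J' : ℝ) := by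
  rw [Complex.ofReal_add, mul_add Complex.I, Complex.exp_add, ← inv_sqrt_mul_self, Complex.ofReal_sum,
    Finset.mul_sum]
  refine Finset.sum_congr rfl fun a _ => ?_
  simp only [noiseCoeff]
  push_cast
  ring

/-- The products of coefficients separate into a rotating phase and a weight independent of the
slice, so their sums over slices are averages of a single phase. -/
theorem noiseCoeff_mul_conj (O : Matrix (Fin m) (Fin m) ℝ) (q : Fin m → ℝ) (n k : ℕ) (J J' : NoiseIndex m) :
    ∑ a, noiseCoeff O q n k a J * (starRingEnd ℂ) (noiseCoeff O q n k a J') = (n : ℂ)⁻¹ *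
      Complex.exp (Complex.I * (noisePhase q J - noisePhase q J' : ℝ)) ^ (k + 1) *
      (∑ a, noiseWeight O a J * noiseWeight O a J' : ℝ) := by
  rw [sub_eq_add_neg, Complex.ofReal_add, mul_add Complex.I, Complex.exp_add, ← inv_sqrt_mul_self,
    Complex.ofReal_sum, Finset.mul_sum]
  refine Finset.sum_congr rfl fun a _ => ?_
  simp only [noiseCoeff, map_mul, map_pow, Complex.conj_ofReal, conj_exp_I_mul]
  push_cast
  ring

theorem tendsto_sum_of_phase (hn : Tendsto n atTop atTop) {θ : ℕ → ℝ} {b : Prop} [Decidable b]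
    (h0 : b → ∀ ν, θ ν = 0) (h1 : ¬ b → IsNonresonant n θ) (t : unitInterval) (w : ℝ) {c : ℝ}
    (hc : (if b then w else 0) = c) {f : ℕ → ℕ → ℂ}
    (hf : ∀ ν k, f ν k = (n ν : ℂ)⁻¹ * Complex.exp (Complex.I * θ ν) ^ (k + 1) * w) :
    Tendsto (fun ν => ∑ k ∈ Finset.range ⌊(n ν : ℝ) * t⌋₊, f ν k) atTop (𝓝 ((t * c : ℝ) : ℂ)) := by
  simp only [hf, ← hc]
  exact tendsto_average_phase hn h0 h1 t w

theorem sum_sq_eq_eigenvectorOverlap (O : Matrix (Fin m) (Fin m) ℝ) (i j : Fin m) :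
    ∑ a, O a i * O a j * (O a i * O a j) = eigenvectorOverlap O i j :=
  Finset.sum_congr rfl fun a _ => by ring

theorem sum_sq_eq_eigenvectorOverlap' (O : Matrix (Fin m) (Fin m) ℝ) (i j : Fin m) :
    ∑ a, O a i * O a i * (O a j * O a j) = eigenvectorOverlap O i j :=
  Finset.sum_congr rfl fun a _ => by ring

theorem sum_sq_eq_eigenvectorOverlap'' (O : Matrix (Fin m) (Fin m) ℝ) (i j : Fin m) :
    ∑ a, O a i * O a j * (O a j * O a i) = eigenvectorOverlap O i j :=
  Finset.sum_congr rfl fun a _ => by ring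

/-- For two entries of `A`, and for two entries of `B`, the phase has two plus and two minus signs:
it vanishes identically when the indices pair up and is nonresonant otherwise. Between an entry of
`A` and one of `B` three signs stand against one, and no cancellation is possible. -/
theorem tendsto_noiseCoeff_conj (h : IsChaotic n q) (O : Matrix (Fin m) (Fin m) ℝ)
    (J J' : NoiseIndex m) (t : unitInterval) :
    Tendsto (fun ν => ∑ k ∈ Finset.range ⌊(n ν : ℝ) * t⌋₊,
      ∑ a, noiseCoeff O (q ν) (n ν) k a J * (starRingEnd ℂ) (noiseCoeff O (q ν) (n ν) k a J')) atTop
      (𝓝 ((t * covTable O J J' : ℝ) : ℂ)) := by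
  have hn := h.tendsto_length
  rcases J with ⟨i, j⟩ | ⟨i, j⟩ <;> rcases J' with ⟨k, l⟩ | ⟨k, l⟩
  · refine tendsto_sum_of_phase hn (b := (i = j ∧ l = k) ∨ (i = k ∧ l = j))
      (θ := fun ν => noisePhase (q ν) (.inl (i, j)) - noisePhase (q ν) (.inl (k, l))) ?_ ?_ t _ ?_
      fun ν k => noiseCoeff_mul_conj _ _ _ _ _ _
    · rintro (⟨rfl, rfl⟩ | ⟨rfl, rfl⟩) ν <;> simp [noisePhase]
    · intro hb
      refine (h.pairs (i := i) (j := l) (k := j) (l := k) hb).of_eq fun ν => ?_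
      simp only [noisePhase, Sum.elim_inl]
      ring
    · rw [sum_noiseWeight_mul O _ _ i j k l (Or.inl rfl) (Or.inl rfl)]
      simp only [covTable]
      split_ifs with h1 h2 h3 h4 h5
      · obtain ⟨rfl, rfl⟩ := h2
        exact sum_sq_eq_eigenvectorOverlap O i j
      · obtain ⟨rfl, rfl⟩ := h3
        exact sum_sq_eq_eigenvectorOverlap' O i k
      · exact absurd h1 (by tauto)
      · exact absurd (Or.inr ⟨h4.1, h4.2.symm⟩) h1
      · exact absurd (Or.inl ⟨h5.1, h5.2.symm⟩) h1
      · rfl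
  · refine tendsto_sum_of_phase hn (b := False)
      (θ := fun ν => noisePhase (q ν) (.inl (i, j)) - noisePhase (q ν) (.inr (k, l))) False.elim ?_ t _ ?_
      fun ν k => noiseCoeff_mul_conj _ _ _ _ _ _
    · intro _
      refine (h.three j k l i).neg.of_eq fun ν => ?_
      simp only [noisePhase, Sum.elim_inl, Sum.elim_inr]
      ring
    · rw [if_neg not_false]; rfl
  · refine tendsto_sum_of_phase hn (b := False)
      (θ := fun ν => noisePhase (q ν) (.inr (i, j)) - noisePhase (q ν) (.inl (k, l))) False.elim ?_ t _ ?_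
      fun ν k => noiseCoeff_mul_conj _ _ _ _ _ _
    · intro _
      refine (h.three i j l k).of_eq fun ν => ?_
      simp only [noisePhase, Sum.elim_inl, Sum.elim_inr]
      ring
    · rw [if_neg not_false]; rfl
  · refine tendsto_sum_of_phase hn (b := (i = k ∧ j = l) ∨ (i = l ∧ j = k))
      (θ := fun ν => noisePhase (q ν) (.inr (i, j)) - noisePhase (q ν) (.inr (k, l))) ?_ ?_ t _ ?_
      fun ν k => noiseCoeff_mul_conj _ _ _ _ _ _
    · rintro (⟨rfl, rfl⟩ | ⟨rfl, rfl⟩) ν <;> simp [noisePhase, add_comm]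
    · intro hb
      refine (h.pairs hb).of_eq fun ν => ?_
      simp only [noisePhase, Sum.elim_inr]
      ring
    · rw [sum_noiseWeight_mul O _ _ i j k l (Or.inr rfl) (Or.inr rfl)]
      simp only [covTable]
      split_ifs with h1
      · rcases h1 with ⟨rfl, rfl⟩ | ⟨rfl, rfl⟩
        · exact sum_sq_eq_eigenvectorOverlap O i j
        · exact sum_sq_eq_eigenvectorOverlap'' O i j
      · rfl

theorem noiseCoeff_inl_swap (O : Matrix (Fin m) (Fin m) ℝ) (q : Fin m → ℝ) (n k : ℕ) (a i j : Fin m) :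
    noiseCoeff O q n k a (.inl (i, j)) = (starRingEnd ℂ) (noiseCoeff O q n k a (.inl (j, i))) := by
  simp only [noiseCoeff, map_mul, map_pow, Complex.conj_ofReal, conj_exp_I_mul, noisePhase, noiseWeight,
    Sum.elim_inl, neg_sub]
  rw [mul_comm (O a i)]

/-- Without conjugation, two entries of `A` reduce to the previous case because transposing indices
conjugates the coefficient. Two entries of `B` give a sum of four angles, which is nonresonant. -/
theorem tendsto_noiseCoeff (h : IsChaotic n q) (O : Matrix (Fin m) (Fin m) ℝ)
    (J J' : NoiseIndex m) (t : unitInterval) :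
    Tendsto (fun ν => ∑ k ∈ Finset.range ⌊(n ν : ℝ) * t⌋₊,
      ∑ a, noiseCoeff O (q ν) (n ν) k a J * noiseCoeff O (q ν) (n ν) k a J') atTop
      (𝓝 ((t * pseudoCovTable O J J' : ℝ) : ℂ)) := by
  have hn := h.tendsto_length
  rcases J with ⟨i, j⟩ | ⟨i, j⟩ <;> rcases J' with ⟨k, l⟩ | ⟨k, l⟩
  · simp only [noiseCoeff_inl_swap O _ _ _ _ k l]
    exact tendsto_noiseCoeff_conj h O (.inl (i, j)) (.inl (l, k)) t
  · refine tendsto_sum_of_phase hn (b := False)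
      (θ := fun ν => noisePhase (q ν) (.inl (i, j)) + noisePhase (q ν) (.inr (k, l))) False.elim ?_ t _ ?_
      fun ν k => noiseCoeff_mul _ _ _ _ _ _
    · intro _
      refine (h.three i k l j).of_eq fun ν => ?_
      simp only [noisePhase, Sum.elim_inl, Sum.elim_inr]
      ring
    · rw [if_neg not_false]; rfl
  · refine tendsto_sum_of_phase hn (b := False)
      (θ := fun ν => noisePhase (q ν) (.inr (i, j)) + noisePhase (q ν) (.inl (k, l))) False.elim ?_ t _ ?_
      fun ν k => noiseCoeff_mul _ _ _ _ _ _
    · intro _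
      refine (h.three i j k l).of_eq fun ν => ?_
      simp only [noisePhase, Sum.elim_inl, Sum.elim_inr]
      ring
    · rw [if_neg not_false]; rfl
  · refine tendsto_sum_of_phase hn (b := False)
      (θ := fun ν => noisePhase (q ν) (.inr (i, j)) + noisePhase (q ν) (.inr (k, l))) False.elim ?_ t _ ?_
      fun ν k => noiseCoeff_mul _ _ _ _ _ _
    · intro _
      refine (h.four i j k l).of_eq fun ν => ?_
      simp only [noisePhase, Sum.elim_inr]
      ring
    · rw [if_neg not_false]; rfl

/-- The complex coefficients of a real linear functional. -/
def functionalCoeff {J : Type*} [Fintype J] [DecidableEq J] (L : (J → ℂ) →L[ℝ] ℝ) (j : J) : ℂ :=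
  L (Pi.single j 1) - L (Pi.single j Complex.I) * Complex.I

theorem functional_eq {J : Type*} [Fintype J] [DecidableEq J] (L : (J → ℂ) →L[ℝ] ℝ) (x : J → ℂ) :
    L x = (∑ j, functionalCoeff L j * x j).re := by
  conv_lhs => rw [← Finset.univ_sum_single x, map_sum]
  rw [Complex.re_sum]
  refine Finset.sum_congr rfl fun j _ => ?_
  have h1 : (Pi.single j (x j) : J → ℂ) = (x j).re • (Pi.single j 1 : J → ℂ) +
      (x j).im • (Pi.single j Complex.I : J → ℂ) := by
    rw [← Pi.single_smul, ← Pi.single_smul, ← Pi.single_add]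
    congr 1
    rw [Complex.real_smul, Complex.real_smul, mul_one, Complex.re_add_im]
  rw [h1, map_add, map_smul, map_smul, functionalCoeff]
  simp
  ring

/-- The covariance form of the pair `(A, B)`. -/
def covForm (O : Matrix (Fin m) (Fin m) ℝ) (L L' : (NoiseIndex m → ℂ) →L[ℝ] ℝ) : ℝ :=
  (1 / 2) * (∑ J, ∑ J', (functionalCoeff L J * functionalCoeff L' J' * pseudoCovTable O J J' +
    functionalCoeff L J * (starRingEnd ℂ) (functionalCoeff L' J') * covTable O J J')).re

/-- Since `Re u * Re w = Re (u w + u w̄) / 2`, all covariances of real functionals are determined by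
the complex covariances and pseudo-covariances of the entries. -/
theorem functional_mul {J : Type*} [Fintype J] [DecidableEq J] (L L' : (J → ℂ) →L[ℝ] ℝ) (x x' : J → ℂ) :
    L x * L' x' = (1 / 2) * (∑ j, ∑ j', (functionalCoeff L j * functionalCoeff L' j' * (x j * x' j') +
      functionalCoeff L j * (starRingEnd ℂ) (functionalCoeff L' j') * (x j * (starRingEnd ℂ) (x' j')))).re := by
  have h1 : ∀ u w : ℂ, u.re * w.re = (1 / 2) * (u * w + u * (starRingEnd ℂ) w).re := by
    intro u w
    simp
    ring
  rw [functional_eq L, functional_eq L', h1, map_sum, Finset.sum_mul_sum, Finset.sum_mul_sum,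
    ← Finset.sum_add_distrib]
  congr 2
  refine Finset.sum_congr rfl fun j _ => ?_
  rw [← Finset.sum_add_distrib]
  refine Finset.sum_congr rfl fun j' _ => ?_
  rw [map_mul]
  ring

theorem norm_noiseCoeff_le (O : Matrix (Fin m) (Fin m) ℝ) (q : Fin m → ℝ) (n k : ℕ) (a : Fin m) :
    ‖noiseCoeff O q n k a‖ ≤ (∑ a, ∑ J, |noiseWeight O a J|) * (√(n : ℝ))⁻¹ := by
  refine (pi_norm_le_iff_of_nonneg (by positivity)).2 fun J => ?_
  rw [noiseCoeff, norm_mul, norm_mul, norm_pow, norm_exp_I_mul, one_pow, one_mul, Complex.norm_real,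
    Complex.norm_real, Real.norm_of_nonneg (by positivity), mul_comm]
  refine mul_le_mul_of_nonneg_right ?_ (by positivity)
  exact (Finset.single_le_sum (f := fun J => |noiseWeight O a J|) (fun _ _ => abs_nonneg _)
    (Finset.mem_univ J)).trans (Finset.single_le_sum (f := fun a => ∑ J, |noiseWeight O a J|)
      (fun _ _ => Finset.sum_nonneg fun _ _ => abs_nonneg _) (Finset.mem_univ a))

theorem hasBrownianCoefficients (h : IsChaotic n q) (O : Matrix (Fin m) (Fin m) ℝ) :
    HasBrownianCoefficients n (fun ν k a => noiseCoeff O (q ν) (n ν) k a)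
      (∑ a, ∑ J, |noiseWeight O a J|) (covForm O) where
  nonneg := by positivity
  norm_le ν k a := norm_noiseCoeff_le O (q ν) (n ν) k a
  tendsto L L' t := by
    have h1 := fun J J' => ((tendsto_noiseCoeff h O J J' t).const_mul
      (functionalCoeff L J * functionalCoeff L' J')).add
      ((tendsto_noiseCoeff_conj h O J J' t).const_mul
        (functionalCoeff L J * (starRingEnd ℂ) (functionalCoeff L' J')))
    have h2 := (tendsto_finsetSum Finset.univ fun J _ => tendsto_finsetSum Finset.univ fun J' _ => h1 J J')
    have h3 := ((Complex.continuous_re.tendsto _).comp h2).const_mul (1 / 2 : ℝ)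
    have e : (t : ℝ) * covForm O L L' = 1 / 2 * (∑ J, ∑ J', (functionalCoeff L J * functionalCoeff L' J' *
        ((t * pseudoCovTable O J J' : ℝ) : ℂ) + functionalCoeff L J * (starRingEnd ℂ) (functionalCoeff L' J') *
        ((t * covTable O J J' : ℝ) : ℂ))).re := by
      rw [covForm, mul_left_comm, ← Complex.re_ofReal_mul, Finset.mul_sum]
      congr 2
      refine Finset.sum_congr rfl fun J _ => ?_
      rw [Finset.mul_sum]
      refine Finset.sum_congr rfl fun J' _ => ?_
      push_cast
      ring
    rw [e]
    refine h3.congr fun ν => ?_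
    simp only [Function.comp_apply, functional_mul L L']
    simp only [← Finset.mul_sum, ← Complex.re_sum]
    congr 2
    symm
    calc _ = ∑ k ∈ Finset.range ⌊(n ν : ℝ) * t⌋₊, ∑ J, ∑ a, ∑ J', _ :=
          Finset.sum_congr rfl fun k _ => Finset.sum_comm
      _ = ∑ J, ∑ k ∈ Finset.range ⌊(n ν : ℝ) * t⌋₊, ∑ a, ∑ J', _ := Finset.sum_comm
      _ = ∑ J, ∑ J', ∑ k ∈ Finset.range ⌊(n ν : ℝ) * t⌋₊, ∑ a, _ := by
          refine Finset.sum_congr rfl fun J _ => ?_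
          rw [Finset.sum_congr rfl fun k _ => Finset.sum_comm, Finset.sum_comm]
      _ = _ := by
          refine Finset.sum_congr rfl fun J _ => Finset.sum_congr rfl fun J' _ => ?_
          simp only [Finset.sum_add_distrib, Finset.mul_sum]

/-! ### The driving Brownian motions as one vector-valued process -/

section Driving

variable {Ω' : Type*} [MeasurableSpace Ω'] {P' : Measure Ω'} [IsProbabilityMeasure P']
  {O : Matrix (Fin m) (Fin m) ℝ} {A B : unitInterval → Ω' → Matrix (Fin m) (Fin m) ℂ}

/-- The entries of a pair of matrices as one vector. -/
def joinEntries (a b : Matrix (Fin m) (Fin m) ℂ) : NoiseIndex m → ℂ :=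
  Sum.elim (fun p => a p.1 p.2) (fun p => b p.1 p.2)

theorem IsDrivingBrownianMotion.cov_conj (hAB : IsDrivingBrownianMotion O A B P') (s t : unitInterval)
    (J J' : NoiseIndex m) : ∫ ω, joinEntries (A s ω) (B s ω) J *
      (starRingEnd ℂ) (joinEntries (A t ω) (B t ω) J') ∂P' = ((min (s : ℝ) t * covTable O J J' : ℝ) : ℂ) := by
  rcases J with ⟨i, j⟩ | ⟨i, j⟩ <;> rcases J' with ⟨k, l⟩ | ⟨k, l⟩ <;>
    simp only [joinEntries, Sum.elim_inl, Sum.elim_inr, covTable]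
  · exact hAB.cov_A s t i j k l
  · rw [mul_zero, Complex.ofReal_zero]
    exact hAB.cov_AB s t i j k l
  · rw [mul_zero, Complex.ofReal_zero]
    have h := congrArg (starRingEnd ℂ) (hAB.cov_AB t s k l i j)
    rw [← integral_conj, map_zero] at h
    rw [← h]
    refine integral_congr_ae (ae_of_all _ fun ω => ?_)
    simp only [map_mul, Complex.conj_conj]
    ring
  · exact hAB.cov_B s t i j k l

/-- As `A` is Hermitian, conjugating one of its entries transposes the indices. The moments without
conjugation that involve `A` therefore reduce to conjugated ones. -/
theorem IsDrivingBrownianMotion.pseudoCov (hAB : IsDrivingBrownianMotion O A B P') (s t : unitInterval)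
    (J J' : NoiseIndex m) : ∫ ω, joinEntries (A s ω) (B s ω) J *
      joinEntries (A t ω) (B t ω) J' ∂P' = ((min (s : ℝ) t * pseudoCovTable O J J' : ℝ) : ℂ) := by
  have hswap : ∀ᵐ ω ∂P', ∀ t i j, A t ω i j = (starRingEnd ℂ) (A t ω j i) := by
    filter_upwards [hAB.hermitian] with ω hω t i j
    exact ((hω t).apply i j).symm
  have hmix : ∀ (s t : unitInterval) (i j k l : Fin m), ∫ ω, A s ω i j * B t ω k l ∂P' = 0 := by
    intro s t i j k l
    have h := congrArg (starRingEnd ℂ) (hAB.cov_AB s t j i k l)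
    rw [← integral_conj, map_zero] at h
    rw [← h]
    refine integral_congr_ae (hswap.mono fun ω hω => ?_)
    simp only [map_mul, Complex.conj_conj, ← hω]
  rcases J with ⟨i, j⟩ | ⟨i, j⟩ <;> rcases J' with ⟨k, l⟩ | ⟨k, l⟩
  · refine Eq.trans ?_ (hAB.cov_conj s t (.inl (i, j)) (.inl (l, k)))
    refine integral_congr_ae (hswap.mono fun ω hω => ?_)
    simp only [joinEntries, Sum.elim_inl, ← hω]
  · simp only [joinEntries, Sum.elim_inl, Sum.elim_inr, pseudoCovTable]
    rw [mul_zero, Complex.ofReal_zero]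
    exact hmix s t i j k l
  · simp only [joinEntries, Sum.elim_inl, Sum.elim_inr, pseudoCovTable]
    rw [mul_zero, Complex.ofReal_zero]
    simp only [mul_comm]
    exact hmix t s k l i j
  · simp only [joinEntries, Sum.elim_inr, pseudoCovTable]
    rw [mul_zero, Complex.ofReal_zero]
    exact hAB.pseudoCov_B s t i j k l

theorem IsDrivingBrownianMotion.isBrownian (hAB : IsDrivingBrownianMotion O A B P') :
    IsBrownian (fun t ω => joinEntries (A t ω) (B t ω)) P' (covForm O) := by
  set J := NoiseIndex m with hJ
  set T : ((Fin m → Fin m → ℂ) × (Fin m → Fin m → ℂ)) →L[ℝ] (J → ℂ) :=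
    ContinuousLinearMap.pi (Sum.elim
      (fun p => ((ContinuousLinearMap.proj p.2).comp (ContinuousLinearMap.proj p.1)).comp
        (ContinuousLinearMap.fst ℝ (Fin m → Fin m → ℂ) (Fin m → Fin m → ℂ)))
      (fun p => ((ContinuousLinearMap.proj p.2).comp (ContinuousLinearMap.proj p.1)).comp
        (ContinuousLinearMap.snd ℝ (Fin m → Fin m → ℂ) (Fin m → Fin m → ℂ)))) with hT
  have hG : IsGaussianProcess (fun t ω => joinEntries (A t ω) (B t ω)) P' := by
    refine (hAB.gaussian.comp_left fun _ => T).congr fun t => ae_of_all _ fun ω => ?_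
    funext p
    rcases p with p | p <;> rfl
  have hL2 : ∀ t p, MemLp (fun ω => joinEntries (A t ω) (B t ω) p) 2 P' := fun t p =>
    ((hG.hasGaussianLaw_eval t).map_fun
      (ContinuousLinearMap.proj p : (J → ℂ) →L[ℝ] ℂ)).memLp_two
  have hL2c : ∀ t p, MemLp (fun ω => (starRingEnd ℂ) (joinEntries (A t ω) (B t ω) p)) 2 P' := fun t p =>
    (Complex.conjCLE : ℂ →L[ℝ] ℂ).comp_memLp' (hL2 t p)
  have hmean : ∀ t p, ∫ ω, joinEntries (A t ω) (B t ω) p ∂P' = 0 := by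
    rintro t (⟨i, j⟩ | ⟨i, j⟩)
    · exact hAB.mean_A t i j
    · exact hAB.mean_B t i j
  refine ⟨hG, ?_, fun t L => ?_, fun s t L L' => ?_⟩
  · filter_upwards [hAB.continuous_paths] with ω hω
    refine continuous_pi fun p => ?_
    rcases p with ⟨i, j⟩ | ⟨i, j⟩
    · exact hω.1.matrix_elem i j
    · exact hω.2.matrix_elem i j
  · have h1 : ∀ ω, L (joinEntries (A t ω) (B t ω)) = (∑ p, functionalCoeff L p *
        joinEntries (A t ω) (B t ω) p).re := fun ω => functional_eq L _
    have hint : ∀ p ∈ Finset.univ, Integrable (fun ω => functionalCoeff L p * joinEntries (A t ω) (B t ω) p) P' :=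
      fun p _ => ((hL2 t p).integrable (by norm_num)).const_mul _
    simp only [h1]
    have h2 := integral_re (𝕜 := ℂ) (integrable_finsetSum Finset.univ hint)
    simp only [RCLike.re_to_complex] at h2
    rw [h2, integral_finsetSum _ hint]
    simp only [integral_const_mul, hmean, mul_zero, Finset.sum_const_zero, Complex.zero_re]
  · have h1 : ∀ ω, L (joinEntries (A s ω) (B s ω)) * L' (joinEntries (A t ω) (B t ω)) = _ :=
      fun ω => functional_mul L L' _ _
    simp only [h1]
    have hi1 : ∀ p p', Integrable (fun ω => functionalCoeff L p * functionalCoeff L' p' *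
        (joinEntries (A s ω) (B s ω) p * joinEntries (A t ω) (B t ω) p')) P' := fun p p' =>
      ((hL2 s p).integrable_mul (hL2 t p')).const_mul _
    have hi2 : ∀ p p', Integrable (fun ω => functionalCoeff L p * (starRingEnd ℂ) (functionalCoeff L' p') *
        (joinEntries (A s ω) (B s ω) p * (starRingEnd ℂ) (joinEntries (A t ω) (B t ω) p'))) P' := fun p p' =>
      ((hL2 s p).integrable_mul (hL2c t p')).const_mul _
    have hi3 : ∀ p, Integrable (fun ω => ∑ p', (functionalCoeff L p * functionalCoeff L' p' *
        (joinEntries (A s ω) (B s ω) p * joinEntries (A t ω) (B t ω) p') +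
        functionalCoeff L p * (starRingEnd ℂ) (functionalCoeff L' p') *
        (joinEntries (A s ω) (B s ω) p * (starRingEnd ℂ) (joinEntries (A t ω) (B t ω) p')))) P' := fun p =>
      integrable_finsetSum _ fun p' _ => (hi1 p p').add (hi2 p p')
    have h2 := integral_re (𝕜 := ℂ) (integrable_finsetSum Finset.univ fun p _ => hi3 p)
    simp only [RCLike.re_to_complex] at h2
    rw [integral_const_mul, h2, integral_finsetSum _ fun p _ => hi3 p, covForm, mul_left_comm,
      ← Complex.re_ofReal_mul (min (s : ℝ) t), Finset.mul_sum]
    congr 2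
    refine Finset.sum_congr rfl fun p _ => ?_
    have hi12 : ∀ p', Integrable (fun ω => functionalCoeff L p * functionalCoeff L' p' *
        (joinEntries (A s ω) (B s ω) p * joinEntries (A t ω) (B t ω) p') +
        functionalCoeff L p * (starRingEnd ℂ) (functionalCoeff L' p') *
        (joinEntries (A s ω) (B s ω) p * (starRingEnd ℂ) (joinEntries (A t ω) (B t ω) p'))) P' :=
      fun p' => (hi1 p p').add (hi2 p p')
    rw [integral_finsetSum _ fun p' _ => hi12 p', Finset.mul_sum]
    refine Finset.sum_congr rfl fun p' _ => ?_
    rw [integral_add (hi1 p p') (hi2 p p'), integral_const_mul, integral_const_mul, hAB.pseudoCov,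
      hAB.cov_conj]
    push_cast
    ring

end Driving

end BrownianCoefficients

/-! ### The evolution as a perturbation of the noise -/

section Blocks

open scoped ComplexConjugate

variable {m : ℕ}

/-- The entry of `(A, B)` that governs an entry of the block matrix `[[A, B], [-B̄, -Ā]]`. -/
def entryIndex : Fin m ⊕ Fin m → Fin m ⊕ Fin m → NoiseIndex m
  | .inl i, .inl j => .inl (i, j)
  | .inl i, .inr j => .inr (i, j)
  | .inr i, .inl j => .inr (i, j)
  | .inr i, .inr j => .inl (i, j)

/-- Multiplication by `i`, preceded by a conjugation in the lower row. -/
def rowMap : Fin m ⊕ Fin m → ℂ →ₗ[ℝ] ℂ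
  | .inl _ => LinearMap.mulLeft ℝ Complex.I
  | .inr _ => -(LinearMap.mulLeft ℝ Complex.I ∘ₗ Complex.conjAe.toLinearMap)

theorem norm_rowMap (x : Fin m ⊕ Fin m) (c : ℂ) : ‖rowMap x c‖ = ‖c‖ := by
  rcases x with i | i <;> simp [rowMap]

/-- The matrix `i S [[A, B], [-B̄, -Ā]] S` with `S` the real diagonal matrix `diag (s, s)`, as a
linear function of the entries of `(A, B)`. -/
def scaledBlock (s : Fin m → ℝ) : (NoiseIndex m → ℂ) →ₗ[ℝ] Matrix (Fin m ⊕ Fin m) (Fin m ⊕ Fin m) ℂ where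
  toFun p := Matrix.of fun x y =>
    (s (x.elim id id) * s (y.elim id id)) • rowMap x (p (entryIndex x y))
  map_add' p p' := by
    ext x y
    simp
  map_smul' c p := by
    ext x y
    simp only [Matrix.of_apply, Pi.smul_apply, map_smul, RingHom.id_apply, Matrix.smul_apply]
    rw [smul_comm]

theorem scaledBlock_apply (s : Fin m → ℝ) (p : NoiseIndex m → ℂ) (x y : Fin m ⊕ Fin m) :
    scaledBlock s p x y = (s (x.elim id id) * s (y.elim id id)) • rowMap x (p (entryIndex x y)) := rfl

theorem norm_scaledBlock_le {s : Fin m → ℝ} {b : ℝ} (hs : ∀ j, |s j| ≤ b) (p : NoiseIndex m → ℂ)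
    (x y : Fin m ⊕ Fin m) : ‖scaledBlock s p x y‖ ≤ b ^ 2 * ‖p (entryIndex x y)‖ := by
  rw [scaledBlock_apply, norm_smul, norm_rowMap, Real.norm_eq_abs, abs_mul, pow_two]
  gcongr
  · exact (abs_nonneg _).trans (hs (x.elim id id))
  · exact hs _
  · exact hs _

theorem norm_scaledBlock_sub_le {s s' : Fin m → ℝ} {η : ℝ} (hs : ∀ i j, |s i * s j - s' i * s' j| ≤ η)
    (p : NoiseIndex m → ℂ) (x y : Fin m ⊕ Fin m) :
    ‖scaledBlock s p x y - scaledBlock s' p x y‖ ≤ η * ‖p (entryIndex x y)‖ := by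
  rw [scaledBlock_apply, scaledBlock_apply, ← sub_smul, norm_smul, norm_rowMap, Real.norm_eq_abs]
  gcongr
  exact hs _ _

/-- The matrix `diag (s, s)`. -/
def doubledDiagonal (s : Fin m → ℝ) : Matrix (Fin m ⊕ Fin m) (Fin m ⊕ Fin m) ℂ :=
  Matrix.fromBlocks (Matrix.diagonal fun j => (s j : ℂ)) 0 0 (Matrix.diagonal fun j => (s j : ℂ))

theorem sMatrix_eq (e : Fin m → ℝ) : sMatrix e = doubledDiagonal fun j => sEntry (e j) := rfl

/-- In this form the block matrix can be pulled out of noise sums. The conjugates in the lower row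
make it linear over the reals only. -/
theorem noiseBlock_doubledDiagonal (s : Fin m → ℝ) (a b : Matrix (Fin m) (Fin m) ℂ) :
    noiseBlock (doubledDiagonal s) a b = scaledBlock s (joinEntries a b) := by
  rw [noiseBlock, doubledDiagonal]
  simp only [Matrix.fromBlocks_multiply, Matrix.mul_zero, Matrix.zero_mul, add_zero, zero_add]
  ext (i | i) (j | j) <;>
  · simp [scaledBlock_apply, rowMap, joinEntries, entryIndex, Matrix.mul_diagonal, Matrix.diagonal_mul]
    ring

theorem limitMatrix_doubledDiagonal (s : Fin m → ℝ) (a b : Matrix (Fin m) (Fin m) ℂ) (z : ℂ) (t : ℝ) :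
    limitMatrix (doubledDiagonal s) a b z t = scaledBlock s (joinEntries a b) +
      (z * t) • scaledBlock s (joinEntries 1 0) := by
  rw [← noiseBlock_doubledDiagonal, ← noiseBlock_doubledDiagonal, limitMatrix, add_comm]
  congr 1
  rw [noiseBlock, smul_smul]
  congr 1
  · ring
  · rw [doubledDiagonal, pow_two]
    simp only [Matrix.fromBlocks_multiply, Matrix.mul_zero, Matrix.zero_mul, add_zero, zero_add]
    ext (i | i) (j | j) <;> simp [Matrix.one_apply, Matrix.diagonal_apply]

/-- The shape of the matrix, with real and repeated diagonal entries, is preserved by entrywise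
limits. -/
theorem exists_eq_doubledDiagonal {e : ℕ → Fin m → ℝ} {S : Matrix (Fin m ⊕ Fin m) (Fin m ⊕ Fin m) ℂ}
    (hS : Tendsto (fun ν => sMatrix (e ν)) atTop (𝓝 S)) :
    ∃ s : Fin m → ℝ, S = doubledDiagonal s ∧ ∀ j, Tendsto (fun ν => sEntry (e ν j)) atTop (𝓝 (s j)) := by
  have hlim : ∀ x y, Tendsto (fun ν => sMatrix (e ν) x y) atTop (𝓝 (S x y)) := fun x y =>
    tendsto_pi_nhds.1 (tendsto_pi_nhds.1 hS x) y
  have h1 : ∀ j, Tendsto (fun ν => sEntry (e ν j)) atTop (𝓝 (S (.inl j) (.inl j)).re) := by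
    intro j
    refine ((Complex.continuous_re.tendsto _).comp (hlim (.inl j) (.inl j))).congr fun ν => ?_
    simp [sMatrix_eq, doubledDiagonal]
  have h2 : ∀ j, Tendsto (fun ν => (sEntry (e ν j) : ℂ)) atTop (𝓝 ((S (.inl j) (.inl j)).re : ℂ)) :=
    fun j => (Complex.continuous_ofReal.tendsto _).comp (h1 j)
  refine ⟨fun j => (S (.inl j) (.inl j)).re, ?_, h1⟩
  ext x y
  refine tendsto_nhds_unique (hlim x y) ?_
  rcases x with i | i <;> rcases y with j | j <;>
    simp only [sMatrix_eq, doubledDiagonal, Matrix.fromBlocks_apply₁₁, Matrix.fromBlocks_apply₁₂,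
      Matrix.fromBlocks_apply₂₁, Matrix.fromBlocks_apply₂₂, Matrix.diagonal_apply, Matrix.zero_apply]
  · split_ifs
    · exact h2 i
    · exact tendsto_const_nhds
  · exact tendsto_const_nhds
  · exact tendsto_const_nhds
  · split_ifs
    · exact h2 i
    · exact tendsto_const_nhds

end Blocks

/-! ### Coefficients of the one-step recursion -/

section Coefficients

variable {m : ℕ}

/-- The coefficients of a unit energy shift in the entries of `(A, B)`. -/
def driftCoeff (q : Fin m → ℝ) (k : ℕ) : NoiseIndex m → ℂ :=
  Sum.elim (fun p => if p.1 = p.2 then 1 else 0)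
    (fun p => if p.1 = p.2 then Complex.exp (Complex.I * (q p.1 + q p.2 : ℝ)) ^ (k + 1) else 0)

theorem norm_driftCoeff_le (q : Fin m → ℝ) (k : ℕ) (J : NoiseIndex m) : ‖driftCoeff q k J‖ ≤ 1 := by
  rcases J with ⟨i, j⟩ | ⟨i, j⟩ <;> simp only [driftCoeff, Sum.elim_inl, Sum.elim_inr] <;> split_ifs
  · simp
  · simp
  · rw [norm_pow, norm_exp_I_mul, one_pow]
  · simp

/-- In `A` the conjugate phases cancel, so the drift is constant there; in `B` they double, so the
drift rotates and will average out. -/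
theorem joinEntries_drift {e : Fin m → ℝ} (he : ∀ j, |e j| < 2) (k : ℕ) :
    joinEntries (phaseA (fun j => unitRoot (e j)) k 1) (phaseB (fun j => unitRoot (e j)) k 1) =
      driftCoeff (fun j => criticalAngle (e j)) k := by
  funext J
  rcases J with ⟨i, j⟩ | ⟨i, j⟩
  · simp only [joinEntries, Sum.elim_inl, phaseA, Matrix.of_apply, driftCoeff, Matrix.one_apply]
    split_ifs with h
    · subst h
      rw [← mul_pow, normSq_unitRoot (he i)]
      simp
    · simp
  · simp only [joinEntries, Sum.elim_inr, phaseB, Matrix.of_apply, driftCoeff, Matrix.one_apply]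
    split_ifs with h
    · subst h
      rw [← mul_pow, unitRoot_eq_exp (he i), ← Complex.exp_add]
      push_cast
      rw [mul_add]
      simp
    · simp

theorem joinEntries_noise {e : Fin m → ℝ} (he : ∀ j, |e j| < 2) (O : Matrix (Fin m) (Fin m) ℝ) (n k : ℕ)
    (σ : ℝ) (x : Fin m → ℝ) :
    joinEntries (phaseA (fun j => unitRoot (e j)) k (rotatedDiagonal O ((σ / √(n : ℝ)) • x)))
      (phaseB (fun j => unitRoot (e j)) k (rotatedDiagonal O ((σ / √(n : ℝ)) • x))) =
      σ • ∑ a, x a • noiseCoeff O (fun j => criticalAngle (e j)) n k a := by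
  have h1 : ∀ j, unitRoot (e j) = Complex.exp (Complex.I * (criticalAngle (e j) : ℝ)) := fun j =>
    unitRoot_eq_exp (he j)
  funext J
  simp only [Pi.smul_apply, Finset.sum_apply, noiseCoeff]
  rcases J with ⟨i, j⟩ | ⟨i, j⟩
  · simp only [joinEntries, Sum.elim_inl, phaseA, Matrix.of_apply, rotatedDiagonal_apply, h1,
      noisePhase, noiseWeight, conj_exp_I_mul, ← mul_pow, ← Complex.exp_add, ← mul_add]
    push_cast
    simp only [Finset.mul_sum, Finset.smul_sum, Complex.real_smul, Pi.smul_apply, smul_eq_mul]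
    refine Finset.sum_congr rfl fun a _ => ?_
    push_cast
    ring_nf
  · simp only [joinEntries, Sum.elim_inr, phaseB, Matrix.of_apply, rotatedDiagonal_apply, h1,
      noisePhase, noiseWeight, ← mul_pow, ← Complex.exp_add, ← mul_add]
    push_cast
    simp only [Finset.mul_sum, Finset.smul_sum, Complex.real_smul, Pi.smul_apply, smul_eq_mul]
    refine Finset.sum_congr rfl fun a _ => ?_
    push_cast
    ring_nf

/-- The recursion in the form used from here on: a deterministic term for the energy shift and a
noise term, which has the shape required by `IsNoisyEvolution`. The noise appears as `-v`, because
the potential is subtracted in the transfer matrix. -/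
theorem regularizedEvolution_step {e : Fin m → ℝ} (he : ∀ j, |e j| < 2) {O H : Matrix (Fin m) (Fin m) ℝ}
    (hO : O ∈ Matrix.orthogonalGroup (Fin m) ℝ) {lam : ℝ}
    (hH : H * O = O * Matrix.diagonal fun j => lam - e j) {n : ℕ} (σ : ℝ) (v : Fin m × Fin n → ℝ)
    (E : ℂ) (k : ℕ) :
    regularizedEvolution H O e lam (fun k => (σ / √(n : ℝ)) • slice v k) E (k + 1) =
      (1 + (E - lam) • scaledBlock (fun j => sEntry (e j)) (driftCoeff (fun j => criticalAngle (e j)) k)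
        + σ • ∑ a, slice (-v) k a • scaledBlock (fun j => sEntry (e j))
          (noiseCoeff O (fun j => criticalAngle (e j)) n k a)) *
      regularizedEvolution H O e lam (fun k => (σ / √(n : ℝ)) • slice v k) E k := by
  rw [regularizedEvolution_succ he hO hH, sMatrix_eq, noiseBlock_doubledDiagonal,
    noiseBlock_doubledDiagonal, joinEntries_drift he, joinEntries_noise he, sub_eq_add_neg,
    ← map_neg, ← smul_neg, ← Finset.sum_neg_distrib, map_smul, map_sum]
  congr 3
  refine Finset.sum_congr rfl fun a _ => ?_
  rw [← neg_smul, map_smul]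
  congr 1
  simp only [slice, Pi.neg_apply]
  split_ifs <;> simp

end Coefficients

/-! ### The perturbation estimate in terms of matrix entries -/

section EntryPerturbation

variable {I : Type*} [Fintype I] [DecidableEq I]

-- A submultiplicative norm is needed for the estimate in a normed ring; it is confined to this
-- section, and the final bound concerns entries.
attribute [local instance] Matrix.linftyOpNormedRing Matrix.linftyOpNormedAlgebra

theorem Matrix.norm_entry_le_linftyOp (M : Matrix I I ℂ) (i j : I) : ‖M i j‖ ≤ ‖M‖ := by
  have h1 : ∑ j, ‖M i j‖₊ ≤ ‖M‖₊ := by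
    rw [Matrix.linfty_opNNNorm_def]
    exact Finset.le_sup (f := fun i => ∑ j, ‖M i j‖₊) (Finset.mem_univ i)
  exact (Finset.single_le_sum (f := fun j => ‖M i j‖₊) (fun _ _ => zero_le) (Finset.mem_univ j)).trans h1

theorem Matrix.linftyOp_norm_le_of_entry {M : Matrix I I ℂ} {c : ℝ} (hc : 0 ≤ c)
    (h : ∀ i j, ‖M i j‖ ≤ c) : ‖M‖ ≤ Fintype.card I * c := by
  lift c to NNReal using hc
  have h' : ∀ i j, ‖M i j‖₊ ≤ c := h
  have : ‖M‖₊ ≤ Fintype.card I * c := by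
    rw [Matrix.linfty_opNNNorm_def]
    refine Finset.sup_le fun i _ => (Finset.sum_le_sum fun j _ => h' i j).trans ?_
    simp
  exact_mod_cast this

/-- A bounded perturbation of a matrix recursion that stays close to the identity, entrywise. -/
theorem Matrix.norm_perturbation_entry_le [Nonempty I] {X Y M D : ℕ → Matrix I I ℂ} {n : ℕ} {d δ : ℝ}
    (hX0 : X 0 = 1) (hY0 : Y 0 = 1)
    (hX : ∀ k < n, X (k + 1) = (1 + M k) * X k) (hY : ∀ k < n, Y (k + 1) = (1 + D k + M k) * Y k)
    (hd : 0 ≤ d) (hδ0 : 0 ≤ δ)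
    (hD : ∀ k < n, ∀ i j, ‖D k i j‖ ≤ d) (hδX : ∀ k ≤ n, ∀ i j, ‖(X k - 1) i j‖ ≤ δ)
    (hδ : Fintype.card I * δ ≤ 1 / 2) (hnd : 6 * (n * (Fintype.card I * d)) ≤ 1) {k : ℕ} (hk : k ≤ n) (i j : I) :
    ‖(Y k - X k - ∑ j ∈ Finset.range k, D j) i j‖ ≤
      14 * (Fintype.card I * δ) * (n * (Fintype.card I * d)) + 6 * (n * (Fintype.card I * d)) ^ 2 := by
  haveI : NormOneClass (Matrix I I ℂ) := Matrix.linfty_opNormOneClass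
  haveI := FiniteDimensional.complete ℂ (Matrix I I ℂ)
  exact (Matrix.norm_entry_le_linftyOp _ i j).trans (norm_perturbation_le hX0 hY0 hX hY
    (fun k hk => Matrix.linftyOp_norm_le_of_entry hd (hD k hk))
    (fun k hk => Matrix.linftyOp_norm_le_of_entry hδ0 (hδX k hk)) hδ hnd hk)

end EntryPerturbation

/-! ### Linearization at nearby energies -/

section Regime

variable {m : ℕ}

/-- The entries of `(A, B)` that correspond to a unit energy shift. -/
def unitDrift (m : ℕ) : NoiseIndex m → ℂ := joinEntries 1 0

/-- Elliptic energies whose critical angles are chaotic on the scale `n`, with convergent weights,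
and vanishing noise levels `σ`. -/
structure IsCriticalRegime (e : ℕ → Fin m → ℝ) (s : Fin m → ℝ) (n : ℕ → ℕ) (σ : ℕ → ℝ) : Prop where
  elliptic : ∀ ν j, |e ν j| < 2
  scale : ∀ j, Tendsto (fun ν => sEntry (e ν j)) atTop (𝓝 (s j))
  chaotic : IsChaotic n fun ν j => criticalAngle (e ν j)
  pos : ∀ ν, 0 < σ ν
  small : Tendsto σ atTop (𝓝 0)

variable {e : ℕ → Fin m → ℝ} {s : Fin m → ℝ} {n : ℕ → ℕ} {σ : ℕ → ℝ}

theorem IsCriticalRegime.exists_scale_le (h : IsCriticalRegime e s n σ) :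
    ∃ b : ℝ, 0 < b ∧ ∀ᶠ ν in atTop, ∀ j, |sEntry (e ν j)| ≤ b := by
  refine ⟨∑ j, |s j| + 1, by positivity, ?_⟩
  refine eventually_all.2 fun j => ?_
  have h1 : |s j| < ∑ j, |s j| + 1 := lt_of_le_of_lt
    (Finset.single_le_sum (f := fun j => |s j|) (fun _ _ => abs_nonneg _) (Finset.mem_univ j)) (lt_add_one _)
  exact ((h.scale j).abs.eventually_lt_const h1).mono fun ν hν => hν.le

theorem IsCriticalRegime.eventually_scale_sub_le (h : IsCriticalRegime e s n σ) {η : ℝ} (hη : 0 < η) :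
    ∀ᶠ ν in atTop, ∀ i j, |sEntry (e ν i) * sEntry (e ν j) - s i * s j| ≤ η := by
  refine eventually_all.2 fun i => eventually_all.2 fun j => ?_
  have h1 := (((h.scale i).mul (h.scale j)).sub_const (s i * s j)).abs
  rw [sub_self, abs_zero] at h1
  exact (h1.eventually_lt_const hη).mono fun ν hν => hν.le

/-- The part of the drift in `A` averages exactly to `K / n`; the part in `B` is a geometric sum of
the nonresonant phase `2 q_j`, negligible uniformly in `K`. -/
theorem IsCriticalRegime.eventually_drift_le (h : IsCriticalRegime e s n σ) {η : ℝ} (hη : 0 < η) :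
    ∀ᶠ ν in atTop, ∀ (K : ℕ) (J : NoiseIndex m),
      ‖((n ν : ℝ)⁻¹ • ∑ k ∈ Finset.range K, driftCoeff (fun j => criticalAngle (e ν j)) k -
        ((K : ℝ) / n ν) • unitDrift m) J‖ ≤ η := by
  have h1 : ∀ j, ∀ᶠ ν in atTop, ∀ K : ℕ, ‖(n ν : ℂ)⁻¹ * ∑ k ∈ Finset.range K,
      Complex.exp (Complex.I * (criticalAngle (e ν j) + criticalAngle (e ν j) : ℝ)) ^ (k + 1)‖ ≤ η := by
    intro j
    obtain ⟨η', h0, h2⟩ := (h.chaotic.sum j j).exists_bound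
    filter_upwards [h2, h0.eventually_lt_const hη] with ν h3 h4 K
    exact (h3 K).trans h4.le
  filter_upwards [eventually_all.2 h1] with ν hν K J
  rcases J with ⟨i, j⟩ | ⟨i, j⟩
  · have : ((n ν : ℝ)⁻¹ • ∑ k ∈ Finset.range K, driftCoeff (fun j => criticalAngle (e ν j)) k -
        ((K : ℝ) / n ν) • unitDrift m) (.inl (i, j)) = 0 := by
      simp only [Pi.sub_apply, Pi.smul_apply, Finset.sum_apply, driftCoeff, Sum.elim_inl, unitDrift, joinEntries,
        Matrix.one_apply, Finset.sum_const, Finset.card_range]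
      split_ifs
      · simp [div_eq_inv_mul]
      · simp
    rw [this, norm_zero]
    exact hη.le
  · by_cases hij : i = j
    · subst hij
      simpa [driftCoeff, unitDrift, joinEntries] using hν i K
    · simpa [driftCoeff, unitDrift, joinEntries, hij] using hη.le

/-- The sums of the noise that drive the entries of `(A, B)`. -/
def noiseValue (O : Matrix (Fin m) (Fin m) ℝ) (q : Fin m → ℝ) {n : ℕ} (v : Fin m × Fin n → ℝ) (k : ℕ) :
    NoiseIndex m → ℂ :=
  ∑ j ∈ Finset.range k, ∑ a, slice (-v) j a • noiseCoeff O q n j a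

/-- The regularized evolution in a box with potential `(σ / √n) v`. -/
def boxEvolution (H O : Matrix (Fin m) (Fin m) ℝ) (e : Fin m → ℝ) (lam σ : ℝ) {n : ℕ}
    (v : Fin m × Fin n → ℝ) (E : ℂ) (k : ℕ) : Matrix (Fin m ⊕ Fin m) (Fin m ⊕ Fin m) ℂ :=
  regularizedEvolution H O e lam (fun k => (σ / √(n : ℝ)) • slice v k) E k

/-- The evolution at the reference energy is linearized with precision `σ τ` up to time `n`, and its
driving noise is at most `R`. -/
def IsLinearized (H O : Matrix (Fin m) (Fin m) ℝ) (e : Fin m → ℝ) (lam σ : ℝ) {n : ℕ} (τ R : ℝ)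
    (v : Fin m × Fin n → ℝ) : Prop :=
  ∀ k ≤ n, (∀ x y, ‖(boxEvolution H O e lam σ v lam k - 1 - σ • scaledBlock (fun j => sEntry (e j))
    (noiseValue O (fun j => criticalAngle (e j)) v k)) x y‖ ≤ σ * τ) ∧
    ∀ J, ‖noiseValue O (fun j => criticalAngle (e j)) v k J‖ ≤ R

variable {O : Matrix (Fin m) (Fin m) ℝ} {H : ℕ → Matrix (Fin m) (Fin m) ℝ} {lam : ℝ}

theorem norm_unitDrift_le (J : NoiseIndex m) : ‖unitDrift m J‖ ≤ 1 := by
  rcases J with ⟨i, j⟩ | ⟨i, j⟩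
  · simp only [unitDrift, joinEntries, Sum.elim_inl, Matrix.one_apply]
    split_ifs <;> simp
  · simp [unitDrift, joinEntries]

/-- On the event that the evolution at the reference energy is linearized, the evolution at nearby
energies is affine in the noise up to a small error. -/
theorem IsCriticalRegime.eventually_norm_boxEvolution_sub_le (h : IsCriticalRegime e s n σ)
    (hO : O ∈ Matrix.orthogonalGroup (Fin m) ℝ)
    (hH : ∀ ν, H ν * O = O * Matrix.diagonal fun j => lam - e ν j) {τ R B : ℝ} (hτ : 0 < τ)
    (hR : 0 < R) (hB : 0 < B) :
    ∀ᶠ ν in atTop, ∀ v : Fin m × Fin (n ν) → ℝ, IsLinearized (H ν) O (e ν) lam (σ ν) τ R v →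
      ∀ z : ℂ, ‖z‖ ≤ B → ∀ k ≤ n ν, ∀ x y,
        ‖(((1 / σ ν : ℝ) : ℂ) • (boxEvolution (H ν) O (e ν) lam (σ ν) v
            ((lam : ℂ) + z * (σ ν : ℂ) / (n ν : ℂ)) k - 1) -
          (scaledBlock s (noiseValue O (fun j => criticalAngle (e ν j)) v k) +
            (z * ((k / n ν : ℝ) : ℂ)) • scaledBlock s (unitDrift m))) x y‖ ≤ 5 * τ := by
  haveI := h.chaotic.nonempty
  obtain ⟨b, hb, hsb⟩ := h.exists_scale_le
  set c : ℝ := (Fintype.card (Fin m ⊕ Fin m) : ℝ) with hc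
  have hc0 : 0 ≤ c := Nat.cast_nonneg _
  have hσ0 : ∀ C : ℝ, ∀ ε > 0, ∀ᶠ ν in atTop, σ ν * C ≤ ε := by
    intro C ε hε
    have h1 := h.small.mul_const C
    rw [zero_mul] at h1
    exact (h1.eventually_lt_const hε).mono fun ν hν => hν.le
  filter_upwards [hsb, h.eventually_scale_sub_le (η := τ / R) (by positivity),
    h.eventually_scale_sub_le (η := τ / B) (by positivity),
    h.eventually_drift_le (η := τ / (B * b ^ 2)) (by positivity),
    h.chaotic.tendsto_length.eventually_gt_atTop 0,
    hσ0 (14 * (c * (τ + b ^ 2 * R)) * (c * (B * b ^ 2)) + 6 * (c * (B * b ^ 2)) ^ 2) τ hτ,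
    hσ0 (c * (τ + b ^ 2 * R)) (1 / 2) (by norm_num), hσ0 (6 * (c * (B * b ^ 2))) 1 one_pos]
    with ν h1 h2 h3 h4 h5 h6 h7 h8 v hv z hz k hk x y
  have hσ := h.pos ν
  have hn : (0 : ℝ) < n ν := Nat.cast_pos.2 h5
  set sν : Fin m → ℝ := fun j => sEntry (e ν j) with hsν
  set q : Fin m → ℝ := fun j => criticalAngle (e ν j) with hq
  set p := noiseValue O q v k with hp
  set X := boxEvolution (H ν) O (e ν) lam (σ ν) v lam with hX
  set Y := boxEvolution (H ν) O (e ν) lam (σ ν) v ((lam : ℂ) + z * (σ ν : ℂ) / (n ν : ℂ)) with hY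
  set D : ℕ → Matrix (Fin m ⊕ Fin m) (Fin m ⊕ Fin m) ℂ := fun k =>
    (z * (σ ν : ℂ) / (n ν : ℂ)) • scaledBlock sν (driftCoeff q k) with hD
  set M : ℕ → Matrix (Fin m ⊕ Fin m) (Fin m ⊕ Fin m) ℂ := fun k =>
    σ ν • ∑ a, slice (-v) k a • scaledBlock sν (noiseCoeff O q (n ν) k a) with hM
  have hpb : ∀ k ≤ n ν, ∀ x y, ‖scaledBlock sν (noiseValue O q v k) x y‖ ≤ b ^ 2 * R := fun k hk x y =>
    (norm_scaledBlock_le h1 _ x y).trans (mul_le_mul_of_nonneg_left ((hv k hk).2 _) (by positivity))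
  -- Here `d` bounds the energy shift in one step, so `n * d` is `σ * B * b ^ 2`, and `δ` bounds `X
  -- - 1` when the evolution is linearized. Both errors of the perturbation estimate are then `O(σ ^
  -- 2)`, and remain small after division by `σ`.
  have hmain := Matrix.norm_perturbation_entry_le (X := X) (Y := Y) (M := M) (D := D) (n := n ν)
    (d := B * σ ν / n ν * b ^ 2) (δ := σ ν * (τ + b ^ 2 * R))
    (regularizedEvolution_zero (h.elliptic ν) hO (hH ν) _ _)
    (regularizedEvolution_zero (h.elliptic ν) hO (hH ν) _ _)
    (fun k _ => by
      rw [hX, boxEvolution, regularizedEvolution_step (h.elliptic ν) hO (hH ν), sub_self, zero_smul,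
        add_zero]
      rfl)
    (fun k _ => by
      rw [hY, boxEvolution, regularizedEvolution_step (h.elliptic ν) hO (hH ν), add_sub_cancel_left]
      rfl)
    (by positivity) (by positivity)
    (fun k _ i j => by
      simp only [hD]
      rw [Matrix.smul_apply, norm_smul, norm_div, norm_mul, Complex.norm_natCast,
        Complex.norm_of_nonneg hσ.le]
      refine mul_le_mul (by gcongr) ((norm_scaledBlock_le h1 _ i j).trans ?_) (norm_nonneg _) (by positivity)
      exact mul_le_of_le_one_right (by positivity) (norm_driftCoeff_le q k _))
    (fun k hk i j => by
      have e1 : (X k - 1) i j = (X k - 1 - σ ν • scaledBlock sν (noiseValue O q v k)) i j +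
          (σ ν : ℂ) * scaledBlock sν (noiseValue O q v k) i j := by
        simp
      rw [e1, mul_add]
      refine (norm_add_le _ _).trans (add_le_add ((hv k hk).1 i j) ?_)
      rw [norm_mul, Complex.norm_of_nonneg hσ.le]
      exact mul_le_mul_of_nonneg_left (hpb k hk i j) hσ.le)
    (by rw [← hc]; linarith) (by
      rw [← hc]
      have : 6 * (n ν * (c * (B * σ ν / n ν * b ^ 2))) = σ ν * (6 * (c * (B * b ^ 2))) := by
        field_simp
      rwa [this]) hk x y
  rw [← hc] at hmain
  have e0 : (n ν : ℝ) * (c * (B * σ ν / n ν * b ^ 2)) = σ ν * (c * (B * b ^ 2)) := by field_simp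
  rw [e0] at hmain
  -- Five errors of size `τ`: the change of energy, the linearization at the reference energy, the
  -- averaging of the drift, and the passage to the limiting weights in the noise and in the drift.
  have g1 : ‖((1 / σ ν : ℝ) : ℂ) * (Y k - X k - ∑ j ∈ Finset.range k, D j) x y‖ ≤ τ := by
    rw [norm_mul, Complex.norm_of_nonneg (by positivity), one_div_mul_eq_div, div_le_iff₀ hσ]
    refine hmain.trans ?_
    nlinarith
  have g2 : ‖((1 / σ ν : ℝ) : ℂ) * (X k - 1 - σ ν • scaledBlock sν p) x y‖ ≤ τ := by
    rw [norm_mul, Complex.norm_of_nonneg (by positivity), one_div_mul_eq_div, div_le_iff₀ hσ, mul_comm τ]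
    exact (hv k hk).1 x y
  have g3 : ‖z * scaledBlock sν ((n ν : ℝ)⁻¹ • ∑ k ∈ Finset.range k, driftCoeff q k -
        ((k : ℝ) / n ν) • unitDrift m) x y‖ ≤ τ := by
    rw [norm_mul]
    calc _ ≤ B * (b ^ 2 * (τ / (B * b ^ 2))) := mul_le_mul hz ((norm_scaledBlock_le h1 _ x y).trans
          (mul_le_mul_of_nonneg_left (h4 k _) (by positivity))) (norm_nonneg _) hB.le
      _ = τ := by field_simp
  have g4 : ‖scaledBlock sν p x y - scaledBlock s p x y‖ ≤ τ :=
    calc _ ≤ τ / R * R := (norm_scaledBlock_sub_le h2 p x y).trans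
          (mul_le_mul_of_nonneg_left ((hv k hk).2 _) (by positivity))
      _ = τ := by field_simp
  have g5 : ‖z * ((k / n ν : ℝ) : ℂ) * (scaledBlock sν (unitDrift m) x y -
      scaledBlock s (unitDrift m) x y)‖ ≤ τ := by
    have hk1 : (k / n ν : ℝ) ≤ 1 := by
      rw [div_le_one hn]
      exact_mod_cast hk
    rw [norm_mul, norm_mul, Complex.norm_of_nonneg (by positivity)]
    calc _ ≤ B * 1 * (τ / B * 1) := by
          refine mul_le_mul (mul_le_mul hz hk1 (by positivity) hB.le)
            ((norm_scaledBlock_sub_le h3 _ x y).trans (mul_le_mul_of_nonneg_left (norm_unitDrift_le _)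
            (by positivity))) (norm_nonneg _) (by positivity)
      _ = τ := by field_simp
  have hσc : (σ ν : ℂ) ≠ 0 := Complex.ofReal_ne_zero.2 hσ.ne'
  have hsum : (∑ j ∈ Finset.range k, D j) x y = (z * (σ ν : ℂ)) *
      scaledBlock sν ((n ν : ℝ)⁻¹ • ∑ k ∈ Finset.range k, driftCoeff q k) x y := by
    simp only [hD]
    rw [← Finset.smul_sum, ← map_sum, map_smul, Matrix.smul_apply, Matrix.smul_apply, smul_eq_mul,
      Complex.real_smul]
    push_cast
    ring
  have hfin : (((1 / σ ν : ℝ) : ℂ) • (Y k - 1) - (scaledBlock s p + (z * ((k / n ν : ℝ) : ℂ)) •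
      scaledBlock s (unitDrift m))) x y =
      ((1 / σ ν : ℝ) : ℂ) * (Y k - X k - ∑ j ∈ Finset.range k, D j) x y +
      ((1 / σ ν : ℝ) : ℂ) * (X k - 1 - σ ν • scaledBlock sν p) x y +
      z * scaledBlock sν ((n ν : ℝ)⁻¹ • ∑ k ∈ Finset.range k, driftCoeff q k -
        ((k : ℝ) / n ν) • unitDrift m) x y +
      (scaledBlock sν p x y - scaledBlock s p x y) +
      z * ((k / n ν : ℝ) : ℂ) * (scaledBlock sν (unitDrift m) x y -
      scaledBlock s (unitDrift m) x y) := by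
    rw [map_sub, map_smul (scaledBlock sν) ((k : ℝ) / n ν)]
    simp only [Matrix.sub_apply, Matrix.add_apply, Matrix.smul_apply, smul_eq_mul, Complex.real_smul, hsum]
    push_cast
    field_simp
    ring
  rw [hfin]
  have n1 := norm_add_le (((1 / σ ν : ℝ) : ℂ) * (Y k - X k - ∑ j ∈ Finset.range k, D j) x y +
      ((1 / σ ν : ℝ) : ℂ) * (X k - 1 - σ ν • scaledBlock sν p) x y +
      z * scaledBlock sν ((n ν : ℝ)⁻¹ • ∑ k ∈ Finset.range k, driftCoeff q k -
        ((k : ℝ) / n ν) • unitDrift m) x y +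
      (scaledBlock sν p x y - scaledBlock s p x y)) (z * ((k / n ν : ℝ) : ℂ) * (scaledBlock sν (unitDrift m) x y -
      scaledBlock s (unitDrift m) x y))
  refine n1.trans (le_trans (add_le_add_left (norm_add₄_le) _) ?_)
  linarith

end Regime

/-! ### The evolution is linearized with high probability -/

section Linearization

variable {Ω : ℕ → Type*} [∀ ν, MeasurableSpace (Ω ν)] {P : ∀ ν, Measure (Ω ν)}
  [∀ ν, IsProbabilityMeasure (P ν)] {m : ℕ} {e : ℕ → Fin m → ℝ} {s : Fin m → ℝ} {n : ℕ → ℕ}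
  {σ : ℕ → ℝ} {V : ∀ ν, Fin m × Fin (n ν) → Ω ν → ℝ} {K : ℝ}
  {O : Matrix (Fin m) (Fin m) ℝ} {H : ℕ → Matrix (Fin m) (Fin m) ℝ} {lam : ℝ}

theorem noiseSum_neg_eq {Ω : Type*} {n : ℕ} (V : Fin m × Fin n → Ω → ℝ) (O : Matrix (Fin m) (Fin m) ℝ)
    (q : Fin m → ℝ) (k : ℕ) (ω : Ω) :
    noiseSum (sliceNoise fun p ω => -V p ω) (fun k a _ => noiseCoeff O q n k a) k ω =
      noiseValue O q (fun p => V p ω) k := rfl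

/-- With unit weights every entry of the noise appears, up to a map preserving the modulus, as an
entry of the block matrix. Bounds for noise matrices thus control the noise itself. -/
theorem norm_le_of_scaledBlock_one {p : NoiseIndex m → ℂ} {R : ℝ}
    (h : ∀ x y, ‖scaledBlock (fun _ => 1) p x y‖ ≤ R) (J : NoiseIndex m) : ‖p J‖ ≤ R := by
  have h1 : ∀ x y, ‖p (entryIndex x y)‖ ≤ R := by
    intro x y
    simpa [scaledBlock_apply, norm_rowMap] using h x y
  rcases J with ⟨i, j⟩ | ⟨i, j⟩
  · exact h1 (.inl i) (.inl j)
  · exact h1 (.inl i) (.inr j)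

theorem measure_le_ofReal_of_real_le {Ω : Type*} [MeasurableSpace Ω] {P : Measure Ω} [IsFiniteMeasure P]
    {A : Set Ω} {x : ℝ} (h : P.real A ≤ x) : P A ≤ ENNReal.ofReal x := by
  rw [← ofReal_measureReal]
  exact ENNReal.ofReal_le_ofReal h

/-- With probability close to one the evolution at the reference energy is linearized. -/
theorem IsCriticalRegime.exists_measure_not_isLinearized_le (h : IsCriticalRegime e s n σ)
    (hO : O ∈ Matrix.orthogonalGroup (Fin m) ℝ)
    (hH : ∀ ν, H ν * O = O * Matrix.diagonal fun j => lam - e ν j) (hK : 0 ≤ K)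
    (hV : ∀ ν, IsBoxNoise (P ν) (V ν) K) {ε : ℝ} (hε : 0 < ε) :
    ∃ R : ℝ, 0 < R ∧ ∀ τ : ℝ, 0 < τ → ∀ᶠ ν in atTop, P ν {ω | ¬ IsLinearized (H ν) O (e ν) lam (σ ν) τ R
      fun p => V ν p ω} ≤ ENNReal.ofReal ε := by
  obtain ⟨b, hb, hsb⟩ := h.exists_scale_le
  set C : ℝ := ∑ a, ∑ J, |noiseWeight O a J| with hC
  have hC0 : 0 ≤ C := by positivity
  set κ₁ : ℝ := ((Fintype.card (Fin m) : ℝ) * C * Fintype.card (Fin m ⊕ Fin m)) ^ 2 with hκ₁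
  set κ : ℝ := ((Fintype.card (Fin m) : ℝ) * (b ^ 2 * C) * Fintype.card (Fin m ⊕ Fin m)) ^ 2 with hκ
  -- The noise bound `R` depends on `ε` only and is fixed before the precision `τ`, which can then
  -- be chosen in terms of `R`.
  obtain ⟨R, hR, hRε⟩ : ∃ R : ℝ, 0 < R ∧ κ₁ / R ^ 2 ≤ ε / 2 := by
    have h1 : Tendsto (fun R : ℝ => κ₁ / R ^ 2) atTop (𝓝 0) :=
      (tendsto_pow_atTop (by norm_num)).const_div_atTop κ₁
    obtain ⟨R, h2, h3⟩ := ((eventually_gt_atTop (0 : ℝ)).and (h1.eventually_lt_const (half_pos hε))).exists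
    exact ⟨R, h2, h3.le⟩
  refine ⟨R, hR, fun τ hτ => ?_⟩
  have hσ2 : ∀ D : ℝ, ∀ ε > 0, ∀ᶠ ν in atTop, D * σ ν ^ 2 ≤ ε := by
    intro D ε hε
    have h1 := (h.small.pow 2).const_mul D
    rw [zero_pow two_ne_zero, mul_zero] at h1
    exact (h1.eventually_lt_const hε).mono fun ν hν => hν.le
  filter_upwards [hsb, hσ2 (4 * κ) 1 one_pos,
    hσ2 (κ * (4 * Fintype.card (Fin m ⊕ Fin m) * κ) / τ ^ 2) (ε / 2) (half_pos hε)] with ν h1 h2 h3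
  have hnoise := ((hV ν).neg).isNoise hK
  have hθ : (n ν : ℝ) * (√(n ν : ℝ))⁻¹ ^ 2 ≤ 1 := by
    rw [inv_pow, Real.sq_sqrt (Nat.cast_nonneg _)]
    exact mul_inv_le_one
  have hcoef : ∀ k a J, ‖noiseCoeff O (fun j => criticalAngle (e ν j)) (n ν) k a J‖ ≤
      C * (√(n ν : ℝ))⁻¹ := fun k a J => (norm_le_pi_norm _ J).trans (norm_noiseCoeff_le O _ _ k a)
  have hX : IsNoisyEvolution (sliceNoise fun p ω => -V ν p ω)
      (fun k a => scaledBlock (fun j => sEntry (e ν j)) (noiseCoeff O (fun j => criticalAngle (e ν j)) (n ν) k a))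
      (σ ν) (fun k ω => boxEvolution (H ν) O (e ν) lam (σ ν) (fun p => V ν p ω) lam k) := by
    constructor
    · intro ω
      exact regularizedEvolution_zero (h.elliptic ν) hO (hH ν) _ _
    · intro k ω
      simp only [boxEvolution]
      rw [regularizedEvolution_step (h.elliptic ν) hO (hH ν), sub_self, zero_smul, add_zero]
      rfl
  have hrem := hX.measure_exists_remainder_le hnoise (h.pos ν) (n := n ν) (C := b ^ 2 * C)
    (θ := (√(n ν : ℝ))⁻¹) (fun k a x y => by
      rw [mul_assoc]
      exact (norm_scaledBlock_le h1 _ x y).trans (mul_le_mul_of_nonneg_left (hcoef k a _) (by positivity)))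
    hθ (by rw [← hκ]; linarith) hτ
  -- Unit weights are used, so that the maximal inequality bounds the noise and not its scaled block
  -- matrix.
  have htight := hnoise.measure_exists_noise_le (n := n ν) (C := C) (θ := (√(n ν : ℝ))⁻¹)
    (N := fun k a => scaledBlock (fun _ => 1) (noiseCoeff O (fun j => criticalAngle (e ν j)) (n ν) k a))
    (fun k a x y => by
      refine (norm_scaledBlock_le (b := 1) (fun _ => by simp) _ x y).trans ?_
      rw [one_pow, one_mul]
      exact hcoef k a _) hθ hR
  rw [← hκ₁] at htight
  rw [← hκ] at hrem
  refine measure_le_ofReal_of_real_le ?_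
  refine (measureReal_mono (s₂ := _ ∪ _) ?_ (measure_ne_top _ _)).trans ((measureReal_union_le _ _).trans
    ((add_le_add htight hrem).trans ?_))
  · intro ω hω
    simp only [Set.mem_setOf_eq, IsLinearized, not_forall] at hω
    obtain ⟨k, hk, hω⟩ := hω
    rw [not_and_or] at hω
    by_contra hc
    simp only [Set.mem_union, Set.mem_setOf_eq, not_or, not_exists, not_and, not_le] at hc
    rcases hω with hω | hω
    · refine hω fun x y => ?_
      have h4 := (hc.2 k hk x y).le
      rw [← map_noiseSum (scaledBlock fun j => sEntry (e ν j)) (sliceNoise fun p ω => -V ν p ω)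
        (fun k a _ => noiseCoeff O (fun j => criticalAngle (e ν j)) (n ν) k a), noiseSum_neg_eq] at h4
      exact h4
    · refine hω (norm_le_of_scaledBlock_one fun x y => ?_)
      have h4 := (hc.1 k hk x y).le
      rw [← map_noiseSum (scaledBlock fun _ => 1) (sliceNoise fun p ω => -V ν p ω)
        (fun k a _ => noiseCoeff O (fun j => criticalAngle (e ν j)) (n ν) k a), noiseSum_neg_eq] at h4
      exact h4
  · have h5 : κ * (4 * Fintype.card (Fin m ⊕ Fin m) * κ * σ ν ^ 2) / τ ^ 2 =
        κ * (4 * Fintype.card (Fin m ⊕ Fin m) * κ) / τ ^ 2 * σ ν ^ 2 := by ring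
    rw [h5]
    linarith

theorem measurable_slice {Ω : Type*} [MeasurableSpace Ω] {n : ℕ} {V : Fin m × Fin n → Ω → ℝ}
    (hV : ∀ p, Measurable (V p)) (k : ℕ) (a : Fin m) :
    Measurable fun ω => slice (-fun p => V p ω) k a := by
  by_cases hk : k < n
  · simpa [slice, hk] using hV _
  · simp [slice, hk]

theorem measurable_boxEvolution {Ω : Type*} [MeasurableSpace Ω] {n : ℕ} {V : Fin m × Fin n → Ω → ℝ}
    (hV : ∀ p, Measurable (V p)) {e : Fin m → ℝ} (he : ∀ j, |e j| < 2)
    (hO : O ∈ Matrix.orthogonalGroup (Fin m) ℝ) {H : Matrix (Fin m) (Fin m) ℝ}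
    (hH : H * O = O * Matrix.diagonal fun j => lam - e j) (σ : ℝ) (E : ℂ) (k : ℕ) :
    ∀ x y, Measurable fun ω => boxEvolution H O e lam σ (fun p => V p ω) E k x y := by
  induction k with
  | zero =>
    intro x y
    simp only [boxEvolution, regularizedEvolution_zero he hO hH]
    exact measurable_const
  | succ k ih =>
    intro x y
    simp only [boxEvolution] at ih ⊢
    simp only [regularizedEvolution_step he hO hH, Matrix.mul_apply]
    refine Finset.measurable_fun_sum _ fun u _ => Measurable.mul ?_ (ih u y)
    simp only [Matrix.add_apply, Matrix.smul_apply, Matrix.sum_apply]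
    refine measurable_const.add (Measurable.const_smul ?_ σ)
    exact Finset.measurable_fun_sum _ fun a _ => (measurable_slice hV k a).smul_const _

end Linearization

/-! ### Convergence of the rescaled evolution as a path -/

section PathLimit

variable {Ω : ℕ → Type*} [∀ ν, MeasurableSpace (Ω ν)] {P : ∀ ν, Measure (Ω ν)}
  [∀ ν, IsProbabilityMeasure (P ν)] {m : ℕ} {e : ℕ → Fin m → ℝ} {s : Fin m → ℝ} {n : ℕ → ℕ}
  {σ : ℕ → ℝ} {V : ∀ ν, Fin m × Fin (n ν) → Ω ν → ℝ} {K : ℝ}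
  {O : Matrix (Fin m) (Fin m) ℝ} {H : ℕ → Matrix (Fin m) (Fin m) ℝ} {lam : ℝ}
  {Ω' : Type*} [MeasurableSpace Ω'] {P' : Measure Ω'} [IsProbabilityMeasure P']
  {A B : unitInterval → Ω' → Matrix (Fin m) (Fin m) ℂ}

/-- The sums of the noise converge to the driving Brownian motions. -/
theorem IsCriticalRegime.tendstoInDistribution_noiseValue (h : IsCriticalRegime e s n σ) (hK : 0 ≤ K)
    (hV : ∀ ν, IsBoxNoise (P ν) (V ν) K) (hAB : IsDrivingBrownianMotion O A B P') :
    TendstoInDistribution (fun ν ω => PathSpace.mk fun t : unitInterval =>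
        noiseValue O (fun j => criticalAngle (e ν j)) (fun p => V ν p ω) ⌊(n ν : ℝ) * t⌋₊)
      atTop (fun ω => PathSpace.mk fun t => joinEntries (A t ω) (B t ω)) P P' :=
  functional_clt h.chaotic.tendsto_length hK (fun ν => (hV ν).neg) (hasBrownianCoefficients h.chaotic O)
    hAB.isBrownian

/-- The value of the limit at finitely many energies, for given values of the noise. -/
def affineLimit (s : Fin m → ℝ) (Λ : Finset ℂ) (t : ℝ) (p : NoiseIndex m → ℂ) :
    Λ → Fin m ⊕ Fin m → Fin m ⊕ Fin m → ℂ := fun z x y =>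
  (scaledBlock s p + ((z : ℂ) * t) • scaledBlock s (unitDrift m)) x y

/-- At each time the map is a bounded linear map followed by a translation, with a bound independent
of time, hence Lipschitz for the uniform distance. The limit law then follows by continuous mapping.
-/
theorem continuous_affineLimit_path (s : Fin m → ℝ) (Λ : Finset ℂ) :
    Continuous fun f : PathSpace (NoiseIndex m → ℂ) =>
      PathSpace.mk fun t : unitInterval => affineLimit s Λ t (UniformFun.toFun f t) := by
  have hb : ∀ j, |s j| ≤ ∑ j, |s j| := fun j =>
    Finset.single_le_sum (f := fun j => |s j|) (fun _ _ => abs_nonneg _) (Finset.mem_univ j)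
  obtain ⟨b, hb0, hb⟩ : ∃ b : NNReal, 0 ≤ b ∧ ∀ j, |s j| ≤ b :=
    ⟨⟨∑ j, |s j|, by positivity⟩, zero_le, hb⟩
  have : LipschitzWith (b ^ 2) fun f : PathSpace (NoiseIndex m → ℂ) =>
      PathSpace.mk fun t : unitInterval => affineLimit s Λ t (UniformFun.toFun f t) := by
    intro f g
    refine PathSpace.edist_mk_le fun t => ?_
    have h1 : edist (UniformFun.toFun f t) (UniformFun.toFun g t) ≤ edist f g :=
      PathSpace.edist_le_edist_mk (f := UniformFun.toFun f) (g := UniformFun.toFun g) t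
    refine le_trans ?_ (mul_le_mul_right h1 _)
    refine edist_pi_le_iff.2 fun z => edist_pi_le_iff.2 fun x => edist_pi_le_iff.2 fun y => ?_
    rw [edist_nndist, edist_nndist, ← ENNReal.coe_mul, ENNReal.coe_le_coe]
    have h2 : affineLimit s Λ t (UniformFun.toFun f t) z x y - affineLimit s Λ t (UniformFun.toFun g t) z x y =
        scaledBlock s (UniformFun.toFun f t - UniformFun.toFun g t) x y := by
      rw [map_sub]
      simp [affineLimit]
    rw [← NNReal.coe_le_coe, coe_nndist, NNReal.coe_mul, NNReal.coe_pow, coe_nndist, dist_eq_norm,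
      dist_eq_norm, h2]
    exact (norm_scaledBlock_le hb _ x y).trans
      (mul_le_mul_of_nonneg_left (norm_le_pi_norm _ _) (by positivity))
  exact this.continuous

/-- Convergence of the rescaled regularized evolution to its Gaussian limit. -/
theorem IsCriticalRegime.tendstoInDistribution_boxEvolution (h : IsCriticalRegime e s n σ)
    (hO : O ∈ Matrix.orthogonalGroup (Fin m) ℝ)
    (hH : ∀ ν, H ν * O = O * Matrix.diagonal fun j => lam - e ν j) (hK : 0 ≤ K)
    (hV : ∀ ν, IsBoxNoise (P ν) (V ν) K) (hAB : IsDrivingBrownianMotion O A B P') (Λ : Finset ℂ) :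
    TendstoInDistribution (fun ν ω => PathSpace.mk fun t : unitInterval =>
        (fun (z : Λ) x y => (((1 / σ ν : ℝ) : ℂ) • (boxEvolution (H ν) O (e ν) lam (σ ν) (fun p => V ν p ω)
            ((lam : ℂ) + (z : ℂ) * (σ ν : ℂ) / (n ν : ℂ)) ⌊(n ν : ℝ) * t⌋₊ - 1)) x y :
          Λ → Fin m ⊕ Fin m → Fin m ⊕ Fin m → ℂ))
      atTop (fun ω => PathSpace.mk fun t : unitInterval => affineLimit s Λ t (joinEntries (A t ω) (B t ω)))
      P P' := by
  have hlim := (h.tendstoInDistribution_noiseValue hK hV hAB).continuous_comp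
    (continuous_affineLimit_path s Λ)
  refine tendstoInDistribution_of_approx (fun ν => (measurable_stepPath (n ν) (S := fun k ω =>
    (fun (z : Λ) x y => (((1 / σ ν : ℝ) : ℂ) • (boxEvolution (H ν) O (e ν) lam (σ ν) (fun p => V ν p ω)
      ((lam : ℂ) + (z : ℂ) * (σ ν : ℂ) / (n ν : ℂ)) k - 1)) x y)) fun k => ?_).aemeasurable)
    hlim.aemeasurable_limit fun ε hε => ⟨_, _, hlim, ?_, ?_⟩
  · refine measurable_pi_lambda _ fun z => measurable_pi_lambda _ fun x => measurable_pi_lambda _ fun y => ?_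
    simp only [Matrix.smul_apply, Matrix.sub_apply]
    exact ((measurable_boxEvolution (hV ν).measurable (h.elliptic ν) hO (hH ν) _ _ _ x y).sub_const
      _).const_smul (((1 / σ ν : ℝ) : ℂ))
  · set B' : ℝ := ∑ z ∈ Λ, ‖z‖ + 1 with hB'
    have hB0 : 0 < B' := by positivity
    have hB : ∀ z ∈ Λ, ‖z‖ ≤ B' := fun z hz =>
      (Finset.single_le_sum (f := fun z => ‖z‖) (fun _ _ => norm_nonneg _) hz).trans (by linarith)
    set b : ℝ := ∑ j, |s j| with hb'
    have hb : ∀ j, |s j| ≤ b := fun j =>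
      Finset.single_le_sum (f := fun j => |s j|) (fun _ _ => abs_nonneg _) (Finset.mem_univ j)
    obtain ⟨R, hR, hev⟩ := h.exists_measure_not_isLinearized_le hO hH hK hV hε
    -- The drift is evaluated at `⌊n t⌋ / n` before the limit and at `t` in it; the difference is at
    -- most `1 / n`. Together with the five errors of the linearization this accounts for the
    -- fractions `ε / 6`.
    have hsm : ∀ᶠ ν in atTop, B' * b ^ 2 * (1 / (n ν : ℝ)) ≤ ε / 6 := by
      have h1 := (tendsto_one_div_atTop_nhds_zero_nat (𝕜 := ℝ)).comp h.chaotic.tendsto_length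
      have h2 := h1.const_mul (B' * b ^ 2)
      rw [mul_zero] at h2
      exact (h2.eventually_lt_const (show 0 < ε / 6 by positivity)).mono fun ν hν => hν.le
    filter_upwards [hev (ε / 6) (by positivity), h.eventually_norm_boxEvolution_sub_le hO hH (show 0 < ε / 6 by positivity) hR hB0,
      hsm, h.chaotic.tendsto_length.eventually_gt_atTop 0] with ν h1 h2 h3 h4
    refine (measure_mono fun ω hω => ?_).trans h1
    refine fun hlin => not_le.2 (Set.mem_setOf_eq ▸ hω) ?_
    refine PathSpace.edist_mk_le fun t => edist_pi_le_iff.2 fun z => edist_pi_le_iff.2 fun x =>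
      edist_pi_le_iff.2 fun y => ?_
    rw [edist_dist, dist_eq_norm]
    refine ENNReal.ofReal_le_ofReal ?_
    have h5 := h2 _ hlin z (hB z z.2) ⌊(n ν : ℝ) * t⌋₊ (Nat.lt_succ_iff.1 (floor_mul_lt_succ _ t)) x y
    have h6 : ‖((z : ℂ) * (((⌊(n ν : ℝ) * t⌋₊ / n ν : ℝ) - t : ℝ) : ℂ)) * scaledBlock s (unitDrift m) x y‖ ≤ ε / 6 := by
      refine le_trans ?_ h3
      rw [norm_mul, norm_mul, Complex.norm_real, Real.norm_eq_abs]
      have h7 := (norm_scaledBlock_le hb (unitDrift m) x y).trans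
        (mul_le_of_le_one_right (sq_nonneg b) (norm_unitDrift_le _))
      calc _ ≤ B' * (1 / n ν) * b ^ 2 := mul_le_mul (mul_le_mul (hB z z.2) (abs_floor_div_sub_le h4 t)
            (abs_nonneg _) hB0.le) h7 (norm_nonneg _) (by positivity)
        _ = _ := by ring
    refine le_trans (le_of_eq (congrArg norm ?_)) ((norm_add_le _ _).trans ((add_le_add h5 h6).trans (by linarith)))
    simp only [affineLimit, Matrix.sub_apply, Matrix.add_apply, Matrix.smul_apply, smul_eq_mul]
    simp only [PathSpace.mk, UniformFun.toFun_ofFun]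
    push_cast
    ring
  -- The approximating family has exactly the required limit, so no error arises on this side.
  · refine le_of_eq_of_le (measure_mono_null (t := ∅) (fun ω hω => ?_) measure_empty) zero_le
    have h1 : ENNReal.ofReal ε < edist (PathSpace.mk fun t : unitInterval =>
      affineLimit s Λ t (joinEntries (A t ω) (B t ω))) (PathSpace.mk fun t : unitInterval =>
      affineLimit s Λ t (joinEntries (A t ω) (B t ω))) := hω
    rw [edist_self] at h1
    exact not_lt_zero h1

end PathLimit

/-! ### The limit of the eigenvalue process -/

section RescaledOperator

variable {m : ℕ}

theorem isSymm_pathMatrix (n : ℕ) : (pathMatrix n).IsSymm := by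
  ext i j
  simp only [Matrix.transpose_apply, pathMatrix, Matrix.of_apply, or_comm]

theorem isSymm_rescaledOperator {G : Matrix (Fin m) (Fin m) ℝ} (hG : G.IsSymm) (lam r σ : ℝ) (n : ℕ)
    (v : Fin m × Fin n → ℝ) : (rescaledOperator G lam r σ n v).IsSymm := by
  have h1 : (cartesianProduct (r • G) (pathMatrix n)).IsSymm := by
    rw [Matrix.IsSymm, cartesianProduct, Matrix.transpose_add, ← Matrix.kroneckerMap_transpose,
      ← Matrix.kroneckerMap_transpose, Matrix.transpose_one, Matrix.transpose_one, Matrix.transpose_smul,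
      hG.eq, (isSymm_pathMatrix n).eq]
  exact ((h1.add ((Matrix.isSymm_diagonal v).smul _)).sub (Matrix.isSymm_one.smul lam)).smul _

theorem continuous_rescaledOperator (G : Matrix (Fin m) (Fin m) ℝ) (lam r σ : ℝ) (n : ℕ) :
    Continuous fun v : Fin m × Fin n → ℝ => rescaledOperator G lam r σ n v := by
  unfold rescaledOperator
  fun_prop

theorem slice_smul {n : ℕ} (c : ℝ) (v : Fin m × Fin n → ℝ) : slice (c • v) = fun k => c • slice v k := by
  funext k a
  simp only [slice, Pi.smul_apply]
  split_ifs <;> simp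

/-- The characteristic polynomial of the rescaled operator in terms of the regularized evolution. -/
theorem det_sub_rescaledOperator {e : Fin m → ℝ} (he : ∀ j, |e j| < 2) {G O : Matrix (Fin m) (Fin m) ℝ}
    (hO : O ∈ Matrix.orthogonalGroup (Fin m) ℝ) {lam r σ : ℝ} (hσ : 0 < σ)
    (hH : (r • G) * O = O * Matrix.diagonal fun j => lam - e j) (n : ℕ) :
    ∃ c : ℂ, c ≠ 0 ∧ ∀ (z : ℂ) (v : Fin m × Fin n → ℝ),
      c * (z • 1 - (rescaledOperator G lam r σ n v).map (algebraMap ℝ ℂ)).det =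
        (((1 / σ : ℝ) : ℂ) • reducedBlock e n (boxEvolution (r • G) O e lam σ v
          ((lam : ℂ) + z * (σ : ℂ) / (n : ℂ)) n)).det := by
  obtain ⟨c, hc, h⟩ := det_sub_cartesianProduct m n
  have hσc : (σ : ℂ) ≠ 0 := Complex.ofReal_ne_zero.2 hσ.ne'
  have h1 : ∀ (z : ℂ) (v : Fin m × Fin n → ℝ),
      z • (1 : Matrix (Fin m × Fin n) (Fin m × Fin n) ℂ) -
        (rescaledOperator G lam r σ n v).map (algebraMap ℝ ℂ) = ((n : ℂ) / σ) •
      (((lam : ℂ) + z * (σ : ℂ) / (n : ℂ)) • 1 - (cartesianProduct (r • G) (pathMatrix n) +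
        Matrix.diagonal ((σ / √(n : ℝ)) • v)).map (algebraMap ℝ ℂ)) := by
    intro z v
    -- For `n = 0` the box is empty, and the default value of the division by `n` plays no role.
    rcases Nat.eq_zero_or_pos n with rfl | hn
    · ext x
      exact x.2.elim0
    · have hnc : (n : ℂ) ≠ 0 := Nat.cast_ne_zero.2 hn.ne'
      ext x y
      simp only [rescaledOperator, Matrix.sub_apply, Matrix.smul_apply, Matrix.map_apply, Matrix.add_apply,
        Matrix.diagonal_smul, smul_eq_mul, map_mul, map_add, map_sub, map_div₀, map_natCast,
        Complex.coe_algebraMap]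
      have h2 : ((((1 : Matrix (Fin m × Fin n) (Fin m × Fin n) ℝ) x y : ℝ)) : ℂ) =
          (1 : Matrix (Fin m × Fin n) (Fin m × Fin n) ℂ) x y := by
        simp only [Matrix.one_apply]
        split_ifs <;> simp
      push_cast
      rw [h2]
      field_simp
      ring
  have h3 : ((n : ℂ) / σ) ^ Fintype.card (Fin m × Fin n) ≠ 0 := by
    rcases Nat.eq_zero_or_pos n with rfl | hn
    · simp
    · exact pow_ne_zero _ (div_ne_zero (Nat.cast_ne_zero.2 hn.ne') hσc)
  refine ⟨((1 / σ : ℝ) : ℂ) ^ m / (((n : ℂ) / σ) ^ Fintype.card (Fin m × Fin n) * c), ?_, fun z v => ?_⟩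
  · refine div_ne_zero (pow_ne_zero _ ?_) (mul_ne_zero h3 hc)
    exact Complex.ofReal_ne_zero.2 (one_div_pos.2 hσ).ne'
  · rw [h1, Matrix.det_smul, h, slice_smul, det_transferProduct_toBlocks he hO hH, Matrix.det_smul,
      Fintype.card_fin, boxEvolution]
    field_simp

/-- The real matrix `Re (A - B)`. -/
def realDifference (p : NoiseIndex m → ℂ) : Matrix (Fin m) (Fin m) ℝ :=
  Matrix.of fun i j => (p (.inl (i, j)) - p (.inr (i, j))).re

theorem continuous_realDifference : Continuous (realDifference (m := m)) := by
  refine continuous_matrix fun i j => ?_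
  simp only [realDifference, Matrix.of_apply]
  fun_prop

theorem realDifference_neg (p : NoiseIndex m → ℂ) : realDifference (-p) = -realDifference p := by
  ext i j
  simp [realDifference]
  ring

theorem noiseValue_neg (O : Matrix (Fin m) (Fin m) ℝ) (q : Fin m → ℝ) {n : ℕ} (v : Fin m × Fin n → ℝ)
    (k : ℕ) : noiseValue O q (-v) k = -noiseValue O q v k := by
  simp only [noiseValue, ← Finset.sum_neg_distrib, ← neg_smul]
  refine Finset.sum_congr rfl fun j _ => Finset.sum_congr rfl fun a _ => ?_
  congr 1
  simp only [slice, Pi.neg_apply]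
  split_ifs <;> simp

/-- Exchanging the indices conjugates the coefficients of `A` and fixes those of `B`; real parts are
unaffected by either. -/
theorem isSymm_realDifference_noiseValue (O : Matrix (Fin m) (Fin m) ℝ) (q : Fin m → ℝ) {n : ℕ}
    (v : Fin m × Fin n → ℝ) (k : ℕ) : (realDifference (noiseValue O q v k)).IsSymm := by
  have h1 : ∀ k a i j, noiseCoeff O q n k a (.inr (i, j)) = noiseCoeff O q n k a (.inr (j, i)) := by
    intro k a i j
    simp only [noiseCoeff, noisePhase, noiseWeight, Sum.elim_inr]
    rw [add_comm (q i), mul_comm (O a i)]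
  ext i j
  simp only [Matrix.transpose_apply, realDifference, Matrix.of_apply, noiseValue, Finset.sum_apply,
    Pi.smul_apply, Complex.sub_re, Complex.re_sum, Complex.real_smul, Complex.re_ofReal_mul]
  congr 1
  · refine Finset.sum_congr rfl fun k _ => Finset.sum_congr rfl fun a _ => ?_
    rw [noiseCoeff_inl_swap O q n k a j i, Complex.conj_re]
  · refine Finset.sum_congr rfl fun k _ => Finset.sum_congr rfl fun a _ => ?_
    rw [h1]

/-- The eigenvalue process of the symmetric part of `Re (A - B)`. -/
def differenceProcess (p : NoiseIndex m → ℂ) : LocallyFiniteMeasures :=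
  eigenvalueProcess ((1 / 2 : ℝ) • (realDifference p + (realDifference p).transpose))

/-- Eigenvalue processes are known to be continuous along families of symmetric matrices;
symmetrizing makes the map continuous on all noise values, without changing it on those that occur.
-/
theorem continuous_differenceProcess : Continuous (differenceProcess (m := m)) :=
  continuous_eigenvalueProcess (by
    have h1 := continuous_realDifference (m := m)
    fun_prop) fun p => isHermitian_map <| by
      rw [Matrix.IsSymm, Matrix.transpose_smul, Matrix.transpose_add, Matrix.transpose_transpose, add_comm]

theorem differenceProcess_of_isSymm {p : NoiseIndex m → ℂ} (hp : (realDifference p).IsSymm) :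
    differenceProcess p = eigenvalueProcess (realDifference p) := by
  rw [differenceProcess, hp.eq, ← two_smul ℝ (realDifference p), smul_smul]
  norm_num

end RescaledOperator

/-! ### The eigenvalue process for potentials with linearized evolution -/

section DeterministicLimit

variable {m : ℕ} {e : ℕ → Fin m → ℝ} {s : Fin m → ℝ} {n : ℕ → ℕ} {σ r : ℕ → ℝ}
  {G O : Matrix (Fin m) (Fin m) ℝ} {lam : ℝ}

theorem IsCriticalRegime.comp (h : IsCriticalRegime e s n σ) {φ : ℕ → ℕ} (hφ : Tendsto φ atTop atTop) :
    IsCriticalRegime (fun k => e (φ k)) s (fun k => n (φ k)) fun k => σ (φ k) where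
  elliptic k := h.elliptic _
  scale j := (h.scale j).comp hφ
  chaotic := Tendsto.comp h.chaotic hφ
  pos k := h.pos _
  small := h.small.comp hφ

theorem IsLinearized.mono {e : Fin m → ℝ} {H : Matrix (Fin m) (Fin m) ℝ} {σ : ℝ} {n : ℕ} {τ τ' R : ℝ}
    {v : Fin m × Fin n → ℝ} (hv : IsLinearized H O e lam σ τ R v) (hσ : 0 < σ) (hτ : τ ≤ τ') :
    IsLinearized H O e lam σ τ' R v := fun k hk =>
  ⟨fun x y => ((hv k hk).1 x y).trans (mul_le_mul_of_nonneg_left hτ hσ.le), (hv k hk).2⟩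

/-- The uniform lower bound on the weights survives the limit; hence the constant in front of the
limiting characteristic polynomial is nonzero. -/
theorem IsCriticalRegime.scale_ne_zero (h : IsCriticalRegime e s n σ) (j : Fin m) : s j ≠ 0 := by
  have h1 : (2 : ℝ) ^ (-(1 / 2) : ℝ) ≤ s j :=
    ge_of_tendsto (h.scale j) (Eventually.of_forall fun ν => sEntry_ge (h.elliptic ν j))
  have h2 : (0 : ℝ) < 2 ^ (-(1 / 2) : ℝ) := by positivity
  exact (h2.trans_le h1).ne'

/-- The limit of the reduced block of the regularized evolution. -/
theorem IsCriticalRegime.tendsto_reducedBlock (h : IsCriticalRegime e s n σ)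
    (hu : ∀ j, Tendsto (fun ν => (1 / σ ν) * ‖unitRoot (e ν j) ^ (n ν + 1) - 1‖) atTop (𝓝 0))
    {X : ℕ → Matrix (Fin m ⊕ Fin m) (Fin m ⊕ Fin m) ℂ} {p : NoiseIndex m → ℂ} {z : ℂ}
    (hX : ∀ x y, Tendsto (fun ν => (((1 / σ ν : ℝ) : ℂ) • (X ν - 1)) x y) atTop
      (𝓝 ((scaledBlock s p + z • scaledBlock s (unitDrift m)) x y))) :
    Tendsto (fun ν => (((1 / σ ν : ℝ) : ℂ) • reducedBlock (e ν) (n ν) (X ν)).det) atTop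
      (𝓝 ((-2) ^ m * (∏ j, (s j : ℂ) ^ 2) ^ 2 *
        (z • 1 - (-realDifference p).map (algebraMap ℝ ℂ)).det)) := by
  set u : ℕ → Fin m → ℂ := fun ν j => unitRoot (e ν j) ^ (n ν + 1) with hudef
  have hσu : ∀ j, Tendsto (fun ν => ((1 / σ ν : ℝ) : ℂ) * (u ν j - 1)) atTop (𝓝 0) := by
    intro j
    rw [tendsto_zero_iff_norm_tendsto_zero]
    refine (hu j).congr fun ν => ?_
    rw [norm_mul, Complex.norm_of_nonneg (one_div_pos.2 (h.pos ν)).le]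
  have hu1 : ∀ j, Tendsto (fun ν => u ν j) atTop (𝓝 1) := by
    intro j
    have h1 := ((Complex.continuous_ofReal.tendsto 0).comp h.small).mul (hσu j)
    have h2 := h1.add_const 1
    simp only [mul_zero, zero_add] at h2
    refine h2.congr fun ν => ?_
    have := Complex.ofReal_ne_zero.2 (h.pos ν).ne'
    simp only [Function.comp_apply]
    push_cast
    field_simp
    ring
  have hconj : ∀ j, Tendsto (fun ν => (starRingEnd ℂ) (u ν j)) atTop (𝓝 1) := by
    intro j
    have := (Complex.continuous_conj.tendsto _).comp (hu1 j)
    rwa [map_one] at this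
  -- The identity part of `X` enters the reduced block through `ū - u`, where `u` is the phase at
  -- time `n + 1`. Division by `σ` is harmless because `u - 1 = o(σ)`.
  have hdiff : ∀ j, Tendsto (fun ν => ((1 / σ ν : ℝ) : ℂ) * ((starRingEnd ℂ) (u ν j) - u ν j)) atTop (𝓝 0) := by
    intro j
    have h1 := ((Complex.continuous_conj.tendsto _).comp (hσu j)).sub (hσu j)
    simp only [map_zero, sub_zero] at h1
    refine h1.congr fun ν => ?_
    simp only [Function.comp_apply, map_mul, Complex.conj_ofReal, map_sub, map_one]
    ring
  have hsc : ∀ j, Tendsto (fun ν => (sEntry (e ν j) : ℂ)) atTop (𝓝 (s j : ℂ)) := fun j =>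
    (Complex.continuous_ofReal.tendsto _).comp (h.scale j)
  -- In the limit the phases are 1. The blocks `i S (A + z) S`, `i S B S` and the negative
  -- conjugates of `A` and `B` below combine to `2 i S (z + Re (A - B)) S`; the outer factors `i s_i
  -- s_j` then yield the constant `-2` and the squares of the weights.
  have hlim : Tendsto (fun ν => ((1 / σ ν : ℝ) : ℂ) • reducedBlock (e ν) (n ν) (X ν)) atTop
      (𝓝 ((-2 : ℂ) • (Matrix.diagonal (fun j => (s j : ℂ) ^ 2) *
        (z • 1 - (-realDifference p).map (algebraMap ℝ ℂ)) * Matrix.diagonal fun j => (s j : ℂ) ^ 2))) := by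
    refine tendsto_pi_nhds.2 fun i => tendsto_pi_nhds.2 fun j => ?_
    have h1 := ((((hsc i).const_mul Complex.I).mul (hsc j)).mul
      ((((hconj i).mul ((hX (.inl i) (.inl j)).sub (hX (.inl i) (.inr j)))).add
        ((hu1 i).mul ((hX (.inr i) (.inl j)).sub (hX (.inr i) (.inr j))))).add
        ((hdiff i).mul_const ((1 : Matrix (Fin m) (Fin m) ℂ) i j))))
    convert! h1 using 2
    · rename_i ν
      have e1 : (1 : Matrix (Fin m ⊕ Fin m) (Fin m ⊕ Fin m) ℂ) (.inl i) (.inl j) =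
          (1 : Matrix (Fin m) (Fin m) ℂ) i j := by
        simp [Matrix.one_apply]
      have e2 : (1 : Matrix (Fin m ⊕ Fin m) (Fin m ⊕ Fin m) ℂ) (.inr i) (.inr j) =
          (1 : Matrix (Fin m) (Fin m) ℂ) i j := by
        simp [Matrix.one_apply]
      have e3 : (1 : Matrix (Fin m ⊕ Fin m) (Fin m ⊕ Fin m) ℂ) (.inl i) (.inr j) = 0 := by
        simp [Matrix.one_apply]
      have e4 : (1 : Matrix (Fin m ⊕ Fin m) (Fin m ⊕ Fin m) ℂ) (.inr i) (.inl j) = 0 := by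
        simp [Matrix.one_apply]
      simp only [reducedBlock, Matrix.smul_apply, Matrix.of_apply, Matrix.sub_apply, e1, e2, e3, e4,
        smul_eq_mul, hudef, map_pow]
      ring
    · have e5 : ∀ c : ℂ, ((c.re : ℝ) : ℂ) = (c + (starRingEnd ℂ) c) / 2 := fun c => by
        rw [Complex.add_conj]
        push_cast
        ring
      simp only [Matrix.smul_apply, Matrix.mul_diagonal, Matrix.diagonal_mul, Matrix.sub_apply,
        Matrix.map_apply, Matrix.add_apply, Matrix.neg_apply, realDifference, Matrix.of_apply,
        scaledBlock_apply, Sum.elim_inl, Sum.elim_inr, entryIndex, rowMap, unitDrift, joinEntries,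
        LinearMap.mulLeft_apply, LinearMap.neg_apply, LinearMap.comp_apply, id_eq, smul_eq_mul,
        Complex.real_smul, Complex.coe_algebraMap, Complex.ofReal_neg, e5, map_sub, Matrix.zero_apply,
        AlgEquiv.toLinearMap_apply, Complex.conjAe_coe, map_zero, mul_zero, neg_zero, sub_zero]
      have e6 : (starRingEnd ℂ) ((1 : Matrix (Fin m) (Fin m) ℂ) i j) = (1 : Matrix (Fin m) (Fin m) ℂ) i j := by
        simp only [Matrix.one_apply]
        split_ifs <;> simp
      rw [e6]
      push_cast
      ring_nf
      simp only [Complex.I_sq]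
      ring
  have hdet := ((continuous_id.matrix_det).tendsto _).comp hlim
  have e : (((-2 : ℂ) • (Matrix.diagonal (fun j => (s j : ℂ) ^ 2) *
        (z • 1 - (-realDifference p).map (algebraMap ℝ ℂ)) * Matrix.diagonal fun j => (s j : ℂ) ^ 2))).det =
      (-2) ^ m * (∏ j, (s j : ℂ) ^ 2) ^ 2 * (z • 1 - (-realDifference p).map (algebraMap ℝ ℂ)).det := by
    rw [Matrix.det_smul, Matrix.det_mul, Matrix.det_mul, Matrix.det_diagonal, Fintype.card_fin]
    ring
  rw [← e]
  exact hdet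

/-- Along potentials for which the evolution is linearized with increasing precision and the noise
converges, the eigenvalue processes converge. -/
theorem IsCriticalRegime.tendsto_eigenvalueProcess_rescaledOperator (h : IsCriticalRegime e s n σ)
    (hG : G.IsSymm) (hO : O ∈ Matrix.orthogonalGroup (Fin m) ℝ)
    (hH : ∀ ν, (r ν • G) * O = O * Matrix.diagonal fun j => lam - e ν j)
    (hu : ∀ j, Tendsto (fun ν => (1 / σ ν) * ‖unitRoot (e ν j) ^ (n ν + 1) - 1‖) atTop (𝓝 0))
    {v : ∀ ν, Fin m × Fin (n ν) → ℝ} {τ : ℕ → ℝ} (hτ : Tendsto τ atTop (𝓝 0)) {R : ℝ} (hR : 0 < R)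
    (hv : ∀ ν, IsLinearized (r ν • G) O (e ν) lam (σ ν) (τ ν) R (v ν)) {p : NoiseIndex m → ℂ}
    (hp : Tendsto (fun ν => noiseValue O (fun j => criticalAngle (e ν j)) (v ν) (n ν)) atTop (𝓝 p)) :
    Tendsto (fun ν => eigenvalueProcess (rescaledOperator G lam (r ν) (σ ν) (n ν) (v ν))) atTop
      (𝓝 (eigenvalueProcess (-realDifference p))) := by
  choose c hc hcd using fun ν => det_sub_rescaledOperator (h.elliptic ν) hO (h.pos ν) (hH ν) (n ν)
  -- Symmetry holds for the noise of every box and passes to the limit.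
  have hps : (realDifference p).IsSymm := by
    refine tendsto_nhds_unique (((continuous_id.matrix_transpose.comp continuous_realDifference).tendsto p).comp hp)
      (((continuous_realDifference.tendsto p).comp hp).congr fun ν => ?_)
    exact (isSymm_realDifference_noiseValue O _ (v ν) (n ν)).eq.symm
  refine tendsto_eigenvalueProcess (fun ν => isHermitian_map (isSymm_rescaledOperator hG _ _ _ _ _))
    (isHermitian_map hps.neg) hc (c' := (-2) ^ m * (∏ j, (s j : ℂ) ^ 2) ^ 2) ?_ fun z _ => ?_
  · refine mul_ne_zero (pow_ne_zero _ (by norm_num)) (pow_ne_zero _ (Finset.prod_ne_zero_iff.2 fun j _ => ?_))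
    exact pow_ne_zero _ (Complex.ofReal_ne_zero.2 (h.scale_ne_zero j))
  simp only [hcd]
  refine h.tendsto_reducedBlock hu fun x y => ?_
  have h1 : Tendsto (fun ν => (scaledBlock s (noiseValue O (fun j => criticalAngle (e ν j)) (v ν) (n ν)) +
      z • scaledBlock s (unitDrift m)) x y) atTop
      (𝓝 ((scaledBlock s p + z • scaledBlock s (unitDrift m)) x y)) := by
    have h2 : Continuous fun p : NoiseIndex m → ℂ => (scaledBlock s p + z • scaledBlock s (unitDrift m)) x y := by
      have h3 : Continuous fun p : NoiseIndex m → ℂ => scaledBlock s p x y := by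
        simp only [scaledBlock_apply]
        have h4 : Continuous fun c => rowMap x c := (rowMap x).continuous_of_finiteDimensional
        have h5 : Continuous fun p : NoiseIndex m → ℂ => rowMap x (p (entryIndex x y)) :=
          h4.comp (continuous_apply _)
        exact h5.const_smul (s (x.elim id id) * s (y.elim id id))
      exact h3.add continuous_const
    exact (h2.tendsto p).comp hp
  refine (tendsto_iff_of_dist ?_).1 h1
  rw [Metric.tendsto_atTop]
  intro ε hε
  have h2 := h.eventually_norm_boxEvolution_sub_le hO hH (show 0 < ε / 6 by positivity) hR
    (show 0 < ‖z‖ + 1 by positivity)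
  obtain ⟨N, hN⟩ := eventually_atTop.1 ((h2.and (hτ.eventually_lt_const (show 0 < ε / 6 by positivity))).and
    (h.chaotic.tendsto_length.eventually_gt_atTop 0))
  refine ⟨N, fun ν hν => ?_⟩
  obtain ⟨⟨h3, h4⟩, h5⟩ := hN ν hν
  have h6 := h3 (v ν) ((hv ν).mono (h.pos ν) h4.le) z (by linarith) (n ν) le_rfl x y
  rw [div_self (Nat.cast_ne_zero.2 h5.ne' : (n ν : ℝ) ≠ 0), Complex.ofReal_one, mul_one, Matrix.sub_apply] at h6
  rw [Real.dist_eq, sub_zero, abs_of_nonneg dist_nonneg, dist_comm, dist_eq_norm]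
  linarith

/-- If the evolution is linearized precisely enough, then the eigenvalue process of the rescaled
operator is close to that of the matrix of the noise. -/
theorem IsCriticalRegime.exists_abs_eigenvalueProcess_sub_le (h : IsCriticalRegime e s n σ)
    (hG : G.IsSymm) (hO : O ∈ Matrix.orthogonalGroup (Fin m) ℝ)
    (hH : ∀ ν, (r ν • G) * O = O * Matrix.diagonal fun j => lam - e ν j)
    (hu : ∀ j, Tendsto (fun ν => (1 / σ ν) * ‖unitRoot (e ν j) ^ (n ν + 1) - 1‖) atTop (𝓝 0))
    {R : ℝ} (hR : 0 < R) {f : LocallyFiniteMeasures → ℝ} (hf : Continuous f) {ε : ℝ} (hε : 0 < ε) :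
    ∃ τ : ℝ, 0 < τ ∧ ∀ᶠ ν in atTop, ∀ v : Fin m × Fin (n ν) → ℝ,
      IsLinearized (r ν • G) O (e ν) lam (σ ν) τ R v →
      |f (eigenvalueProcess (rescaledOperator G lam (r ν) (σ ν) (n ν) v)) -
        f (differenceProcess (noiseValue O (fun j => criticalAngle (e ν j)) (-v) (n ν)))| ≤ ε := by
  -- If no precision worked, there would be potentials with precisions `1 / (k + 1)`, at indices
  -- beyond `k`, violating the bound. The deterministic limit along a subsequence contradicts this,
  -- and no metric on the space of configurations is needed.
  by_contra hcon
  push Not at hcon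
  have h1 : ∀ k : ℕ, ∃ ν ≥ k, ∃ v : Fin m × Fin (n ν) → ℝ,
      IsLinearized (r ν • G) O (e ν) lam (σ ν) (1 / ((k : ℝ) + 1)) R v ∧
      ε < |f (eigenvalueProcess (rescaledOperator G lam (r ν) (σ ν) (n ν) v)) -
        f (differenceProcess (noiseValue O (fun j => criticalAngle (e ν j)) (-v) (n ν)))| := by
    intro k
    obtain ⟨ν, hν, h2⟩ := (frequently_atTop.1 (hcon _ (Nat.one_div_pos_of_nat (n := k)))) k
    exact ⟨ν, hν, h2⟩
  choose φ hφ v hv hfar using h1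
  have hφt : Tendsto φ atTop atTop := tendsto_atTop_mono hφ tendsto_id
  have hbound : ∀ k, noiseValue O (fun j => criticalAngle (e (φ k) j)) (v k) (n (φ k)) ∈
      Metric.closedBall (0 : NoiseIndex m → ℂ) R := by
    intro k
    rw [mem_closedBall_zero_iff]
    exact (pi_norm_le_iff_of_nonneg hR.le).2 ((hv k _ le_rfl).2)
  -- The noise values stay in a ball of radius `R` in a finite-dimensional space, hence converge
  -- along a subsequence.
  obtain ⟨p, -, ψ, hψ, hp⟩ := (isCompact_closedBall (0 : NoiseIndex m → ℂ) R).tendsto_subseq hbound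
  have hφψ : Tendsto (fun k => φ (ψ k)) atTop atTop := hφt.comp hψ.tendsto_atTop
  have hτ0 : Tendsto (fun k => 1 / ((ψ k : ℝ) + 1)) atTop (𝓝 0) :=
    (tendsto_one_div_add_atTop_nhds_zero_nat (𝕜 := ℝ)).comp hψ.tendsto_atTop
  have hM := (h.comp hφψ).tendsto_eigenvalueProcess_rescaledOperator (r := fun k => r (φ (ψ k))) (lam := lam) hG hO
    (fun k => hH _) (fun j => (hu j).comp hφψ) (v := fun k => v (ψ k)) hτ0 hR (fun k => hv (ψ k)) hp
  have hps : (realDifference p).IsSymm := by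
    refine tendsto_nhds_unique (((continuous_id.matrix_transpose.comp continuous_realDifference).tendsto p).comp hp)
      (((continuous_realDifference.tendsto p).comp hp).congr fun k => ?_)
    exact (isSymm_realDifference_noiseValue _ _ _ _).eq.symm
  have hps' : (realDifference (-p)).IsSymm := by
    rw [realDifference_neg]
    exact hps.neg
  have hK := (continuous_differenceProcess.tendsto (-p)).comp hp.neg
  rw [differenceProcess_of_isSymm hps', realDifference_neg] at hK
  have hK' : Tendsto (fun k => differenceProcess (noiseValue O (fun j => criticalAngle (e (φ (ψ k)) j))
      (-v (ψ k)) (n (φ (ψ k))))) atTop (𝓝 (eigenvalueProcess (-realDifference p))) :=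
    hK.congr fun k => by
      rw [noiseValue_neg]
      rfl
  have hlim := (((hf.tendsto _).comp hM).sub ((hf.tendsto _).comp hK')).abs
  rw [sub_self, abs_zero] at hlim
  obtain ⟨k, hk⟩ := (hlim.eventually_lt_const hε).exists
  exact lt_asymm hk (hfar (ψ k))

end DeterministicLimit

/-! ### Convergence in law of the eigenvalue process -/

section EigenvalueLimit

variable {Ω : ℕ → Type*} [∀ ν, MeasurableSpace (Ω ν)] {P : ∀ ν, Measure (Ω ν)}
  [∀ ν, IsProbabilityMeasure (P ν)] {m : ℕ} {e : ℕ → Fin m → ℝ} {s : Fin m → ℝ} {n : ℕ → ℕ}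
  {σ r : ℕ → ℝ} {V : ∀ ν, Fin m × Fin (n ν) → Ω ν → ℝ} {K : ℝ}
  {G O : Matrix (Fin m) (Fin m) ℝ} {lam : ℝ}
  {Ω' : Type*} [MeasurableSpace Ω'] {P' : Measure Ω'} [IsProbabilityMeasure P']
  {A B : unitInterval → Ω' → Matrix (Fin m) (Fin m) ℂ}

/-- The exceptional set need not be measurable; it is replaced by its measurable hull, which has the
same measure. -/
theorem abs_integral_sub_le_of_measure_le {Ω : Type*} [MeasurableSpace Ω] {P : Measure Ω}
    [IsProbabilityMeasure P] {f g : Ω → ℝ} {M ε : ℝ} (hf : AEStronglyMeasurable f P)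
    (hg : AEStronglyMeasurable g P) (hfM : ∀ ω, |f ω| ≤ M) (hgM : ∀ ω, |g ω| ≤ M) (hε : 0 ≤ ε)
    {D : Set Ω} (hfg : ∀ ω ∉ D, |f ω - g ω| ≤ ε) (hD : P D ≤ ENNReal.ofReal ε) :
    |∫ ω, f ω ∂P - ∫ ω, g ω ∂P| ≤ ε + 2 * M * ε := by
  have hfi : Integrable f P := Integrable.of_bound hf M (ae_of_all _ hfM)
  have hgi : Integrable g P := Integrable.of_bound hg M (ae_of_all _ hgM)
  have hM : 0 ≤ M := by
    obtain ⟨ω⟩ := (inferInstance : NeBot (ae P)).nonempty_of_mem univ_mem |>.to_type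
    exact (abs_nonneg _).trans (hfM ω)
  have hDm := measurableSet_toMeasurable P D
  have hDle : P.real (toMeasurable P D) ≤ ε := by
    rw [measureReal_def, measure_toMeasurable]
    exact ENNReal.toReal_le_of_le_ofReal hε hD
  rw [← integral_sub hfi hgi]
  refine (abs_integral_le_integral_abs).trans ?_
  have hint : Integrable (fun ω => ε + (toMeasurable P D).indicator (fun _ => 2 * M) ω) P :=
    (integrable_const _).add ((integrable_const _).indicator hDm)
  refine (integral_mono (hfi.sub hgi).abs hint fun ω => ?_).trans ?_
  · by_cases hω : ω ∈ toMeasurable P D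
    · simp only [Set.indicator_of_mem hω, Pi.sub_apply]
      have := abs_sub (f ω) (g ω)
      linarith [hfM ω, hgM ω]
    · simp only [Set.indicator_of_notMem hω, add_zero, Pi.sub_apply]
      exact hfg ω fun h => hω (subset_toMeasurable P D h)
  · rw [integral_add (integrable_const _) ((integrable_const _).indicator hDm), integral_const,
      probReal_univ, one_smul, integral_indicator_const _ hDm, smul_eq_mul, mul_comm]
    gcongr

/-- The sums of the noise of the whole box converge in distribution. -/
theorem IsCriticalRegime.tendstoInDistribution_noiseValue_length (h : IsCriticalRegime e s n σ)
    (hK : 0 ≤ K) (hV : ∀ ν, IsBoxNoise (P ν) (V ν) K) (hAB : IsDrivingBrownianMotion O A B P') :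
    TendstoInDistribution (fun ν ω =>
        noiseValue O (fun j => criticalAngle (e ν j)) (-fun p => V ν p ω) (n ν))
      atTop (fun ω => joinEntries (A 1 ω) (B 1 ω)) P P' := by
  have hev : Continuous fun f : PathSpace (NoiseIndex m → ℂ) => UniformFun.toFun f 1 := by
    have : LipschitzWith 1 fun f : PathSpace (NoiseIndex m → ℂ) => UniformFun.toFun f 1 := by
      intro f g
      rw [ENNReal.coe_one, one_mul]
      exact PathSpace.edist_le_edist_mk (f := UniformFun.toFun f) (g := UniformFun.toFun g) 1
    exact this.continuous
  -- Applied to `-V`: the eigenvalues for the potential `v` follow `-Re (A - B)` evaluated at the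
  -- noise of `v`, and changing the sign of the potential removes the minus sign.
  have h1 := (h.tendstoInDistribution_noiseValue hK (fun ν => (hV ν).neg) hAB).continuous_comp hev
  have e1 : ∀ ν, ⌊(n ν : ℝ) * ((1 : unitInterval) : ℝ)⌋₊ = n ν := fun ν => by simp
  refine h1.congr (fun ν => ae_of_all _ fun ω => ?_) (ae_of_all _ fun ω => rfl)
  change noiseValue O (fun j => criticalAngle (e ν j)) (fun p => -V ν p ω)
    ⌊(n ν : ℝ) * ((1 : unitInterval) : ℝ)⌋₊ = _
  rw [e1]
  rfl

/-- Convergence of the eigenvalue process of the rescaled operator. -/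
theorem IsCriticalRegime.eigenvalueProcess_tendstoInDistribution (h : IsCriticalRegime e s n σ)
    (hG : G.IsSymm) (hO : O ∈ Matrix.orthogonalGroup (Fin m) ℝ)
    (hH : ∀ ν, (r ν • G) * O = O * Matrix.diagonal fun j => lam - e ν j)
    (hu : ∀ j, Tendsto (fun ν => (1 / σ ν) * ‖unitRoot (e ν j) ^ (n ν + 1) - 1‖) atTop (𝓝 0))
    (hK : 0 ≤ K) (hV : ∀ ν, IsBoxNoise (P ν) (V ν) K) (hAB : IsDrivingBrownianMotion O A B P') :
    TendstoInDistribution (fun ν ω => eigenvalueProcess (rescaledOperator G lam (r ν) (σ ν) (n ν)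
        fun p => V ν p ω))
      atTop (fun ω => eigenvalueProcess ((A 1 ω - B 1 ω).map Complex.re)) P P' := by
  have hlim := (h.tendstoInDistribution_noiseValue_length hK hV hAB).continuous_comp
    (continuous_differenceProcess (m := m))
  have hlim' : TendstoInDistribution (fun ν ω => differenceProcess
      (noiseValue O (fun j => criticalAngle (e ν j)) (-fun p => V ν p ω) (n ν))) atTop
      (fun ω => eigenvalueProcess ((A 1 ω - B 1 ω).map Complex.re)) P P' := by
    refine hlim.congr (fun ν => ae_of_all _ fun ω => rfl) ?_
    filter_upwards [hAB.hermitian, hAB.symmetric] with ω h1 h2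
    have h3 : realDifference (joinEntries (A 1 ω) (B 1 ω)) = (A 1 ω - B 1 ω).map Complex.re := rfl
    have h4 : (realDifference (joinEntries (A 1 ω) (B 1 ω))).IsSymm := by
      ext i j
      have h5 := congrArg Complex.re ((h1 1).apply i j)
      have h6 := (h2 1).apply i j
      simp only [Matrix.transpose_apply, realDifference, Matrix.of_apply, joinEntries, Sum.elim_inl,
        Sum.elim_inr, Complex.sub_re, h6]
      rw [← h5]
      simp
    rw [Function.comp_apply, differenceProcess_of_isSymm h4, h3]
  have hmeas : ∀ ν, Measurable fun ω => eigenvalueProcess (rescaledOperator G lam (r ν) (σ ν) (n ν)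
        fun p => V ν p ω) := by
    intro ν
    have h1 : Continuous fun v : Fin m × Fin (n ν) → ℝ =>
        eigenvalueProcess (rescaledOperator G lam (r ν) (σ ν) (n ν) v) :=
      continuous_eigenvalueProcess (continuous_rescaledOperator G lam _ _ _) fun v =>
        isHermitian_map (isSymm_rescaledOperator hG _ _ _ _ _)
    exact h1.measurable.comp (measurable_pi_lambda _ fun p => (hV ν).measurable p)
  refine ⟨fun ν => (hmeas ν).aemeasurable, hlim'.aemeasurable_limit, ?_⟩
  -- A bounded continuous `f` takes nearly equal values at the eigenvalue process and at the process
  -- of the noise matrix, uniformly over all potentials with linearized evolution; the remaining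
  -- potentials have small probability. The known limit for the noise matrix then carries over.
  refine ProbabilityMeasure.tendsto_iff_forall_integral_tendsto.2 fun f => ?_
  have hf := (ProbabilityMeasure.tendsto_iff_forall_integral_tendsto.1 hlim'.tendsto) f
  refine (tendsto_iff_of_dist ?_).1 hf
  simp only [ProbabilityMeasure.coe_mk]
  simp only [integral_map (hmeas _).aemeasurable f.continuous.measurable.aestronglyMeasurable,
    integral_map (hlim'.forall_aemeasurable _) f.continuous.measurable.aestronglyMeasurable]
  rw [Metric.tendsto_atTop]
  intro ε hε
  obtain ⟨δ, hδ, hδε⟩ : ∃ δ : ℝ, 0 < δ ∧ δ + 2 * ‖f‖ * δ < ε := by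
    refine ⟨ε / (2 * (1 + 2 * ‖f‖)), by positivity, ?_⟩
    have : ε / (2 * (1 + 2 * ‖f‖)) + 2 * ‖f‖ * (ε / (2 * (1 + 2 * ‖f‖))) = ε / 2 := by
      field_simp
    rw [this]
    linarith
  obtain ⟨R, hR, h1⟩ := h.exists_measure_not_isLinearized_le hO hH hK hV hδ
  obtain ⟨τ, hτ, h2⟩ := h.exists_abs_eigenvalueProcess_sub_le hG hO hH hu hR f.continuous hδ
  obtain ⟨N, hN⟩ := eventually_atTop.1 ((h1 τ hτ).and h2)
  refine ⟨N, fun ν hν => ?_⟩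
  rw [Real.dist_eq, sub_zero, abs_of_nonneg dist_nonneg, dist_comm, Real.dist_eq]
  refine lt_of_le_of_lt (abs_integral_sub_le_of_measure_le
    (f.continuous.measurable.comp_aemeasurable (hmeas ν).aemeasurable).aestronglyMeasurable
    (f.continuous.measurable.comp_aemeasurable (hlim'.forall_aemeasurable ν)).aestronglyMeasurable
    (fun ω => f.norm_coe_le_norm _) (fun ω => f.norm_coe_le_norm _) hδ.le (fun ω hω => ?_) (hN ν hν).1) hδε
  exact (hN ν hν).2 _ (not_not.1 hω)

end EigenvalueLimit

end LongBox

end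

/-! ### The main theorem -/

theorem mainTheorem4 {m : ℕ}
    -- the base: a symmetric matrix `G = O D Oᵀ` with distinct eigenvalues
    (G O : Matrix (Fin m) (Fin m) ℝ) (d : Fin m → ℝ)
    (hO : O ∈ Matrix.orthogonalGroup (Fin m) ℝ)
    (hG : G = O * Matrix.diagonal d * O.transpose)
    (hd : Function.Injective d)
    -- the reference energy
    (lam : ℝ) (hlam : ∀ j j', (2 - lam) / (2 + lam) ≠ d j / d j')
    -- the weights, with linearly independent critical angles, and `S = lim S_ν`
    (r : ℕ → ℝ) (r' : ℝ) (hr : Tendsto r atTop (𝓝 r'))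
    (hcrit : ∀ ν j, |lam - r ν * d j| < 2)
    (hindep : ∀ ν, LinearIndependent ℤ
      (fun j : Fin m => LongBox.criticalAngle (lam - r ν * d j)))
    (S : Matrix (Fin m ⊕ Fin m) (Fin m ⊕ Fin m) ℂ)
    (hS : Tendsto (fun ν => LongBox.sMatrix (fun j => lam - r ν * d j)) atTop (𝓝 S))
    -- the lengths
    (n : ℕ → ℕ)
    (hn : ∀ j, Tendsto (fun ν =>
      ((((n ν : ℝ) + 1) * LongBox.criticalAngle (lam - r ν * d j) : ℝ) : Real.Angle))
      atTop (𝓝 0))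
    (hncha : Tendsto (fun ν => (n ν : ℝ) * LongBox.chaoticity
      (fun j => (LongBox.criticalAngle (lam - r ν * d j) : Real.Angle))) atTop atTop)
    -- the noise levels
    (σ : ℕ → ℝ) (hσpos : ∀ ν, 0 < σ ν) (hσ : Tendsto σ atTop (𝓝 0))
    (hσn : ∀ j, Tendsto (fun ν => (1 / σ ν) * ‖Complex.exp (Complex.I *
      ((((n ν : ℝ) + 1) * LongBox.criticalAngle (lam - r ν * d j) : ℝ) : ℂ)) - 1‖) atTop (𝓝 0))
    (hσcha : Tendsto (fun ν => σ ν * (n ν : ℝ) * LongBox.chaoticity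
      (fun j => (LongBox.criticalAngle (lam - r ν * d j) : Real.Angle))) atTop atTop)
    -- the random diagonal perturbations
    {Ω : ℕ → Type*} [∀ ν, MeasurableSpace (Ω ν)] (P : ∀ ν, Measure (Ω ν))
    [∀ ν, IsProbabilityMeasure (P ν)]
    (V : ∀ ν, Fin m × Fin (n ν) → Ω ν → ℝ)
    (hVmeas : ∀ ν p, Measurable (V ν p))
    (hVindep : ∀ ν, iIndepFun (V ν) (P ν))
    (hVmean : ∀ ν p, ∫ ω, V ν p ω ∂(P ν) = 0)
    (hVvar : ∀ ν p, ∫ ω, V ν p ω ^ 2 ∂(P ν) = 1)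
    (K : NNReal) (hVthird : ∀ ν p, ∫⁻ ω, ENNReal.ofReal (|V ν p ω| ^ 3) ∂(P ν) ≤ K)
    -- the limiting Brownian motions
    {Ω' : Type*} [MeasurableSpace Ω'] (P' : Measure Ω') [IsProbabilityMeasure P']
    (A B : unitInterval → Ω' → Matrix (Fin m) (Fin m) ℂ)
    (hAB : LongBox.IsDrivingBrownianMotion O A B P') :
    -- convergence of the regularized transfer matrix evolution
    (∀ Λ : Finset ℂ,
      TendstoInDistribution
        (fun ν ω => LongBox.PathSpace.mk (fun t : unitInterval => fun z : Λ =>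
          ((1 / σ ν : ℝ) : ℂ) •
            (LongBox.regularizedEvolution (r ν • G) O (fun j => lam - r ν * d j) lam
              (fun k => (σ ν / √(n ν : ℝ)) • LongBox.slice (fun p => V ν p ω) k)
              ((lam : ℂ) + (z : ℂ) * (σ ν : ℂ) / (n ν : ℂ)) ⌊(n ν : ℝ) * (t : ℝ)⌋₊ - 1)))
        atTop
        (fun ω => LongBox.PathSpace.mk (fun t : unitInterval => fun z : Λ =>
          LongBox.limitMatrix S (A t ω) (B t ω) (z : ℂ) (t : ℝ)))
        P P') ∧
    -- convergence of the eigenvalue process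
    TendstoInDistribution
      (fun ν ω => LongBox.eigenvalueProcess
        (LongBox.rescaledOperator G lam (r ν) (σ ν) (n ν) (fun p => V ν p ω)))
      atTop
      (fun ω => LongBox.eigenvalueProcess ((A 1 ω - B 1 ω).map Complex.re))
      P P' := by
  have hH : ∀ ν, (r ν • G) * O = O * Matrix.diagonal fun j => lam - (lam - r ν * d j) := by
    intro ν
    have h1 : O.transpose * O = 1 := (Matrix.mem_orthogonalGroup_iff' (Fin m) ℝ).1 hO
    have h2 : (Matrix.diagonal fun j => lam - (lam - r ν * d j)) = r ν • Matrix.diagonal d := by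
      rw [← Matrix.diagonal_smul]
      congr 1
      funext j
      simp
    rw [h2, hG, Matrix.smul_mul, Matrix.mul_smul, Matrix.mul_assoc, h1, Matrix.mul_one]
  have hGs : G.IsSymm := by
    rw [Matrix.IsSymm, hG, Matrix.transpose_mul, Matrix.transpose_mul, Matrix.transpose_transpose,
      Matrix.diagonal_transpose, Matrix.mul_assoc]
  -- The limiting `S` is `diag (s, s)` with real entries, which turns the limit matrix into an
  -- affine function of the entries of `A` and `B`.
  obtain ⟨s, rfl, hs⟩ := LongBox.exists_eq_doubledDiagonal hS
  have h : LongBox.IsCriticalRegime (fun ν j => lam - r ν * d j) s n σ := ⟨hcrit, hs, hncha, hσpos, hσ⟩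
  have hV : ∀ ν, LongBox.IsBoxNoise (P ν) (V ν) K := fun ν =>
    LongBox.isBoxNoise_of_lintegral (hVmeas ν) (hVindep ν) (hVmean ν) (hVvar ν) (hVthird ν)
  -- The rate for the angles `(n + 1) q_j` is rewritten for the powers of the roots `z_j`, as they
  -- occur in the reduced block.
  have hu : ∀ j, Tendsto (fun ν => (1 / σ ν) *
      ‖LongBox.unitRoot (lam - r ν * d j) ^ (n ν + 1) - 1‖) atTop (𝓝 0) := by
    intro j
    refine (hσn j).congr fun ν => ?_
    rw [LongBox.unitRoot_eq_exp (hcrit ν j), ← Complex.exp_nat_mul]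
    congr 4
    push_cast
    ring
  refine ⟨fun Λ => ?_, h.eigenvalueProcess_tendstoInDistribution hGs hO hH hu K.coe_nonneg hV hAB⟩
  have h1 := h.tendstoInDistribution_boxEvolution hO hH K.coe_nonneg hV hAB Λ
  refine TendstoInDistribution.congr (fun ν => ae_of_all _ fun ω => rfl)
    (ae_of_all _ fun ω => ?_) h1
  refine congrArg LongBox.PathSpace.mk (funext fun t => funext fun z => ?_)
  rw [LongBox.limitMatrix_doubledDiagonal]
  rfl
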